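/- **Setting.** Let $n\ge 5$, $m\ge 2$, $0<\sigma<1/2$, $\kappa>0$, and let $\chi:\mathbf R^n\to[0,\infty)$ be a smooth radial function supported on $|\xi|\le 2$ and equal to $1$ on $|\xi|\le 1$. For $k\in\mathbf Z$ let $P_{\le k}=P_{<k+1}$ be the Fourier multiplier in the space variable with symbol $\chi(2^{-k}\xi)$ (that is, convolution with its Schwartz kernel), and $P_k=P_{\le k}-P_{<k}$. Let $\eta=\mathrm{diag}(-1,1,\dots,1)$ and $\Box=\partial_\alpha\partial^\alpha=\Delta-\partial_t^2$. For $T>0$ all spacetime norms are taken over $[0,T]\times\mathbf R^n$, matrices carry the Euclidean operator norm, and $$\|\phi\|_{S_k}=\sup_{(q,r)}2^{k/q+kn/r}\big(\|\phi\|_{L^q_tL^r_x}+2^{-k}\|\partial_t\phi\|_{L^q_tL^r_x}\big),$$ the supremum being over all $2\le q,r\le\infty$ with $\frac1q+\frac{(n-1)/2}{r}\le\frac{(n-1)/2}{2}$. A *frequency envelope* (with parameters $\kappa,\sigma,\varepsilon$) is a sequence of positive reals $c=(c_k)_{k\in\mathbf Z}$ with $\|c\|_{\ell^2}\le\kappa\varepsilon$,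 $\;2^{-\sigma|k-k'|}c_{k'}\le\kappa c_k$ and $c_k\le\kappa 2^{\sigma|k-k'|}c_{k'}$ for all $k,k'$. A *classical wave map* on $[0,T]\times\mathbf R^n$ is a function $\phi$ with values in the unit sphere $S^{m-1}\subset\mathbf R^m$ which is smooth on $[0,T]\times\mathbf R^n$, equal to a constant outside a finite union of (solid) light cones, and satisfies $\partial_\alpha\partial^\alpha\phi=-\phi\,\partial_\alpha\phi^\dagger\partial^\alpha\phi$. Given $\phi$ and an integer $M$, define $m\times m$ matrix fields recursively, for $k>-M$, by $$U_{<k}=I+\sum_{-M<k'<k}U_{k'},\qquad U_k=\big((P_k\phi)(P_{<k}\phi)^\dagger-(P_{<k}\phi)(P_k\phi)^\dagger\big)U_{<k},$$ and put $$U=I+\sum_{-M<k\le-10}U_k,\qquad A_\alpha=(\partial_\alpha\tilde\phi)\tilde\phi^\dagger-\tilde\phi(\partial_\alpha\tilde\phi)^\dagger,\qquad \tilde\phi=P_{\le-10}\phi.$$ **Proposition 6.1.** There is a constant $C>0$ depending only on $n,m,\sigma,\kappa,\chi$ such that for every $C_0\ge1$ there is $\varepsilon_0>0$ such that for every $0<\varepsilon\le\varepsilon_0$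 and every $0<T<\infty$ there is an integer $M_0$ such that for every integer $M\ge M_0$ the following holds. Let $c$ be a frequency envelope and $\phi$ a classical wave map on $[0,T]\times\mathbf R^n$ such that $$\|P_k\phi\|_{S_k}\le 2C_0c_k\qquad\text{for all }k\in\mathbf Z.$$ Then $U$ is smooth on $(0,T)\times\mathbf R^n$, and $$\|U^\dagger U-I\|_{L^\infty_tL^\infty_x},\ \ \|\partial_t(U^\dagger U-I)\|_{L^\infty_tL^\infty_x}\le C\,C_0^2\varepsilon;$$ $U$ is invertible at every point of $[0,T]\times\mathbf R^n$, and $$\|U\|_{L^\infty_tL^\infty_x},\ \ \|U^{-1}\|_{L^\infty_tL^\infty_x}\le C;$$ for every $\alpha=0,\dots,n$, $$\|\partial_\alpha U-A_\alpha U\|_{L^1_tL^\infty_x}\le C\,C_0^2\varepsilon,\qquad \|\partial_\alpha U\|_{L^\infty_tL^\infty_x}\le C\,C_0^2\varepsilon,\qquad \|\partial_\alpha U\|_{L^2_tL^\infty_x}\le C\,C_0^2\varepsilon;$$ and $$\|\Box U\|_{L^2_tL^{n-1}_x}\le C\,C_0^2\varepsilon .$$ -/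

import Mathlib

open MeasureTheory Set
open scoped ENNReal ContDiff FourierTransform Matrix Matrix.Norms.L2Operator

noncomputable section

namespace WaveMap

/-- Euclidean space of dimension `d`. -/
abbrev E (d : ℕ) : Type := EuclideanSpace ℝ (Fin d)

/-- Points `(t, x)` of Minkowski space `ℝ^{1+n}`. -/
abbrev Spacetime (n : ℕ) : Type := ℝ × E n

/-- Real `m × m` matrices (normed by the Euclidean operator norm). -/
abbrev Mat (m : ℕ) : Type := Matrix (Fin m) (Fin m) ℝ

/-- The closed slab `[0, T] × ℝⁿ`. -/
def slab (n : ℕ) (T : ℝ) : Set (Spacetime n) := Icc 0 T ×ˢ univ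

/-- The open slab `(0, T) × ℝⁿ`. -/
def openSlab (n : ℕ) (T : ℝ) : Set (Spacetime n) := Ioo 0 T ×ˢ univ

/-! Derivatives in Minkowski space -/

/-- The coordinate vectors of `ℝ^{1+n}`; the index `0` is the time direction. -/
def coordVec {n : ℕ} (α : Fin (n + 1)) : Spacetime n :=
  Fin.cases (1, 0) (fun i => (0, EuclideanSpace.single i 1)) α

/-- The partial derivative `∂_α F`. -/
def pd {n : ℕ} {V : Type*} [NormedAddCommGroup V] [NormedSpace ℝ V]
    (α : Fin (n + 1)) (F : Spacetime n → V) : Spacetime n → V :=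
  fun p => fderiv ℝ F p (coordVec α)

/-- The diagonal entries of the Minkowski metric `η = diag(-1, 1, …, 1)`. -/
def eta {n : ℕ} (α : Fin (n + 1)) : ℝ := if α = 0 then -1 else 1

/-- The D'Alembertian `□ F = ∂_α ∂^α F = Δ F - ∂_t² F`. -/
def box {n : ℕ} {V : Type*} [NormedAddCommGroup V] [NormedSpace ℝ V]
    (F : Spacetime n → V) : Spacetime n → V :=
  fun p => ∑ α : Fin (n + 1), eta α • pd α (pd α F) p

/-! Classical wave maps into the sphere -/

/-- The (solid, two-sided) light cone with vertex `v`. -/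
def lightCone {n : ℕ} (v : Spacetime n) : Set (Spacetime n) :=
  {p | ‖p.2 - v.2‖ ≤ |p.1 - v.1|}

/-- `φ` is a classical wave map on `[0, T] × ℝⁿ` with values in `S^{m-1}`: it is smooth up to the
boundary of the slab, takes values in the unit sphere, is constant outside a finite union of light
cones, and solves `∂_α ∂^α φ = - φ (∂_α φ)† (∂^α φ)`.  (As `φ` is smooth, the equation may be
read pointwise; it is imposed on the open slab and extends to the closed one by continuity.) -/
structure IsClassicalWaveMap {n m : ℕ} (T : ℝ) (φ : Spacetime n → E m) : Prop where
  smooth : ContDiffOn ℝ ∞ φ (slab n T)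
  sphere : ∀ p ∈ slab n T, ‖φ p‖ = 1
  const_outside : ∃ (e : E m) (vertices : Finset (Spacetime n)),
    ∀ p ∈ slab n T, (∀ v ∈ vertices, p ∉ lightCone v) → φ p = e
  equation : ∀ p ∈ openSlab n T,
    box φ p = -((∑ α : Fin (n + 1), eta α * inner ℝ (pd α φ p) (pd α φ p)) • φ p)

/-! Littlewood-Paley projections -/

/-- `χ` is a non-negative radial bump function on `ℝⁿ` supported on `|ξ| ≤ 2` and equal to `1` on
`|ξ| ≤ 1`. -/
structure IsLPBump {n : ℕ} (χ : E n → ℝ) : Prop where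
  smooth : ContDiff ℝ ∞ χ
  nonneg : ∀ ξ, 0 ≤ χ ξ
  radial : ∀ ξ ζ, ‖ξ‖ = ‖ζ‖ → χ ξ = χ ζ
  support : ∀ ξ, 2 < ‖ξ‖ → χ ξ = 0
  eq_one : ∀ ξ, ‖ξ‖ ≤ 1 → χ ξ = 1

/-- The convolution kernel of `P_{≤ k}`: the inverse Fourier transform of `ξ ↦ χ(2^{-k} ξ)`, with
the normalization `∫ e^{2π i x·ξ} χ(2^{-k} ξ) dξ`.  It is a real-valued Schwartz function, because
`χ` is real and radial; `re` only passes from `ℂ` to `ℝ`. -/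
def lpKernel {n : ℕ} (χ : E n → ℝ) (k : ℤ) (y : E n) : ℝ :=
  (𝓕⁻ (fun ξ : E n => ((χ ((2 : ℝ) ^ (-k) • ξ) : ℝ) : ℂ)) y).re

/-- `P_{≤ k} φ`: the spatial Fourier multiplier with symbol `χ(2^{-k} ξ)`, written as convolution
with its kernel, so that it is defined for bounded functions, such as constants, as well. -/
def lpLe {n : ℕ} {V : Type*} [NormedAddCommGroup V] [NormedSpace ℝ V]
    (χ : E n → ℝ) (k : ℤ) (φ : Spacetime n → V) : Spacetime n → V :=
  fun p => ∫ y : E n, lpKernel χ k y • φ (p.1, p.2 - y)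

/-- `P_{< k} = P_{≤ k - 1}`. -/
def lpLt {n : ℕ} {V : Type*} [NormedAddCommGroup V] [NormedSpace ℝ V]
    (χ : E n → ℝ) (k : ℤ) (φ : Spacetime n → V) : Spacetime n → V :=
  lpLe χ (k - 1) φ

/-- `P_k = P_{≤ k} - P_{< k}`. -/
def lp {n : ℕ} {V : Type*} [NormedAddCommGroup V] [NormedSpace ℝ V]
    (χ : E n → ℝ) (k : ℤ) (φ : Spacetime n → V) : Spacetime n → V :=
  fun p => lpLe χ k φ p - lpLt χ k φ p

/-! Mixed Lebesgue norms and the Strichartz norms -/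

/-- The norm of `L^q_t L^r_x([0, T] × ℝⁿ)`. -/
def mixedNorm {n : ℕ} {V : Type*} [NormedAddCommGroup V]
    (T : ℝ) (q r : ℝ≥0∞) (F : Spacetime n → V) : ℝ≥0∞ :=
  eLpNorm (fun t : ℝ => eLpNorm (fun x : E n => F (t, x)) r volume) q (volume.restrict (Icc 0 T))

/-- The pair `(q, r)` is admissible: `2 ≤ q, r ≤ ∞` and
`1/q + ((n-1)/2)/r ≤ ((n-1)/2)/2`, where `1/∞ = 0`. -/
def Admissible (n : ℕ) (q r : ℝ≥0∞) : Prop :=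
  2 ≤ q ∧ 2 ≤ r ∧
    (q⁻¹).toReal + ((n : ℝ) - 1) / 2 * (r⁻¹).toReal ≤ ((n : ℝ) - 1) / 2 / 2

/-- The Strichartz norm at frequency `2^k`,
`‖φ‖_{S_k([0,T] × ℝⁿ)} = sup_{q,r} 2^{k/q + kn/r} (‖φ‖_{L^q_t L^r_x} + 2^{-k} ‖∂_t φ‖_{L^q_t L^r_x})`,
the supremum being over all admissible pairs. -/
def strichartzNorm {n : ℕ} {V : Type*} [NormedAddCommGroup V] [NormedSpace ℝ V]
    (T : ℝ) (k : ℤ) (φ : Spacetime n → V) : ℝ≥0∞ :=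
  ⨆ (q : ℝ≥0∞) (r : ℝ≥0∞) (_ : Admissible n q r),
    ENNReal.ofReal ((2 : ℝ) ^ ((k : ℝ) * (q⁻¹).toReal + (k : ℝ) * (n : ℝ) * (r⁻¹).toReal)) *
      (mixedNorm T q r φ + ENNReal.ofReal ((2 : ℝ) ^ (-k)) * mixedNorm T q r (pd 0 φ))

/-- `c` is a frequency envelope with parameters `σ`, `ε`; the constant `κ` is the one implicit in
the bounds `‖c‖_{l²} ≲ ε` and `2^{-σ|k-k'|} c_{k'} ≲ c_k ≲ 2^{σ|k-k'|} c_{k'}`. -/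
structure IsFrequencyEnvelope (κ σ ε : ℝ) (c : ℤ → ℝ) : Prop where
  pos : ∀ k, 0 < c k
  summable_sq : Summable fun k => c k ^ 2
  l2_bound : Real.sqrt (∑' k, c k ^ 2) ≤ κ * ε
  lower : ∀ k k' : ℤ, (2 : ℝ) ^ (-σ * |(k : ℝ) - k'|) * c k' ≤ κ * c k
  upper : ∀ k k' : ℤ, c k ≤ κ * ((2 : ℝ) ^ (σ * |(k : ℝ) - k'|) * c k')

/-! The approximate parallel transport frame -/

/-- The anti-symmetric matrix `a b† - b a†`, for column vectors `a`, `b`. -/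
def wedge {m : ℕ} (a b : E m) : Mat m :=
  Matrix.vecMulVec a.ofLp b.ofLp - Matrix.vecMulVec b.ofLp a.ofLp

/-- The matrix `U_{<k} = I + ∑_{-M < k' < k} U_{k'}`, where
`U_{k'} = (P_{k'} φ (P_{<k'} φ)† - P_{<k'} φ (P_{k'} φ)†) U_{<k'}`. -/
def frameLt {n m : ℕ} (χ : E n → ℝ) (φ : Spacetime n → E m) (M : ℤ) (k : ℤ)
    (p : Spacetime n) : Mat m :=
  1 + ∑ k' : {j : ℤ // j ∈ Finset.Ioo (-M) k},
    wedge (lp χ k'.1 φ p) (lpLt χ k'.1 φ p) * frameLt χ φ M k'.1 p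
termination_by (k + M).toNat
decreasing_by
  have h := Finset.mem_Ioo.mp k'.2
  omega

/-- `U_k = (P_k φ (P_{<k} φ)† - P_{<k} φ (P_k φ)†) U_{<k}`. -/
def frameIncr {n m : ℕ} (χ : E n → ℝ) (φ : Spacetime n → E m) (M : ℤ) (k : ℤ)
    (p : Spacetime n) : Mat m :=
  wedge (lp χ k φ p) (lpLt χ k φ p) * frameLt χ φ M k p

theorem frameLt_eq {n m : ℕ} (χ : E n → ℝ) (φ : Spacetime n → E m) (M : ℤ) (k : ℤ)
    (p : Spacetime n) :
    frameLt χ φ M k p = 1 + ∑ k' ∈ Finset.Ioo (-M) k, frameIncr χ φ M k' p := by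
  rw [frameLt, ← Finset.sum_coe_sort (Finset.Ioo (-M) k) (fun k' => frameIncr χ φ M k' p)]
  rfl

/-- The matrix field `U = I + ∑_{-M < k ≤ -10} U_k`. -/
def frame {n m : ℕ} (χ : E n → ℝ) (φ : Spacetime n → E m) (M : ℤ) (p : Spacetime n) : Mat m :=
  1 + ∑ k ∈ Finset.Ioc (-M) (-10), frameIncr χ φ M k p

/-- The matrix field `A_α = ∂_α φ̃ φ̃† - φ̃ (∂_α φ̃)†`, where `φ̃ = P_{≤ -10} φ`. -/
def connection {n m : ℕ} (χ : E n → ℝ) (φ : Spacetime n → E m) (α : Fin (n + 1))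
    (p : Spacetime n) : Mat m :=
  wedge (pd α (lpLe χ (-10) φ) p) (lpLe χ (-10) φ p)

end WaveMap

end

/-! Write `w_k` for the antisymmetric matrix `P_kφ (P_{<k}φ)† - P_{<k}φ (P_kφ)†` and `u_k` for
`U_{<k}`. The definition of the frame is the recursion `u_{k+1} = (1 + w_k) u_k`, started at
`u_{-M+1} = 1`, and `U = u_{-9}`. Every estimate is an induction on `k` (`IsFrameSeq`).

Orthogonality: since `w_k† = -w_k`, the terms linear in `w_k` cancel and `u_{k+1}† u_{k+1} - u_k†
u_k = u_k† w_k† w_k u_k`. The defect is therefore controlled by the sum of `‖w_k‖²`, for which the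
`ℓ²` smallness of the envelope suffices. This bounds all `u_k` by 2 and makes `U` invertible.

Derivatives: `∂u_{k+1} = ∂u_k + (∂w_k) u_k + w_k ∂u_k`. The norms of `∂w_k` are bounded by sequences
growing at least by a factor `ρ = 2^s > 1` at each step; for `L²L^∞` the sequence is `2^{k/2} b_k`,
and its growth is where `σ < 1/2` enters. Once `‖w_k‖ ≤ (ρ - 1)/2`, `∂u_k` obeys the same bound up
to a constant (`recursion_le`).

D'Alembertian: the same recursion runs in `L²_t L^{n-1}_x`, with cross terms `∂w_k ∂u_k` treated by
Hölder in `L⁴_t L^{2(n-1)}_x`. The source needs `□P_{≤k}φ`. The equation gives `|□φ| ≤ ∑|∂φ|²`;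
split `∂φ` at frequency `2^k`, put the low part in `L⁴L^{2(n-1)}` and the high part in `L⁴L⁴`, and
raise the resulting `L²_x` to `L^{n-1}_x` by Bernstein (`StrichartzBound.box_lpLe`).

Parallel transport: let `A_k` be the connection built from `P_{<k}φ`. In `∂w_k - (A_{k+1} - A_k)`
the term with `∂P_kφ` against `P_{<k}φ` cancels, and each remaining product contains an
undifferentiated `P_kφ`. Two `L²L^∞` factors of sizes `2^{-k/2} b_k` and `2^{k/2} b_k` give `b_k²`
in `L¹L^∞`, which is summable. The same balance handles `w_k ∂u_k` and `A_{k+1} w_k u_k`. The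
initial term `A_{-M+1}` has size about `2^{-M} b_{-M}` and costs a factor `T` in `L¹_t`, so `2^M ≥
T` is needed. -/

noncomputable section

namespace WaveMap

open Filter
open scoped Topology SchwartzMap Convolution

/-! ### Mixed Lebesgue norms on the slab: measurability, Hölder, Minkowski, Fatou -/

section

variable {n : ℕ} {V V₁ V₂ : Type*} [NormedAddCommGroup V] [NormedAddCommGroup V₁]
  [NormedAddCommGroup V₂] {T : ℝ}

theorem isOpen_openSlab (n : ℕ) (T : ℝ) : IsOpen (openSlab n T) :=
  isOpen_Ioo.prod isOpen_univ

theorem openSlab_subset_slab : openSlab n T ⊆ slab n T :=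
  prod_mono Ioo_subset_Icc_self subset_rfl

theorem ae_mem_Ioo (T : ℝ) : ∀ᵐ t ∂(volume.restrict (Icc 0 T) : Measure ℝ), t ∈ Ioo 0 T := by
  rw [← restrict_Ioo_eq_restrict_Icc]
  exact ae_restrict_mem measurableSet_Ioo

theorem continuous_slice {F : Spacetime n → V} (hF : ContinuousOn F (openSlab n T)) {t : ℝ}
    (ht : t ∈ Ioo 0 T) : Continuous fun x => F (t, x) :=
  hF.comp_continuous (by fun_prop) fun x => ⟨ht, mem_univ x⟩

/-- Writing the essential supremum as a countable supremum makes the slice norm a measurable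
function of time when `r = ∞`. -/
theorem eLpNorm_top_eq_iSup {f : E n → V} (hf : Continuous f) :
    eLpNorm f ∞ volume = ⨆ j : ℕ, ‖f (TopologicalSpace.denseSeq (E n) j)‖ₑ := by
  rw [eLpNorm_exponent_top]
  apply le_antisymm
  · refine eLpNormEssSup_le_of_ae_enorm_bound (Eventually.of_forall fun x => ?_)
    have hcl : IsClosed {x | ‖f x‖ₑ ≤ ⨆ j : ℕ, ‖f (TopologicalSpace.denseSeq (E n) j)‖ₑ} :=
      isClosed_le hf.enorm continuous_const
    have : closure (range (TopologicalSpace.denseSeq (E n))) ⊆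
        {x | ‖f x‖ₑ ≤ ⨆ j : ℕ, ‖f (TopologicalSpace.denseSeq (E n) j)‖ₑ} := by
      apply hcl.closure_subset_iff.2
      rintro _ ⟨j, rfl⟩
      exact le_iSup (fun j : ℕ => ‖f (TopologicalSpace.denseSeq (E n) j)‖ₑ) j
    exact this ((TopologicalSpace.denseRange_denseSeq (E n)) x)
  · refine iSup_le fun j => ?_
    have hd := Measure.dense_of_ae (enorm_ae_le_eLpNormEssSup f (volume : Measure (E n)))
    have hcl : IsClosed {x | ‖f x‖ₑ ≤ eLpNormEssSup f volume} :=
      isClosed_le hf.enorm continuous_const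
    have := hcl.closure_eq ▸ hd (TopologicalSpace.denseSeq (E n) j)
    exact this

theorem aemeasurable_slice {F : Spacetime n → V} (hF : ContinuousOn F (openSlab n T)) (r : ℝ≥0∞) :
    AEMeasurable (fun t : ℝ => eLpNorm (fun x : E n => F (t, x)) r volume)
      (volume.restrict (Icc 0 T)) := by
  rw [← restrict_Ioo_eq_restrict_Icc]
  rcases eq_or_ne r 0 with rfl | h0
  · simp
  rcases eq_or_ne r ∞ with rfl | htop
  · have h1 : AEMeasurable (fun t : ℝ => ⨆ j : ℕ,
        ‖F (t, TopologicalSpace.denseSeq (E n) j)‖ₑ) (volume.restrict (Ioo 0 T)) := by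
      refine AEMeasurable.iSup fun j => ?_
      refine ContinuousOn.aemeasurable ?_ measurableSet_Ioo
      refine continuous_enorm.comp_continuousOn (hF.comp (by fun_prop) fun t ht => ?_)
      exact ⟨ht, mem_univ _⟩
    refine h1.congr ?_
    filter_upwards [ae_restrict_mem measurableSet_Ioo] with t ht
    exact (eLpNorm_top_eq_iSup (continuous_slice hF ht)).symm
  · simp_rw [eLpNorm_eq_lintegral_rpow_enorm_toReal h0 htop]
    refine AEMeasurable.pow_const ?_ _
    refine AEMeasurable.lintegral_prod_right' (f := fun p : ℝ × E n => ‖F p‖ₑ ^ r.toReal) ?_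
    have hm : (volume.restrict (Ioo 0 T) : Measure ℝ).prod (volume : Measure (E n)) =
        (volume : Measure (Spacetime n)).restrict (openSlab n T) := by
      rw [openSlab, Measure.volume_eq_prod, ← Measure.prod_restrict, Measure.restrict_univ]
    rw [hm]
    refine AEMeasurable.pow_const ?_ _
    exact ContinuousOn.aemeasurable (continuous_enorm.comp_continuousOn hF)
      (isOpen_openSlab n T).measurableSet

theorem mixedNorm_le_mul {q r : ℝ≥0∞} {F : Spacetime n → V} {G : Spacetime n → V₁} {K : ℝ}
    (h : ∀ p ∈ openSlab n T, ‖F p‖ ≤ K * ‖G p‖) :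
    mixedNorm T q r F ≤ ENNReal.ofReal K * mixedNorm T q r G := by
  have h1 : mixedNorm T q r F ≤ eLpNorm (fun t : ℝ => ENNReal.ofReal K *
      eLpNorm (fun x : E n => G (t, x)) r volume) q (volume.restrict (Icc 0 T)) := by
    refine eLpNorm_mono_enorm_ae ?_
    filter_upwards [ae_mem_Ioo T] with t ht
    refine eLpNorm_le_mul_eLpNorm_of_ae_le_mul (Eventually.of_forall fun x => ?_) r
    exact h (t, x) ⟨ht, mem_univ x⟩
  refine h1.trans ?_
  have := eLpNorm_le_nnreal_smul_eLpNorm_of_ae_le_mul' (μ := volume.restrict (Icc 0 T))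
    (f := fun t : ℝ => ENNReal.ofReal K * eLpNorm (fun x : E n => G (t, x)) r volume)
    (g := fun t : ℝ => eLpNorm (fun x : E n => G (t, x)) r volume) (c := K.toNNReal)
    (Eventually.of_forall fun t => le_rfl) q
  exact this

theorem mixedNorm_add_le {q r : ℝ≥0∞} (hq : 1 ≤ q) (hr : 1 ≤ r) {F G : Spacetime n → V}
    (hF : ContinuousOn F (openSlab n T)) (hG : ContinuousOn G (openSlab n T)) :
    mixedNorm T q r (fun p => F p + G p) ≤ mixedNorm T q r F + mixedNorm T q r G := by
  have h1 : mixedNorm T q r (fun p => F p + G p) ≤ eLpNorm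
      ((fun t : ℝ => eLpNorm (fun x : E n => F (t, x)) r volume) +
        fun t : ℝ => eLpNorm (fun x : E n => G (t, x)) r volume) q (volume.restrict (Icc 0 T)) := by
    refine eLpNorm_mono_enorm_ae ?_
    filter_upwards [ae_mem_Ioo T] with t ht
    exact eLpNorm_add_le (continuous_slice hF ht).aestronglyMeasurable
      (continuous_slice hG ht).aestronglyMeasurable hr
  exact h1.trans (eLpNorm_add_le (aemeasurable_slice hF r).aestronglyMeasurable
    (aemeasurable_slice hG r).aestronglyMeasurable hq)

theorem eLpNorm_mul_le_ennreal {α : Type*} [MeasurableSpace α] {μ : Measure α} {f g : α → ℝ≥0∞}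
    (hf : AEMeasurable f μ) (hg : AEMeasurable g μ) {q : ℝ≥0∞} (h0 : q ≠ 0) (htop : q ≠ ⊤) :
    eLpNorm (fun x => f x * g x) q μ ≤ eLpNorm f (2 * q) μ * eLpNorm g (2 * q) μ := by
  have h0' : 2 * q ≠ 0 := by simp [h0]
  have htop' : 2 * q ≠ ⊤ := ENNReal.mul_ne_top (by simp) htop
  rw [eLpNorm_eq_lintegral_rpow_enorm_toReal h0 htop,
    eLpNorm_eq_lintegral_rpow_enorm_toReal h0' htop',
    eLpNorm_eq_lintegral_rpow_enorm_toReal h0' htop']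
  have hq : 0 < q.toReal := ENNReal.toReal_pos h0 htop
  have h2 : (2 * q).toReal = 2 * q.toReal := by simp
  rw [h2]
  exact ENNReal.lintegral_Lp_mul_le_Lq_mul_Lr hq (by linarith) (by field_simp; norm_num) μ hf hg

/-- Hölder with exponents `r₁, r₂` on each time slice, then Cauchy–Schwarz in time, whence the
exponent `2 * q` on both factors. -/
theorem mixedNorm_mul_le {q r r₁ r₂ : ℝ≥0∞} [ENNReal.HolderTriple r₁ r₂ r] (h0 : q ≠ 0)
    (htop : q ≠ ⊤) {F : Spacetime n → V} {G : Spacetime n → V₁} {H : Spacetime n → V₂} {K : ℝ}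
    (hG : ContinuousOn G (openSlab n T)) (hH : ContinuousOn H (openSlab n T))
    (h : ∀ p ∈ openSlab n T, ‖F p‖ ≤ K * (‖G p‖ * ‖H p‖)) :
    mixedNorm T q r F ≤
      ENNReal.ofReal K * (mixedNorm T (2 * q) r₁ G * mixedNorm T (2 * q) r₂ H) := by
  have h1 : mixedNorm T q r F ≤
      ENNReal.ofReal K * mixedNorm T q r (fun p => ‖G p‖ * ‖H p‖) :=
    mixedNorm_le_mul fun p hp => (h p hp).trans_eq (by simp)
  refine h1.trans ?_
  gcongr
  refine le_trans ?_ (eLpNorm_mul_le_ennreal (aemeasurable_slice hG r₁) (aemeasurable_slice hH r₂)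
    h0 htop)
  refine eLpNorm_mono_enorm_ae ?_
  filter_upwards [ae_mem_Ioo T] with t ht
  have := eLpNorm_le_eLpNorm_mul_eLpNorm'_of_norm (μ := (volume : Measure (E n))) (r := r) (p := r₁)
    (q := r₂) (continuous_slice hG ht).aestronglyMeasurable
    (continuous_slice hH ht).aestronglyMeasurable (fun a b => ‖a‖ * ‖b‖) 1
    (Eventually.of_forall fun x => by simp)
  simpa using this

theorem eLpNorm_le_of_le_liminf {α : Type*} [MeasurableSpace α] {μ : Measure α} {f : α → ℝ≥0∞}
    {g : ℕ → α → ℝ≥0∞} (hg : ∀ N, AEMeasurable (g N) μ)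
    (h : ∀ᵐ x ∂μ, f x ≤ liminf (fun N => g N x) atTop) {q B : ℝ≥0∞}
    (hB : ∀ N, eLpNorm (g N) q μ ≤ B) : eLpNorm f q μ ≤ B := by
  rcases eq_or_ne q 0 with rfl | h0
  · simp
  rcases eq_or_ne q ∞ with rfl | htop
  · simp only [eLpNorm_exponent_top] at hB ⊢
    have h2 : ∀ᵐ x ∂μ, ∀ N, ‖g N x‖ₑ ≤ B := by
      rw [ae_all_iff]
      intro N
      filter_upwards [enorm_ae_le_eLpNormEssSup (g N) μ] with x hx
      exact hx.trans (hB N)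
    refine eLpNormEssSup_le_of_ae_enorm_bound ?_
    filter_upwards [h, h2] with x hx hx2
    refine hx.trans (liminf_le_of_frequently_le' (Frequently.of_forall fun N => hx2 N))
  · have hq : 0 < q.toReal := ENNReal.toReal_pos h0 htop
    have key : ∀ φ : α → ℝ≥0∞, eLpNorm φ q μ ≤ B ↔ ∫⁻ x, φ x ^ q.toReal ∂μ ≤ B ^ q.toReal := by
      intro φ
      rw [eLpNorm_eq_lintegral_rpow_enorm_toReal h0 htop, one_div, ENNReal.rpow_inv_le_iff hq]
      rfl
    rw [key]
    have h3 : ∫⁻ x, f x ^ q.toReal ∂μ ≤ ∫⁻ x, liminf (fun N => g N x ^ q.toReal) atTop ∂μ := by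
      refine lintegral_mono_ae ?_
      filter_upwards [h] with x hx
      have := (ENNReal.orderIsoRpow q.toReal hq).liminf_apply (f := atTop)
        (u := fun N => g N x)
      simp only [ENNReal.orderIsoRpow_apply] at this
      rw [← this]
      exact ENNReal.rpow_le_rpow hx hq.le
    refine h3.trans ((lintegral_liminf_le' fun N => (hg N).pow_const _).trans ?_)
    exact liminf_le_of_frequently_le' (Frequently.of_forall fun N => (key _).1 (hB N))

/-- Fatou's lemma in `x` and then in `t`. It carries uniform bounds on finite Littlewood-Paley sums
over to their pointwise limits. -/
theorem mixedNorm_le_of_tendsto {q r B : ℝ≥0∞} {F : Spacetime n → V} {G : ℕ → Spacetime n → V}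
    (hG : ∀ N, ContinuousOn (G N) (openSlab n T))
    (h : ∀ p ∈ openSlab n T, Tendsto (fun N => G N p) atTop (𝓝 (F p)))
    (hB : ∀ N, mixedNorm T q r (G N) ≤ B) : mixedNorm T q r F ≤ B := by
  refine eLpNorm_le_of_le_liminf (g := fun N t => eLpNorm (fun x : E n => G N (t, x)) r volume)
    (fun N => aemeasurable_slice (hG N) r) ?_ hB
  filter_upwards [ae_mem_Ioo T] with t ht
  exact Lp.eLpNorm_lim_le_liminf_eLpNorm
    (fun N => (continuous_slice (hG N) ht).aestronglyMeasurable) _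
    (Eventually.of_forall fun x => h (t, x) ⟨ht, mem_univ x⟩)

/-- An almost everywhere bound holds on a dense set, and continuity extends it: first in `x` for
almost every `t`, then in `t` for fixed `x`. -/
theorem norm_le_of_mixedNorm_top {F : Spacetime n → V} {B : ℝ} (hB : 0 ≤ B)
    (hF : ContinuousOn F (openSlab n T)) (h : mixedNorm T ∞ ∞ F ≤ ENNReal.ofReal B)
    {p : Spacetime n} (hp : p ∈ openSlab n T) : ‖F p‖ ≤ B := by
  have h1 : ∀ᵐ t ∂(volume.restrict (Ioo 0 T) : Measure ℝ), ∀ x : E n, ‖F (t, x)‖ ≤ B := by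
    rw [restrict_Ioo_eq_restrict_Icc]
    rw [mixedNorm, eLpNorm_exponent_top] at h
    filter_upwards [enorm_ae_le_eLpNormEssSup
      (fun t : ℝ => eLpNorm (fun x : E n => F (t, x)) ∞ volume) (volume.restrict (Icc 0 T)),
      ae_mem_Ioo T] with t ht ht'
    have h2 : eLpNorm (fun x : E n => F (t, x)) ∞ volume ≤ ENNReal.ofReal B := le_trans ht h
    rw [eLpNorm_exponent_top] at h2
    have hd := Measure.dense_of_ae
      (enorm_ae_le_eLpNormEssSup (fun x : E n => F (t, x)) (volume : Measure (E n)))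
    have hcl : IsClosed {x | ‖F (t, x)‖ₑ ≤ eLpNormEssSup (fun x : E n => F (t, x)) volume} :=
      isClosed_le (continuous_slice hF ht').enorm continuous_const
    intro x
    have h3 : ‖F (t, x)‖ₑ ≤ _ := (hcl.closure_eq ▸ hd x :)
    have h4 := h3.trans h2
    rwa [← ofReal_norm, ENNReal.ofReal_le_ofReal_iff hB] at h4
  rw [ae_restrict_iff' measurableSet_Ioo] at h1
  have hd := (Measure.dense_of_ae h1)
  obtain ⟨t, x⟩ := p
  have ht : t ∈ Ioo 0 T := hp.1
  have hc : ContinuousOn (fun s : ℝ => ‖F (s, x)‖) (Ioo 0 T) :=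
    (hF.comp (by fun_prop) fun s hs => ⟨hs, mem_univ _⟩).norm
  by_contra hlt
  push Not at hlt
  have hev : ∀ᶠ s in 𝓝 t, B < ‖F (s, x)‖ :=
    (hc.continuousAt (isOpen_Ioo.mem_nhds ht)).eventually_const_lt hlt
  obtain ⟨s, hs3, hs1, hs2⟩ := hd.inter_nhds_nonempty (inter_mem hev (isOpen_Ioo.mem_nhds ht))
  exact absurd (hs3 hs2 x) (not_le.2 hs1)

theorem mixedNorm_top_le {F : Spacetime n → V} {B : ℝ}
    (h : ∀ p ∈ openSlab n T, ‖F p‖ ≤ B) : mixedNorm T ∞ ∞ F ≤ ENNReal.ofReal B := by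
  rw [mixedNorm, eLpNorm_exponent_top]
  refine eLpNormEssSup_le_of_ae_enorm_bound ?_
  filter_upwards [ae_mem_Ioo T] with t ht
  change eLpNorm _ _ _ ≤ _
  rw [eLpNorm_exponent_top]
  refine eLpNormEssSup_le_of_ae_enorm_bound (Eventually.of_forall fun x => ?_)
  rw [← ofReal_norm]
  exact ENNReal.ofReal_le_ofReal (h (t, x) ⟨ht, mem_univ x⟩)

theorem mixedNorm_one_top_le {F : Spacetime n → V} {B : ℝ} (hT : 0 ≤ T)
    (h : ∀ p ∈ openSlab n T, ‖F p‖ ≤ B) : mixedNorm T 1 ∞ F ≤ ENNReal.ofReal (T * B) := by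
  rw [mixedNorm, eLpNorm_one_eq_lintegral_enorm]
  have : ∫⁻ t, ‖eLpNorm (fun x : E n => F (t, x)) ∞ volume‖ₑ ∂(volume.restrict (Icc 0 T)) ≤
      ∫⁻ t, ENNReal.ofReal B ∂(volume.restrict (Icc 0 T)) := by
    refine lintegral_mono_ae ?_
    filter_upwards [ae_mem_Ioo T] with t ht
    change eLpNorm _ _ _ ≤ _
    rw [eLpNorm_exponent_top]
    refine eLpNormEssSup_le_of_ae_enorm_bound (Eventually.of_forall fun x => ?_)
    rw [← ofReal_norm]
    exact ENNReal.ofReal_le_ofReal (h (t, x) ⟨ht, mem_univ x⟩)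
  refine this.trans_eq ?_
  rw [lintegral_const, Measure.restrict_apply_univ, Real.volume_Icc, sub_zero,
    ENNReal.ofReal_mul hT, mul_comm]

/-- `F` is continuous on the open slab, with `L^q_t L^r_x` norm at most `B`. -/
structure NormBound (T : ℝ) (q r : ℝ≥0∞) (F : Spacetime n → V) (B : ℝ) : Prop where
  cont : ContinuousOn F (openSlab n T)
  nonneg : 0 ≤ B
  le : mixedNorm T q r F ≤ ENNReal.ofReal B

namespace NormBound

variable {q r : ℝ≥0∞} {B B' K : ℝ}

theorem mono {F : Spacetime n → V} (h : NormBound T q r F B) (hB : B ≤ B') :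
    NormBound T q r F B' :=
  ⟨h.cont, h.nonneg.trans hB, h.le.trans (ENNReal.ofReal_le_ofReal hB)⟩

theorem dominated {F : Spacetime n → V} {G : Spacetime n → V₁} (hG : NormBound T q r G B)
    (hF : ContinuousOn F (openSlab n T)) (hK : 0 ≤ K)
    (h : ∀ p ∈ openSlab n T, ‖F p‖ ≤ K * ‖G p‖) : NormBound T q r F (K * B) := by
  refine ⟨hF, mul_nonneg hK hG.nonneg, (mixedNorm_le_mul h).trans ?_⟩
  rw [ENNReal.ofReal_mul hK]
  gcongr
  exact hG.le

theorem dominated' {F : Spacetime n → V} {G : Spacetime n → V₁} (hG : NormBound T q r G B)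
    (hF : ContinuousOn F (openSlab n T))
    (h : ∀ p ∈ openSlab n T, ‖F p‖ ≤ ‖G p‖) : NormBound T q r F B := by
  simpa using hG.dominated hF zero_le_one (by simpa using h)

theorem congr {F G : Spacetime n → V} (hG : NormBound T q r G B)
    (h : ∀ p ∈ openSlab n T, F p = G p) : NormBound T q r F B :=
  hG.dominated' (hG.cont.congr h) fun p hp => (congrArg norm (h p hp)).le

theorem add (hq : 1 ≤ q) (hr : 1 ≤ r) {F G : Spacetime n → V} (hF : NormBound T q r F B)
    (hG : NormBound T q r G B') : NormBound T q r (fun p => F p + G p) (B + B') := by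
  refine ⟨hF.cont.add hG.cont, add_nonneg hF.nonneg hG.nonneg,
    (mixedNorm_add_le hq hr hF.cont hG.cont).trans ?_⟩
  rw [ENNReal.ofReal_add hF.nonneg hG.nonneg]
  exact add_le_add hF.le hG.le

theorem neg {F : Spacetime n → V} (hF : NormBound T q r F B) :
    NormBound T q r (fun p => -F p) B :=
  hF.dominated' hF.cont.neg fun _ _ => (norm_neg _).le

theorem sub (hq : 1 ≤ q) (hr : 1 ≤ r) {F G : Spacetime n → V} (hF : NormBound T q r F B)
    (hG : NormBound T q r G B') : NormBound T q r (fun p => F p - G p) (B + B') :=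
  (hF.add hq hr hG.neg).congr fun _ _ => sub_eq_add_neg _ _

theorem zero (T : ℝ) (q r : ℝ≥0∞) : NormBound T q r (fun _ : Spacetime n => (0 : V)) 0 := by
  refine ⟨continuousOn_const, le_rfl, ?_⟩
  simp [mixedNorm]

theorem sum (hq : 1 ≤ q) (hr : 1 ≤ r) {ι : Type*} (s : Finset ι) {F : ι → Spacetime n → V}
    {A : ι → ℝ} (h : ∀ i ∈ s, NormBound T q r (F i) (A i)) :
    NormBound T q r (fun p => ∑ i ∈ s, F i p) (∑ i ∈ s, A i) := by
  classical
  induction s using Finset.induction_on with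
  | empty => simpa using zero T q r
  | insert i s hi ih =>
    simp only [Finset.sum_insert hi]
    exact (h i (Finset.mem_insert_self i s)).add hq hr
      (ih fun j hj => h j (Finset.mem_insert_of_mem hj))

theorem mul {r₁ r₂ : ℝ≥0∞} [ENNReal.HolderTriple r₁ r₂ r] (h0 : q ≠ 0) (htop : q ≠ ⊤)
    {F : Spacetime n → V} {G : Spacetime n → V₁} {H : Spacetime n → V₂}
    (hG : NormBound T (2 * q) r₁ G B) (hH : NormBound T (2 * q) r₂ H B')
    (hF : ContinuousOn F (openSlab n T)) (hK : 0 ≤ K)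
    (h : ∀ p ∈ openSlab n T, ‖F p‖ ≤ K * (‖G p‖ * ‖H p‖)) :
    NormBound T q r F (K * (B * B')) := by
  refine ⟨hF, mul_nonneg hK (mul_nonneg hG.nonneg hH.nonneg),
    (mixedNorm_mul_le (r₁ := r₁) (r₂ := r₂) h0 htop hG.cont hH.cont h).trans ?_⟩
  rw [ENNReal.ofReal_mul hK, ENNReal.ofReal_mul hG.nonneg]
  gcongr
  exacts [hG.le, hH.le]

theorem of_tendsto {F : Spacetime n → V} {G : ℕ → Spacetime n → V}
    (hF : ContinuousOn F (openSlab n T))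
    (h : ∀ p ∈ openSlab n T, Tendsto (fun N => G N p) atTop (𝓝 (F p)))
    (hG : ∀ N, NormBound T q r (G N) B) : NormBound T q r F B :=
  ⟨hF, (hG 0).nonneg, mixedNorm_le_of_tendsto (fun N => (hG N).cont) h fun N => (hG N).le⟩

theorem pointwise {F : Spacetime n → V} (h : NormBound T ∞ ∞ F B) {p : Spacetime n}
    (hp : p ∈ openSlab n T) : ‖F p‖ ≤ B :=
  norm_le_of_mixedNorm_top h.nonneg h.cont h.le hp

end NormBound

end

/-! ### The Littlewood-Paley kernels: reality, reproducing property, scaling -/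

namespace IsLPBump

variable {n : ℕ} {χ : E n → ℝ}

theorem eq_zero_of_lt (hχ : IsLPBump χ) (k : ℤ) {ξ : E n} (h : (2 : ℝ) ^ (k + 1) < ‖ξ‖) :
    χ ((2 : ℝ) ^ (-k) • ξ) = 0 := by
  apply hχ.support
  have h2 : (0 : ℝ) < 2 ^ (-k) := by positivity
  rw [norm_smul, Real.norm_of_nonneg h2.le]
  calc (2 : ℝ) = 2 ^ (-k) * 2 ^ (k + 1) := by
        rw [← zpow_add₀ two_ne_zero]; simp
    _ < _ := by gcongr

theorem eq_one_of_le (hχ : IsLPBump χ) (k : ℤ) {ξ : E n} (h : ‖ξ‖ ≤ (2 : ℝ) ^ k) :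
    χ ((2 : ℝ) ^ (-k) • ξ) = 1 := by
  apply hχ.eq_one
  have h2 : (0 : ℝ) < 2 ^ (-k) := by positivity
  rw [norm_smul, Real.norm_of_nonneg h2.le]
  calc (2 : ℝ) ^ (-k) * ‖ξ‖ ≤ 2 ^ (-k) * 2 ^ k := by gcongr
    _ = 1 := by rw [← zpow_add₀ two_ne_zero]; simp

/-- The complexified symbol of `P_{≤ k}`. -/
def symbol (hχ : IsLPBump χ) (k : ℤ) : 𝓢(E n, ℂ) :=
  HasCompactSupport.toSchwartzMap (f := fun ξ : E n => ((χ ((2 : ℝ) ^ (-k) • ξ) : ℝ) : ℂ))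
    (HasCompactSupport.intro (isCompact_closedBall 0 ((2 : ℝ) ^ (k + 1))) fun ξ hξ => by
      simp only [Metric.mem_closedBall, dist_zero_right, not_le] at hξ
      rw [hχ.eq_zero_of_lt k hξ, Complex.ofReal_zero])
    (Complex.ofRealCLM.contDiff.comp (hχ.smooth.comp (contDiff_const_smul _)))

theorem symbol_apply (hχ : IsLPBump χ) (k : ℤ) (ξ : E n) :
    hχ.symbol k ξ = ((χ ((2 : ℝ) ^ (-k) • ξ) : ℝ) : ℂ) := rfl

/-- The complexified convolution kernel of `P_{≤ k}`. -/
def kernelC (hχ : IsLPBump χ) (k : ℤ) : 𝓢(E n, ℂ) := 𝓕⁻ (hχ.symbol k)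

theorem kernelC_eq_fourierInv (hχ : IsLPBump χ) (k : ℤ) (y : E n) :
    hχ.kernelC k y = 𝓕⁻ (fun ξ : E n => ((χ ((2 : ℝ) ^ (-k) • ξ) : ℝ) : ℂ)) y := by
  rw [kernelC, SchwartzMap.fourierInv_coe]
  rfl

/-- A radial symbol is even, and the inverse Fourier transform of a real even function is real. -/
theorem kernelC_conj (hχ : IsLPBump χ) (k : ℤ) (y : E n) :
    (starRingEnd ℂ) (hχ.kernelC k y) = hχ.kernelC k y := by
  rw [kernelC_eq_fourierInv, Real.fourierInv_eq, ← integral_conj]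
  rw [← integral_neg_eq_self]
  congr 1
  ext v
  have h : χ ((2 : ℝ) ^ (-k) • -v) = χ ((2 : ℝ) ^ (-k) • v) := by
    apply hχ.radial
    simp
  rw [h]
  simp only [Circle.smul_def, inner_neg_left, AddChar.map_neg_eq_inv, smul_eq_mul, map_mul,
    Complex.conj_ofReal, ← Circle.coe_inv_eq_conj, inv_inv]

theorem kernelC_eq (hχ : IsLPBump χ) (k : ℤ) (y : E n) :
    hχ.kernelC k y = ((lpKernel χ k y : ℝ) : ℂ) := by
  rw [lpKernel, ← kernelC_eq_fourierInv]
  exact (Complex.conj_eq_iff_re.1 (hχ.kernelC_conj k y)).symm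

/-- The convolution kernel of `P_{≤ k}` as a real Schwartz function. -/
def kernel (hχ : IsLPBump χ) (k : ℤ) : 𝓢(E n, ℝ) :=
  SchwartzMap.postcompCLM Complex.reCLM (hχ.kernelC k)

theorem kernel_apply (hχ : IsLPBump χ) (k : ℤ) (y : E n) : hχ.kernel k y = lpKernel χ k y := by
  rw [kernel, SchwartzMap.postcompCLM_apply, kernelC_eq]
  simp

theorem coe_kernel (hχ : IsLPBump χ) (k : ℤ) : ⇑(hχ.kernel k) = lpKernel χ k :=
  funext (hχ.kernel_apply k)

theorem lpKernel_contDiff (hχ : IsLPBump χ) (k : ℤ) : ContDiff ℝ ∞ (lpKernel χ k) := by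
  rw [← hχ.coe_kernel]
  exact (hχ.kernel k).smooth ⊤

theorem lpKernel_continuous (hχ : IsLPBump χ) (k : ℤ) : Continuous (lpKernel χ k) :=
  (hχ.lpKernel_contDiff k).continuous

theorem lpKernel_integrable (hχ : IsLPBump χ) (k : ℤ) : Integrable (lpKernel χ k) := by
  rw [← hχ.coe_kernel]
  exact (hχ.kernel k).integrable

theorem lpKernel_memLp_two (hχ : IsLPBump χ) (k : ℤ) : MemLp (lpKernel χ k) 2 := by
  rw [← hχ.coe_kernel]
  exact (hχ.kernel k).memLp 2

theorem fderiv_lpKernel_integrable (hχ : IsLPBump χ) (k : ℤ) (v : E n) :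
    Integrable (fun y => fderiv ℝ (lpKernel χ k) y v) := by
  rw [← hχ.coe_kernel]
  have := (SchwartzMap.evalCLM ℝ (E n) ℝ v (SchwartzMap.fderivCLM ℝ (E n) ℝ (hχ.kernel k))).integrable
    (μ := volume)
  exact this

theorem integral_lpKernel (hχ : IsLPBump χ) (k : ℤ) : ∫ y, lpKernel χ k y = 1 := by
  have h1 : ∫ y, hχ.kernelC k y = 1 := by
    have h2 : 𝓕 (hχ.kernelC k) 0 = hχ.symbol k 0 := by
      rw [kernelC]; simp
    rw [SchwartzMap.fourier_coe, Real.fourier_eq] at h2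
    simp only [inner_zero_right, neg_zero, AddChar.map_zero_eq_one, one_smul] at h2
    rw [h2, symbol_apply, smul_zero, hχ.eq_one 0 (by simp), Complex.ofReal_one]
  simp_rw [kernelC_eq] at h1
  rw [integral_complex_ofReal] at h1
  exact_mod_cast h1

/-- On the Fourier side: the symbol of `P_{≤ j}` vanishes for `|ξ| > 2^{j+1}`, and that of `P_{≤ k}`
equals 1 for `|ξ| ≤ 2^k`; as `j + 1 ≤ k`, the product of the two is the symbol of `P_{≤ j}`. -/
theorem lpKernel_convolution (hχ : IsLPBump χ) {j k : ℤ} (hjk : j < k) (x : E n) :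
    ∫ y, lpKernel χ k y * lpKernel χ j (x - y) = lpKernel χ j x := by
  have h1 : SchwartzMap.convolution (ContinuousLinearMap.mul ℂ ℂ) (hχ.kernelC k) (hχ.kernelC j) =
      hχ.kernelC j := by
    have h2 : 𝓕 (SchwartzMap.convolution (ContinuousLinearMap.mul ℂ ℂ) (hχ.kernelC k)
        (hχ.kernelC j)) = 𝓕 (hχ.kernelC j) := by
      rw [SchwartzMap.fourier_convolution, kernelC, kernelC]
      ext ξ
      simp only [FourierTransform.fourier_fourierInv_eq]
      rw [SchwartzMap.pairing_apply_apply, symbol_apply, symbol_apply]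
      rcases le_or_gt ‖ξ‖ ((2 : ℝ) ^ k) with h | h
      · rw [hχ.eq_one_of_le k h]; simp
      · rw [hχ.eq_zero_of_lt j (lt_of_le_of_lt (zpow_le_zpow_right₀ one_le_two (by lia)) h)]
        simp
    have h3 := congrArg (fun f => 𝓕⁻ f) h2
    simpa using h3
  have h4 := SchwartzMap.convolution_apply (ContinuousLinearMap.mul ℂ ℂ) (hχ.kernelC k)
    (hχ.kernelC j) x
  rw [h1, convolution_def] at h4
  simp only [kernelC_eq, ContinuousLinearMap.mul_apply'] at h4
  rw [← Complex.ofReal_inj, h4, ← integral_complex_ofReal]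
  simp

theorem lpKernel_scaling (χ : E n → ℝ) (k : ℤ) (y : E n) :
    lpKernel χ k y = ((2 : ℝ) ^ k) ^ n * lpKernel χ 0 ((2 : ℝ) ^ k • y) := by
  have h2 : (0 : ℝ) < 2 ^ k := by positivity
  have h := Measure.integral_comp_smul (volume : Measure (E n))
    (fun v : E n => 𝐞 (inner ℝ v ((2 : ℝ) ^ k • y)) • ((χ v : ℝ) : ℂ)) ((2 : ℝ) ^ (-k))
  simp only [lpKernel, Real.fourierInv_eq, neg_zero, zpow_zero, one_smul]
  have h3 : ∀ v : E n, inner ℝ ((2 : ℝ) ^ (-k) • v) ((2 : ℝ) ^ k • y) = inner ℝ v y := by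
    intro v
    rw [inner_smul_left, inner_smul_right, ← mul_assoc]
    simp [h2.ne']
  simp only [h3] at h
  rw [h, abs_of_pos (by positivity), finrank_euclideanSpace_fin, Complex.smul_re, smul_eq_mul,
    zpow_neg, inv_pow, inv_inv]

theorem integral_scaling (f : E n → ℝ) (k : ℤ) :
    ∫ y, ((2 : ℝ) ^ k) ^ n * f ((2 : ℝ) ^ k • y) = ∫ y, f y := by
  have h2 : (0 : ℝ) < 2 ^ k := by positivity
  rw [integral_const_mul, Measure.integral_comp_smul, abs_of_pos (by positivity),
    finrank_euclideanSpace_fin, smul_eq_mul, ← mul_assoc, mul_inv_cancel₀ (by positivity), one_mul]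

theorem integral_abs_lpKernel (χ : E n → ℝ) (k : ℤ) :
    ∫ y, |lpKernel χ k y| = ∫ y, |lpKernel χ 0 y| := by
  rw [← integral_scaling (fun y => |lpKernel χ 0 y|) k]
  congr 1
  ext y
  rw [lpKernel_scaling, abs_mul, abs_of_pos (by positivity)]

theorem integral_sq_lpKernel (χ : E n → ℝ) (k : ℤ) :
    ∫ y, lpKernel χ k y ^ 2 = ((2 : ℝ) ^ k) ^ n * ∫ y, lpKernel χ 0 y ^ 2 := by
  rw [← integral_scaling (fun y => lpKernel χ 0 y ^ 2) k, ← integral_const_mul]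
  congr 1
  ext y
  rw [lpKernel_scaling]
  ring

theorem integral_abs_fderiv_lpKernel (hχ : IsLPBump χ) (k : ℤ) (v : E n) :
    ∫ y, |fderiv ℝ (lpKernel χ k) y v| = (2 : ℝ) ^ k * ∫ y, |fderiv ℝ (lpKernel χ 0) y v| := by
  rw [← integral_scaling (fun y => |fderiv ℝ (lpKernel χ 0) y v|) k, ← integral_const_mul]
  congr 1
  ext y
  have h1 : lpKernel χ k = fun y => ((2 : ℝ) ^ k) ^ n * lpKernel χ 0 ((2 : ℝ) ^ k • y) :=
    funext (lpKernel_scaling χ k)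
  have hd : DifferentiableAt ℝ (lpKernel χ 0) ((2 : ℝ) ^ k • y) :=
    (hχ.lpKernel_contDiff 0).differentiable (by simp) _
  have h2 : HasFDerivAt (fun y => ((2 : ℝ) ^ k) ^ n * lpKernel χ 0 ((2 : ℝ) ^ k • y))
      (((2 : ℝ) ^ k) ^ n • (fderiv ℝ (lpKernel χ 0) ((2 : ℝ) ^ k • y)).comp
        ((2 : ℝ) ^ k • ContinuousLinearMap.id ℝ (E n))) y :=
    (hd.hasFDerivAt.comp y (f := fun y => (2 : ℝ) ^ k • y)
      ((hasFDerivAt_id y).const_smul ((2 : ℝ) ^ k))).const_mul _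
  rw [h1, h2.fderiv]
  simp [abs_mul]
  ring

end IsLPBump

/-! ### Young's inequality and the gain of integrability from `L²` -/

section Convolution

variable {n : ℕ} {ε V₁ : Type*} [ENorm ε] [NormedAddCommGroup V₁]
  {K : E n → ℝ}

theorem lintegral_prod_translate (hK : Continuous K) {h : E n → ℝ≥0∞} (hh : Measurable h) :
    ∫⁻ x, ∫⁻ y, ‖K y‖ₑ * h (x - y) = (∫⁻ y, ‖K y‖ₑ) * ∫⁻ x, h x := by
  have hm : Measurable fun y => ‖K y‖ₑ := hK.enorm.measurable
  rw [lintegral_lintegral_swap]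
  · have : ∀ y : E n, ∫⁻ x, ‖K y‖ₑ * h (x - y) = ‖K y‖ₑ * ∫⁻ x, h x := by
      intro y
      rw [lintegral_const_mul _ (by fun_prop), lintegral_sub_right_eq_self]
    simp_rw [this]
    rw [lintegral_mul_const _ hm]
  · exact Measurable.aemeasurable (by
      have h1 : Continuous fun p : E n × E n => K p.2 := by fun_prop
      exact h1.enorm.measurable.mul (hh.comp (by fun_prop)))

/-- Young's inequality `‖K * g‖_r ≤ ‖K‖_1 ‖g‖_r`, for a function dominated by `|K| * |g|`. -/
theorem eLpNorm_le_of_le_convolution (hK : Continuous K) (hK1 : Integrable K) {f : E n → ε}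
    {g : E n → V₁} (hg : Continuous g) (h : ∀ x, ‖f x‖ₑ ≤ ∫⁻ y, ‖K y‖ₑ * ‖g (x - y)‖ₑ)
    {r : ℝ≥0∞} (hr : 1 ≤ r) :
    eLpNorm f r volume ≤ ENNReal.ofReal (∫ y, |K y|) * eLpNorm g r volume := by
  have hm : Measurable fun y => ‖K y‖ₑ := hK.enorm.measurable
  have hK2 : ENNReal.ofReal (∫ y, |K y|) = ∫⁻ y, ‖K y‖ₑ :=
    ofReal_integral_norm_eq_lintegral_enorm hK1
  rw [hK2]
  rcases eq_or_ne r ∞ with rfl | htop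
  · simp only [eLpNorm_exponent_top]
    refine eLpNormEssSup_le_of_ae_enorm_bound (Eventually.of_forall fun x => (h x).trans ?_)
    rw [← lintegral_mul_const _ hm]
    refine lintegral_mono_ae ?_
    have h1 := enorm_ae_le_eLpNormEssSup g (volume : Measure (E n))
    have h2 : ∀ᵐ y : E n, ‖g (x - y)‖ₑ ≤ eLpNormEssSup g volume :=
      (Measure.measurePreserving_sub_left volume x).quasiMeasurePreserving.ae h1
    filter_upwards [h2] with y hy
    gcongr
  · have h0 : r ≠ 0 := (zero_lt_one.trans_le hr).ne'
    have hrr : 0 < r.toReal := ENNReal.toReal_pos h0 htop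
    have hr1 : 1 ≤ r.toReal := by
      have := ENNReal.toReal_mono htop hr
      simpa using this
    -- Jensen's inequality for the finite measure `|K| dy`: the `L¹(ν)` norm of `g(x - ·)` is at
    -- most its `L^r(ν)` norm times a power of the mass of `ν`. Integrating in `x` then uses only
    -- translation invariance.
    set ν : Measure (E n) := volume.withDensity fun y => ‖K y‖ₑ with hν
    have hint : ∀ φ : E n → ℝ≥0∞, Measurable φ → ∫⁻ y, φ y ∂ν = ∫⁻ y, ‖K y‖ₑ * φ y := by
      intro φ hφ
      rw [hν, lintegral_withDensity_eq_lintegral_mul _ hm hφ]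
      rfl
    have huniv : ν univ = ∫⁻ y, ‖K y‖ₑ := by
      rw [hν, withDensity_apply _ MeasurableSet.univ, Measure.restrict_univ]
    have hbd : ∀ x, ‖f x‖ₑ ^ r.toReal ≤
        (∫⁻ y, ‖K y‖ₑ * ‖g (x - y)‖ₑ ^ r.toReal) * (∫⁻ y, ‖K y‖ₑ) ^ (r.toReal - 1) := by
      intro x
      have hc : Continuous fun y => g (x - y) := by fun_prop
      have h1 := eLpNorm_le_eLpNorm_mul_rpow_measure_univ (μ := ν) (f := fun y => g (x - y)) hr
        hc.aestronglyMeasurable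
      rw [eLpNorm_one_eq_lintegral_enorm, hint _ hc.enorm.measurable, huniv,
        eLpNorm_eq_lintegral_rpow_enorm_toReal h0 htop,
        hint _ (hc.enorm.measurable.pow_const _)] at h1
      have h2 := ENNReal.rpow_le_rpow ((h x).trans h1) hrr.le
      rw [ENNReal.mul_rpow_of_nonneg _ _ hrr.le, ← ENNReal.rpow_mul, ← ENNReal.rpow_mul] at h2
      convert h2 using 2
      · rw [one_div, inv_mul_cancel₀ hrr.ne', ENNReal.rpow_one]
      · congr 1
        simp only [ENNReal.toReal_one]
        field_simp
    rw [eLpNorm_eq_lintegral_rpow_enorm_toReal h0 htop,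
      eLpNorm_eq_lintegral_rpow_enorm_toReal h0 htop, one_div, ENNReal.rpow_inv_le_iff hrr,
      ENNReal.mul_rpow_of_nonneg _ _ hrr.le, ← ENNReal.rpow_mul, inv_mul_cancel₀ hrr.ne',
      ENNReal.rpow_one]
    calc ∫⁻ x, ‖f x‖ₑ ^ r.toReal
        ≤ ∫⁻ x, (∫⁻ y, ‖K y‖ₑ * ‖g (x - y)‖ₑ ^ r.toReal) *
            (∫⁻ y, ‖K y‖ₑ) ^ (r.toReal - 1) := lintegral_mono hbd
      _ = ((∫⁻ y, ‖K y‖ₑ) * ∫⁻ x, ‖g x‖ₑ ^ r.toReal) * (∫⁻ y, ‖K y‖ₑ) ^ (r.toReal - 1) := by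
          rw [lintegral_mul_const, lintegral_prod_translate hK
            (h := fun x => ‖g x‖ₑ ^ r.toReal) (hg.enorm.measurable.pow_const _)]
          have : Measurable (Function.uncurry fun (x y : E n) =>
              ‖K y‖ₑ * ‖g (x - y)‖ₑ ^ r.toReal) := by
            have h1 : Measurable fun z => ‖g z‖ₑ := hg.enorm.measurable
            unfold Function.uncurry
            fun_prop
          exact this.lintegral_prod_right'
      _ = (∫⁻ y, ‖K y‖ₑ) ^ r.toReal * ∫⁻ x, ‖g x‖ₑ ^ r.toReal := by
          have : (∫⁻ y, ‖K y‖ₑ) ^ r.toReal =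
              (∫⁻ y, ‖K y‖ₑ) * (∫⁻ y, ‖K y‖ₑ) ^ (r.toReal - 1) := by
            conv_lhs => rw [show r.toReal = 1 + (r.toReal - 1) by ring]
            rw [ENNReal.rpow_add_of_nonneg _ _ zero_le_one (by linarith), ENNReal.rpow_one]
          rw [this]
          ring

theorem enorm_le_of_le_convolution_two (hK : Continuous K) {f : E n → ε}
    {g : E n → V₁} (hg : Continuous g) (h : ∀ x, ‖f x‖ₑ ≤ ∫⁻ y, ‖K y‖ₑ * ‖g (x - y)‖ₑ) (x : E n) :
    ‖f x‖ₑ ≤ eLpNorm K 2 volume * eLpNorm g 2 volume := by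
  refine (h x).trans ?_
  have h1 := ENNReal.lintegral_mul_le_Lp_mul_Lq (volume : Measure (E n))
    (Real.HolderConjugate.two_two) (f := fun y => ‖K y‖ₑ) (g := fun y => ‖g (x - y)‖ₑ)
    hK.enorm.measurable.aemeasurable (by fun_prop)
  refine h1.trans_eq ?_
  rw [eLpNorm_eq_lintegral_rpow_enorm_toReal two_ne_zero (by simp),
    eLpNorm_eq_lintegral_rpow_enorm_toReal two_ne_zero (by simp)]
  simp only [ENNReal.toReal_ofNat]
  rw [lintegral_sub_left_eq_self (fun y => ‖g y‖ₑ ^ (2 : ℝ)) x]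

/-- `‖K * g‖_s ≤ ‖K‖_2^{1-2/s} ‖K‖_1^{2/s} ‖g‖_2` for `2 ≤ s < ∞`. -/
theorem eLpNorm_le_of_le_convolution_two (hK : Continuous K) (hK1 : Integrable K) {f : E n → ε}
    {g : E n → V₁} (hf : Measurable fun x => ‖f x‖ₑ) (hg : Continuous g)
    (h : ∀ x, ‖f x‖ₑ ≤ ∫⁻ y, ‖K y‖ₑ * ‖g (x - y)‖ₑ) {s : ℝ} (hs : 2 ≤ s) :
    eLpNorm f (ENNReal.ofReal s) volume ≤ eLpNorm K 2 volume ^ (1 - 2 / s) *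
      ENNReal.ofReal (∫ y, |K y|) ^ (2 / s) * eLpNorm g 2 volume := by
  have hs0 : 0 < s := by linarith
  have h2 := eLpNorm_le_of_le_convolution hK hK1 hg h (r := 2) (by norm_num)
  have hinf := enorm_le_of_le_convolution_two hK hg h
  set A := eLpNorm K 2 volume * eLpNorm g 2 volume with hA
  set B := ENNReal.ofReal (∫ y, |K y|) * eLpNorm g 2 volume with hB
  have hp1 : 0 ≤ 1 - 2 / s := by
    rw [sub_nonneg, div_le_one hs0]; exact hs
  have hp2 : 0 ≤ 2 / s := by positivity
  have hR : eLpNorm K 2 volume ^ (1 - 2 / s) *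
      ENNReal.ofReal (∫ y, |K y|) ^ (2 / s) * eLpNorm g 2 volume =
      A ^ (1 - 2 / s) * B ^ (2 / s) := by
    rw [hA, hB, ENNReal.mul_rpow_of_nonneg _ _ hp1, ENNReal.mul_rpow_of_nonneg _ _ hp2]
    have : eLpNorm g 2 volume =
        eLpNorm g 2 volume ^ (1 - 2 / s) * eLpNorm g 2 volume ^ (2 / s) := by
      rw [← ENNReal.rpow_add_of_nonneg _ _ hp1 hp2]; simp
    conv_lhs => rw [this]
    ring
  rw [hR, eLpNorm_eq_lintegral_rpow_enorm_toReal (by simpa using hs0) (by simp),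
    ENNReal.toReal_ofReal hs0.le, one_div, ENNReal.rpow_inv_le_iff hs0,
    ENNReal.mul_rpow_of_nonneg _ _ hs0.le, ← ENNReal.rpow_mul, ← ENNReal.rpow_mul]
  have e1 : (1 - 2 / s) * s = s - 2 := by field_simp
  have e2 : 2 / s * s = 2 := by field_simp
  rw [e1, e2]
  rw [eLpNorm_eq_lintegral_rpow_enorm_toReal two_ne_zero (by simp), ENNReal.toReal_ofNat, one_div,
    ENNReal.rpow_inv_le_iff two_pos] at h2
  -- Interpolation between the sup bound `A` (Cauchy–Schwarz) and the `L²` bound `B` (Young).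
  calc ∫⁻ x, ‖f x‖ₑ ^ s ≤ ∫⁻ x, A ^ (s - 2) * ‖f x‖ₑ ^ (2 : ℝ) := by
        refine lintegral_mono fun x => ?_
        calc ‖f x‖ₑ ^ s = ‖f x‖ₑ ^ (s - 2) * ‖f x‖ₑ ^ (2 : ℝ) := by
              rw [← ENNReal.rpow_add_of_nonneg _ _ (by linarith) (by norm_num)]
              ring_nf
          _ ≤ _ := by
              gcongr
              exact hinf x
    _ ≤ A ^ (s - 2) * B ^ (2 : ℝ) := by
        rw [lintegral_const_mul _ (hf.pow_const _)]
        gcongr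

end Convolution

/-! ### Convolution of an integrable kernel with a bounded function -/

section BoundedConvolution

variable {n : ℕ} {V : Type*} [NormedAddCommGroup V] [NormedSpace ℝ V] {K : E n → ℝ}
  {g : E n → V} {B : ℝ}

theorem integrable_smul_translate (hK1 : Integrable K) (hg : Continuous g)
    (hB : ∀ x, ‖g x‖ ≤ B) (x : E n) : Integrable fun y => K y • g (x - y) := by
  refine (hK1.norm.mul_const B).mono' (hK1.aestronglyMeasurable.smul
    (by fun_prop : Continuous fun y => g (x - y)).aestronglyMeasurable)
    (Eventually.of_forall fun y => ?_)
  rw [norm_smul]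
  gcongr
  exact hB _

theorem integral_smul_convolution [CompleteSpace V] {K₁ K₂ : E n → ℝ} (hK₁ : Integrable K₁) (hK₂ : Integrable K₂)
    (hg : Continuous g) (hB : ∀ x, ‖g x‖ ≤ B) (x : E n) :
    ∫ y, K₁ y • ∫ z, K₂ z • g (x - y - z) = ∫ z, (∫ y, K₁ y * K₂ (z - y)) • g (x - z) := by
  have h1 : ∀ y, ∫ z, K₂ z • g (x - y - z) = ∫ z, K₂ (z - y) • g (x - z) := by
    intro y
    rw [← integral_sub_right_eq_self (fun z => K₂ z • g (x - y - z)) y]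
    congr 1
    ext z
    rw [show x - y - (z - y) = x - z by abel]
  simp_rw [h1, ← integral_smul, ← integral_smul_const, smul_smul]
  rw [integral_integral_swap]
  · have h2 := hK₁.convolution_integrand (ContinuousLinearMap.mul ℝ ℝ) hK₂
    have h3 := h2.swap
    have hc : Continuous fun p : E n × E n => g (x - p.2) := by fun_prop
    refine (h3.norm.mul_const B).mono' ?_ (Eventually.of_forall fun p => ?_)
    · have := h3.aestronglyMeasurable.smul hc.aestronglyMeasurable
      refine this.congr (Eventually.of_forall fun p => ?_)
      simp [Function.uncurry]
    · simp only [Function.uncurry, norm_smul]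
      gcongr
      · simp
      · exact hB _

/-- Integration by parts. The minus sign is cancelled by the one from differentiating `y ↦ g (x -
y)`. -/
theorem integral_smul_fderiv_translate (hK : ContDiff ℝ 1 K) (hK1 : Integrable K) {v : E n}
    (hKv : Integrable fun y => fderiv ℝ K y v) (hg : ContDiff ℝ 1 g) (hB : ∀ x, ‖g x‖ ≤ B)
    {B' : ℝ} (hB' : ∀ x, ‖fderiv ℝ g x v‖ ≤ B') (x : E n) :
    ∫ y, K y • fderiv ℝ g (x - y) v = ∫ y, fderiv ℝ K y v • g (x - y) := by
  have hd : ∀ y, HasFDerivAt (fun y => g (x - y)) (-(fderiv ℝ g (x - y))) y := by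
    intro y
    have h1 : HasFDerivAt (fun y : E n => x - y) (-ContinuousLinearMap.id ℝ (E n)) y :=
      (hasFDerivAt_id y).const_sub x
    have h2 := ((hg.differentiable (by simp)) (x - y)).hasFDerivAt.comp y h1
    simpa using! h2
  have hd' : ∀ y, fderiv ℝ (fun y => g (x - y)) y v = -(fderiv ℝ g (x - y) v) := by
    intro y
    rw [(hd y).fderiv]; rfl
  have hc : Continuous fun y => fderiv ℝ g y v := (hg.continuous_fderiv (by simp)).clm_apply
    continuous_const
  have h := integral_smul_fderiv_eq_neg_fderiv_smul_of_integrable (μ := volume) (f := K)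
    (g := fun y => g (x - y)) (v := v) (integrable_smul_translate hKv hg.continuous hB x)
    (by
      simp_rw [hd']
      simpa using! (integrable_smul_translate hK1 hc hB' x).neg)
    (integrable_smul_translate hK1 hg.continuous hB x)
    (fun y _ => hK.differentiable (by simp) y) (fun y _ => (hd y).differentiableAt)
  simp_rw [hd', smul_neg, integral_neg, neg_inj] at h
  exact h

end BoundedConvolution

/-! ### Limits of `P_{≤ k}` as the frequency goes to `±∞` -/

section LittlewoodPaley

variable {n : ℕ} {V : Type*} [NormedAddCommGroup V] [NormedSpace ℝ V] {χ : E n → ℝ}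
  {g : E n → V} {B : ℝ}

theorem integral_lpKernel_smul_scaling (χ : E n → ℝ) (k : ℤ) (g : E n → V) (x : E n) :
    ∫ y, lpKernel χ k y • g (x - y) = ∫ z, lpKernel χ 0 z • g (x - (2 : ℝ) ^ (-k) • z) := by
  have h2 : (0 : ℝ) < 2 ^ k := by positivity
  have h := Measure.integral_comp_smul (volume : Measure (E n))
    (fun z => lpKernel χ 0 z • g (x - (2 : ℝ) ^ (-k) • z)) ((2 : ℝ) ^ k)
  rw [abs_of_pos (by positivity), finrank_euclideanSpace_fin] at h
  rw [← one_smul ℝ (∫ z, lpKernel χ 0 z • g (x - (2 : ℝ) ^ (-k) • z)),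
    ← mul_inv_cancel₀ (by positivity : ((2 : ℝ) ^ k) ^ n ≠ 0), mul_smul, ← h, ← integral_smul]
  congr 1
  ext y
  rw [IsLPBump.lpKernel_scaling, smul_smul, smul_smul]
  congr 3
  simp [h2.ne']

theorem tendsto_lp_atTop [CompleteSpace V] (hχ : IsLPBump χ) (hg : Continuous g) (hB : ∀ x, ‖g x‖ ≤ B) (x : E n) :
    Tendsto (fun N : ℕ => ∫ y, lpKernel χ (N : ℤ) y • g (x - y)) atTop (𝓝 (g x)) := by
  simp_rw [integral_lpKernel_smul_scaling]
  have h1 : g x = ∫ z, lpKernel χ 0 z • g x := by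
    rw [integral_smul_const, hχ.integral_lpKernel, one_smul]
  rw [h1]
  refine tendsto_integral_of_dominated_convergence (fun z => ‖lpKernel χ 0 z‖ * B) (fun N => ?_)
    ((hχ.lpKernel_integrable 0).norm.mul_const B) (fun N => Eventually.of_forall fun z => ?_)
    (Eventually.of_forall fun z => ?_)
  · exact ((hχ.lpKernel_continuous 0).smul (by fun_prop)).aestronglyMeasurable
  · rw [norm_smul]
    gcongr
    exact hB _
  · refine Tendsto.const_smul ?_ _
    have h3 : Tendsto (fun N : ℕ => (2 : ℝ) ^ (-(N : ℤ))) atTop (𝓝 0) := by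
      simpa using! tendsto_inv_atTop_zero.comp (tendsto_pow_atTop_atTop_of_one_lt (one_lt_two (α := ℝ)))
    have h4 : Tendsto (fun N : ℕ => x - (2 : ℝ) ^ (-(N : ℤ)) • z) atTop (𝓝 (x - (0 : ℝ) • z)) :=
      (h3.smul_const z).const_sub x
    rw [zero_smul, sub_zero] at h4
    exact (hg.tendsto x).comp h4

/-- After rescaling, the integrand samples `g` at `x - 2^N z`, which for each `z ≠ 0` leaves the
support of `g` as `N` grows; dominated convergence concludes. -/
theorem tendsto_lp_atBot (hχ : IsLPBump χ) (hn : 0 < n) (hg : Continuous g)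
    (hB : ∀ x, ‖g x‖ ≤ B) {R : ℝ} (hR : ∀ x, R < ‖x‖ → g x = 0) (x : E n) :
    Tendsto (fun N : ℕ => ∫ y, lpKernel χ (-(N : ℤ)) y • g (x - y)) atTop (𝓝 0) := by
  simp_rw [integral_lpKernel_smul_scaling, neg_neg]
  have h1 : (0 : V) = ∫ z : E n, (0 : V) := by simp
  rw [h1]
  refine tendsto_integral_of_dominated_convergence (fun z => ‖lpKernel χ 0 z‖ * B) (fun N => ?_)
    ((hχ.lpKernel_integrable 0).norm.mul_const B) (fun N => Eventually.of_forall fun z => ?_) ?_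
  · exact ((hχ.lpKernel_continuous 0).smul (by fun_prop)).aestronglyMeasurable
  · rw [norm_smul]
    gcongr
    exact hB _
  · have : Nonempty (Fin n) := ⟨⟨0, hn⟩⟩
    have h0 : ∀ᵐ z : E n, z ≠ 0 := by
      rw [ae_iff]
      simp
    filter_upwards [h0] with z hz
    refine tendsto_const_nhds.congr' ?_
    have h3 : Tendsto (fun N : ℕ => (2 : ℝ) ^ (N : ℤ) * ‖z‖ - ‖x‖) atTop atTop := by
      refine tendsto_atTop_add_const_right _ _ ?_
      refine Tendsto.atTop_mul_const (norm_pos_iff.2 hz) ?_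
      simpa using tendsto_pow_atTop_atTop_of_one_lt (one_lt_two (α := ℝ))
    filter_upwards [h3.eventually_gt_atTop R] with N hN
    rw [hR, smul_zero]
    refine hN.trans_le ?_
    have := norm_sub_norm_le ((2 : ℝ) ^ (N : ℤ) • z) x
    rw [norm_smul, Real.norm_of_nonneg (by positivity)] at this
    rw [norm_sub_rev]
    exact this

theorem lp_reproducing [CompleteSpace V] (hχ : IsLPBump χ) {j k : ℤ} (hjk : j < k) (hg : Continuous g)
    (hB : ∀ x, ‖g x‖ ≤ B) (x : E n) :
    ∫ y, lpKernel χ k y • ∫ z, lpKernel χ j z • g (x - y - z) =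
      ∫ z, lpKernel χ j z • g (x - z) := by
  rw [integral_smul_convolution (hχ.lpKernel_integrable k) (hχ.lpKernel_integrable j) hg hB]
  simp_rw [hχ.lpKernel_convolution hjk]

end LittlewoodPaley

/-! ### Leibniz rules for `∂_α` and `□` -/

section Calculus

variable {n : ℕ} {T : ℝ} {V V₁ V₂ : Type*} [NormedAddCommGroup V] [NormedSpace ℝ V]
  [NormedAddCommGroup V₁] [NormedSpace ℝ V₁] [NormedAddCommGroup V₂] [NormedSpace ℝ V₂]
  {p : Spacetime n}

theorem differentiableAt_of_mem {f : Spacetime n → V} (hf : ContDiffOn ℝ ∞ f (openSlab n T))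
    (hp : p ∈ openSlab n T) : DifferentiableAt ℝ f p :=
  (hf.differentiableOn (by simp)).differentiableAt ((isOpen_openSlab n T).mem_nhds hp)

theorem contDiffOn_pd {f : Spacetime n → V} (hf : ContDiffOn ℝ ∞ f (openSlab n T))
    (α : Fin (n + 1)) : ContDiffOn ℝ ∞ (pd α f) (openSlab n T) :=
  (hf.fderiv_of_isOpen (isOpen_openSlab n T) (m := ∞) (by simp)).clm_apply contDiffOn_const

theorem pd_congr {f g : Spacetime n → V} (h : ∀ p ∈ openSlab n T, f p = g p)
    (hp : p ∈ openSlab n T) (α : Fin (n + 1)) : pd α f p = pd α g p := by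
  have : f =ᶠ[𝓝 p] g := by
    filter_upwards [(isOpen_openSlab n T).mem_nhds hp] with q hq using h q hq
  rw [pd, pd, this.fderiv_eq]

theorem pd_add {f g : Spacetime n → V} (hf : ContDiffOn ℝ ∞ f (openSlab n T))
    (hg : ContDiffOn ℝ ∞ g (openSlab n T)) (hp : p ∈ openSlab n T) (α : Fin (n + 1)) :
    pd α (fun p => f p + g p) p = pd α f p + pd α g p := by
  simp only [pd]
  rw [fderiv_fun_add (differentiableAt_of_mem hf hp) (differentiableAt_of_mem hg hp)]
  rfl

theorem pd_sub {f g : Spacetime n → V} (hf : ContDiffOn ℝ ∞ f (openSlab n T))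
    (hg : ContDiffOn ℝ ∞ g (openSlab n T)) (hp : p ∈ openSlab n T) (α : Fin (n + 1)) :
    pd α (fun p => f p - g p) p = pd α f p - pd α g p := by
  simp only [pd]
  rw [fderiv_fun_sub (differentiableAt_of_mem hf hp) (differentiableAt_of_mem hg hp)]
  rfl

theorem pd_const (c : V) (α : Fin (n + 1)) (p : Spacetime n) : pd α (fun _ => c) p = 0 := by
  simp [pd]

theorem pd_bilin (B : V₁ →L[ℝ] V₂ →L[ℝ] V) {f : Spacetime n → V₁} {g : Spacetime n → V₂}
    (hf : ContDiffOn ℝ ∞ f (openSlab n T)) (hg : ContDiffOn ℝ ∞ g (openSlab n T))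
    (hp : p ∈ openSlab n T) (α : Fin (n + 1)) :
    pd α (fun p => B (f p) (g p)) p = B (pd α f p) (g p) + B (f p) (pd α g p) := by
  simp only [pd]
  rw [B.fderiv_of_bilinear (differentiableAt_of_mem hf hp) (differentiableAt_of_mem hg hp)]
  simp [add_comm]

theorem contDiffOn_bilin (B : V₁ →L[ℝ] V₂ →L[ℝ] V) {f : Spacetime n → V₁} {g : Spacetime n → V₂}
    (hf : ContDiffOn ℝ ∞ f (openSlab n T)) (hg : ContDiffOn ℝ ∞ g (openSlab n T)) :
    ContDiffOn ℝ ∞ (fun p => B (f p) (g p)) (openSlab n T) :=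
  B.isBoundedBilinearMap.contDiff.comp₂_contDiffOn hf hg

theorem contDiffOn_box {f : Spacetime n → V} (hf : ContDiffOn ℝ ∞ f (openSlab n T)) :
    ContDiffOn ℝ ∞ (box f) (openSlab n T) :=
  ContDiffOn.sum fun α _ => contDiffOn_const.smul (contDiffOn_pd (contDiffOn_pd hf α) α)

theorem box_add {f g : Spacetime n → V} (hf : ContDiffOn ℝ ∞ f (openSlab n T))
    (hg : ContDiffOn ℝ ∞ g (openSlab n T)) (hp : p ∈ openSlab n T) :
    box (fun p => f p + g p) p = box f p + box g p := by
  simp only [box]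
  rw [← Finset.sum_add_distrib]
  refine Finset.sum_congr rfl fun α _ => ?_
  rw [pd_congr (fun q hq => pd_add hf hg hq α) hp, pd_add (contDiffOn_pd hf α)
    (contDiffOn_pd hg α) hp, smul_add]

theorem box_sub {f g : Spacetime n → V} (hf : ContDiffOn ℝ ∞ f (openSlab n T))
    (hg : ContDiffOn ℝ ∞ g (openSlab n T)) (hp : p ∈ openSlab n T) :
    box (fun p => f p - g p) p = box f p - box g p := by
  simp only [box]
  rw [← Finset.sum_sub_distrib]
  refine Finset.sum_congr rfl fun α _ => ?_
  rw [pd_congr (fun q hq => pd_sub hf hg hq α) hp, pd_sub (contDiffOn_pd hf α)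
    (contDiffOn_pd hg α) hp, smul_sub]

theorem box_bilin (B : V₁ →L[ℝ] V₂ →L[ℝ] V) {f : Spacetime n → V₁} {g : Spacetime n → V₂}
    (hf : ContDiffOn ℝ ∞ f (openSlab n T)) (hg : ContDiffOn ℝ ∞ g (openSlab n T))
    (hp : p ∈ openSlab n T) :
    box (fun p => B (f p) (g p)) p = B (box f p) (g p) +
      ∑ α, (2 * eta α) • B (pd α f p) (pd α g p) + B (f p) (box g p) := by
  simp only [box, map_sum, map_smul, sum_apply, smul_apply]
  rw [← Finset.sum_add_distrib, ← Finset.sum_add_distrib]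
  refine Finset.sum_congr rfl fun α _ => ?_
  rw [pd_congr (fun q hq => pd_bilin B hf hg hq α) hp,
    pd_add (contDiffOn_bilin B (contDiffOn_pd hf α) hg)
      (contDiffOn_bilin B hf (contDiffOn_pd hg α)) hp,
    pd_bilin B (contDiffOn_pd hf α) hg hp, pd_bilin B hf (contDiffOn_pd hg α) hp]
  module

theorem abs_eta (α : Fin (n + 1)) : |eta α| = 1 := by
  unfold eta
  split_ifs <;> simp

end Calculus

/-! ### Functions constant near spatial infinity, and derivatives of `P_{≤ k}` -/

section Tame

variable {n : ℕ} {T : ℝ} {V : Type*} [NormedAddCommGroup V] {χ : E n → ℝ}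

theorem exists_bound_slice {f : Spacetime n → V} {s : Set ℝ} (hf : ContinuousOn f (s ×ˢ univ))
    {e : V} {R : ℝ} (he : ∀ p ∈ s ×ˢ univ, R < ‖p.2‖ → f p = e) {t : ℝ} (ht : t ∈ s) :
    ∃ B, ∀ x : E n, ‖f (t, x)‖ ≤ B := by
  have hc : Continuous fun x : E n => f (t, x) :=
    hf.comp_continuous (by fun_prop) fun x => ⟨ht, mem_univ x⟩
  obtain ⟨B, hB⟩ := (isCompact_closedBall (0 : E n) R).exists_bound_of_continuousOn hc.continuousOn
  refine ⟨max B ‖e‖, fun x => ?_⟩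
  by_cases hx : ‖x‖ ≤ R
  · exact (hB x (by simpa using hx)).trans (le_max_left _ _)
  · rw [he (t, x) ⟨ht, mem_univ x⟩ (not_le.1 hx)]
    exact le_max_right _ _

variable [NormedSpace ℝ V]

/-- The kernel has integral 1, so the constant at infinity can be split off; what remains is a
convolution with a compactly supported function, to which differentiation under the integral
applies. The time set `s` is arbitrary, so that the closed slab is covered too. -/
theorem lpLe_eq_convolution [CompleteSpace V] (hχ : IsLPBump χ) (k : ℤ) {f : Spacetime n → V}
    {s : Set ℝ}
    (hf : ContinuousOn f (s ×ˢ univ)) {e : V} {R : ℝ}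
    (he : ∀ p ∈ s ×ˢ univ, R < ‖p.2‖ → f p = e) {p : Spacetime n} (hp : p ∈ s ×ˢ univ) :
    lpLe χ k f p = e + (lpKernel χ k ⋆[ContinuousLinearMap.lsmul ℝ ℝ, volume]
      (fun x => f (p.1, x) - e)) p.2 := by
  obtain ⟨B, hB⟩ := exists_bound_slice hf he hp.1
  have hc : Continuous fun x : E n => f (p.1, x) :=
    hf.comp_continuous (by fun_prop) fun x => ⟨hp.1, mem_univ x⟩
  have h1 := integrable_smul_translate (hχ.lpKernel_integrable k) hc hB p.2
  have h2 : Integrable fun y => lpKernel χ k y • e := (hχ.lpKernel_integrable k).smul_const e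
  rw [convolution_def]
  simp only [ContinuousLinearMap.lsmul_apply, smul_sub]
  rw [integral_sub h1 h2, integral_smul_const, hχ.integral_lpKernel, one_smul]
  simp [lpLe]

theorem continuousOn_lpLe [CompleteSpace V] (hχ : IsLPBump χ) (k : ℤ) {f : Spacetime n → V}
    {s : Set ℝ}
    (hf : ContinuousOn f (s ×ˢ univ)) {e : V} {R : ℝ}
    (he : ∀ p ∈ s ×ˢ univ, R < ‖p.2‖ → f p = e) : ContinuousOn (lpLe χ k f) (s ×ˢ univ) := by
  have h := continuousOn_convolution_right_with_param (ContinuousLinearMap.lsmul ℝ ℝ)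
    (μ := (volume : Measure (E n))) (f := lpKernel χ k) (g := fun t x => f (t, x) - e) (s := s)
    (k := Metric.closedBall 0 R) (isCompact_closedBall _ _)
    (fun t x ht hx => by rw [he (t, x) ⟨ht, mem_univ x⟩ (by simpa using hx), sub_self])
    (hχ.lpKernel_integrable k).locallyIntegrable (hf.sub continuousOn_const)
  exact (continuousOn_const.add h).congr fun p hp => lpLe_eq_convolution hχ k hf he hp

/-- `f` is smooth on the open slab, and constant for `x` outside of a compact set. -/
structure Tame (T : ℝ) (f : Spacetime n → V) : Prop where
  smooth : ContDiffOn ℝ ∞ f (openSlab n T)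
  const : ∃ (e : V) (R : ℝ), ∀ p ∈ openSlab n T, R < ‖p.2‖ → f p = e

namespace Tame

variable {f : Spacetime n → V}

theorem exists_pd_eq_zero (hf : Tame T f) (α : Fin (n + 1)) :
    ∃ R : ℝ, ∀ p ∈ openSlab n T, R < ‖p.2‖ → pd α f p = 0 := by
  obtain ⟨e, R, he⟩ := hf.const
  refine ⟨R, fun p hp hR => ?_⟩
  have hev : f =ᶠ[𝓝 p] fun _ => e := by
    have ho : IsOpen {q : Spacetime n | R < ‖q.2‖} := isOpen_lt continuous_const (by fun_prop)
    filter_upwards [(isOpen_openSlab n T).mem_nhds hp, ho.mem_nhds hR] with q hq hq'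
    exact he q hq hq'
  rw [WaveMap.pd, hev.fderiv_eq]
  simp

theorem pd (hf : Tame T f) (α : Fin (n + 1)) : Tame T (pd α f) :=
  ⟨contDiffOn_pd hf.smooth α, 0, hf.exists_pd_eq_zero α⟩

theorem slice_bound (hf : Tame T f) {t : ℝ} (ht : t ∈ Ioo 0 T) :
    ∃ B, ∀ x : E n, ‖f (t, x)‖ ≤ B := by
  obtain ⟨e, R, he⟩ := hf.const
  exact exists_bound_slice hf.smooth.continuousOn he ht

theorem continuous_slice (hf : Tame T f) {t : ℝ} (ht : t ∈ Ioo 0 T) :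
    Continuous fun x : E n => f (t, x) :=
  WaveMap.continuous_slice hf.smooth.continuousOn ht

variable [CompleteSpace V]

theorem contDiffOn_lpLe (hf : Tame T f) (hχ : IsLPBump χ) (k : ℤ) :
    ContDiffOn ℝ ∞ (lpLe χ k f) (openSlab n T) := by
  obtain ⟨e, R, he⟩ := hf.const
  have h := contDiffOn_convolution_right_with_param (n := ⊤) (ContinuousLinearMap.lsmul ℝ ℝ)
    (μ := (volume : Measure (E n))) (f := lpKernel χ k) (g := fun t x => f (t, x) - e)
    (s := Ioo 0 T) isOpen_Ioo
    (k := Metric.closedBall 0 R) (isCompact_closedBall _ _)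
    (fun t x ht hx => by rw [he (t, x) ⟨ht, mem_univ x⟩ (by simpa using hx), sub_self])
    (hχ.lpKernel_integrable k).locallyIntegrable (hf.smooth.sub contDiffOn_const)
  exact (contDiffOn_const.add h).congr fun p hp =>
    lpLe_eq_convolution hχ k hf.smooth.continuousOn he hp

theorem pd_lpLe (hf : Tame T f) (hχ : IsLPBump χ) (k : ℤ) (α : Fin (n + 1)) {p : Spacetime n}
    (hp : p ∈ openSlab n T) : WaveMap.pd α (lpLe χ k f) p = lpLe χ k (WaveMap.pd α f) p := by
  obtain ⟨e, R, he⟩ := hf.const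
  have h := hasFDerivAt_convolution_right_with_param (ContinuousLinearMap.lsmul ℝ ℝ)
    (μ := (volume : Measure (E n))) (f := lpKernel χ k) (g := fun t x => f (t, x) - e)
    (s := Ioo 0 T) isOpen_Ioo
    (k := Metric.closedBall 0 R) (isCompact_closedBall _ _)
    (fun t x ht hx => by rw [he (t, x) ⟨ht, mem_univ x⟩ (by simpa using hx), sub_self])
    (hχ.lpKernel_integrable k).locallyIntegrable
    ((hf.smooth.sub contDiffOn_const).of_le (by simp)) p hp.1
  have hev : lpLe χ k f =ᶠ[𝓝 p] fun q => e + (lpKernel χ k ⋆[ContinuousLinearMap.lsmul ℝ ℝ, volume]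
      (fun x => f (q.1, x) - e)) q.2 := by
    filter_upwards [(isOpen_openSlab n T).mem_nhds hp] with q hq
    exact lpLe_eq_convolution hχ k hf.smooth.continuousOn he hq
  have hg : (fun x : E n => fderiv ℝ (Function.HasUncurry.uncurry fun (t : ℝ) (x : E n) =>
      f (t, x) - e) (p.1, x)) = fun x : E n => fderiv ℝ f (p.1, x) := by
    ext1 x
    exact fderiv_sub_const (𝕜 := ℝ) (f := f) (x := (p.1, x)) e
  rw [hg] at h
  have hcont : Continuous fun x : E n => fderiv ℝ f (p.1, x) :=
    WaveMap.continuous_slice (hf.smooth.fderiv_of_isOpen (isOpen_openSlab n T) (m := ∞)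
      (by simp)).continuousOn hp.1
  have hsupp : HasCompactSupport fun x : E n => fderiv ℝ f (p.1, x) := by
    refine HasCompactSupport.intro (isCompact_closedBall 0 R) fun x hx => ?_
    have hx' : R < ‖x‖ := by simpa using hx
    have hev : f =ᶠ[𝓝 (p.1, x)] fun _ => e := by
      have ho : IsOpen {q : Spacetime n | R < ‖q.2‖} := isOpen_lt continuous_const (by fun_prop)
      filter_upwards [(isOpen_openSlab n T).mem_nhds (x := (p.1, x)) ⟨hp.1, mem_univ x⟩,
        ho.mem_nhds (x := (p.1, x)) hx'] with q hq hq'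
      exact he q hq hq'
    rw [hev.fderiv_eq]
    simp
  rw [WaveMap.pd, hev.fderiv_eq, (h.const_add e).fderiv,
    convolution_precompR_apply _ (hχ.lpKernel_integrable k).locallyIntegrable hsupp hcont]
  rfl

end Tame

end Tame

/-! ### Classical wave maps are constant near spatial infinity -/

namespace IsClassicalWaveMap

variable {n m : ℕ} {T : ℝ} {φ : Spacetime n → E m}

theorem exists_const (h : IsClassicalWaveMap T φ) :
    ∃ (e : E m) (R : ℝ), ∀ p ∈ slab n T, R < ‖p.2‖ → φ p = e := by
  obtain ⟨e, vs, hv⟩ := h.const_outside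
  -- Within the slab, the cone at `v` lies in the ball of radius `‖v.2‖ + |T| + |v.1|`; the sum of
  -- these nonnegative radii dominates each of them.
  refine ⟨e, ∑ v ∈ vs, (‖v.2‖ + |T| + |v.1|), fun p hp hR => hv p hp fun v hvs hc => ?_⟩
  have h1 : ‖v.2‖ + |T| + |v.1| ≤ ∑ v ∈ vs, (‖v.2‖ + |T| + |v.1|) :=
    Finset.single_le_sum (f := fun v : Spacetime n => ‖v.2‖ + |T| + |v.1|)
      (fun v _ => by positivity) hvs
  have h2 : ‖p.2 - v.2‖ ≤ |p.1 - v.1| := hc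
  have h3 : |p.1 - v.1| ≤ |p.1| + |v.1| := abs_sub _ _
  have h4 : |p.1| ≤ |T| := by
    rw [abs_of_nonneg hp.1.1]
    exact hp.1.2.trans (le_abs_self T)
  have h5 : ‖p.2‖ ≤ ‖p.2 - v.2‖ + ‖v.2‖ := by
    simpa using norm_add_le (p.2 - v.2) v.2
  linarith

theorem tame (h : IsClassicalWaveMap T φ) : Tame T φ := by
  obtain ⟨e, R, he⟩ := h.exists_const
  exact ⟨h.smooth.mono openSlab_subset_slab, e, R, fun p hp => he p (openSlab_subset_slab hp)⟩

end IsClassicalWaveMap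

/-! ### Telescoping and geometric sums over dyadic frequencies -/

section Sums

theorem sum_Ioc_telescope {V : Type*} [AddCommGroup V] (F : ℤ → V) {a b : ℤ} (hab : a ≤ b) :
    ∑ j ∈ Finset.Ioc a b, (F j - F (j - 1)) = F b - F a := by
  induction b, hab using Int.leInduction with
  | base => simp
  | succ b hab ih =>
    rw [← Finset.insert_Ioc_right_eq_Ioc_add_one (by lia), Finset.sum_insert (by simp), ih]
    simp

variable {y : ℤ → ℝ} {ρ : ℝ}

/-- The last term dominates as in a geometric series. The bound does not depend on `a`, so it
survives the limit `a → -∞`. -/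
theorem sum_Ioc_le_of_growth (hρ : 1 < ρ) (hy0 : ∀ j, 0 ≤ y j) (hy : ∀ j, ρ * y j ≤ y (j + 1))
    (a b : ℤ) : ∑ j ∈ Finset.Ioc a b, y j ≤ ρ / (ρ - 1) * y b := by
  have hρ' : 0 < ρ - 1 := by linarith
  rcases lt_or_ge b a with h | h
  · rw [Finset.Ioc_eq_empty (by lia), Finset.sum_empty]
    have := hy0 b
    positivity
  induction b, h using Int.leInduction with
  | base =>
    have := hy0 a
    simp only [Finset.Ioc_self, Finset.sum_empty]
    positivity
  | succ b hab ih =>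
    rw [← Finset.insert_Ioc_right_eq_Ioc_add_one (by lia), Finset.sum_insert (by simp)]
    have h1 := hy b
    have h2 : ρ / (ρ - 1) * y b ≤ 1 / (ρ - 1) * y (b + 1) := by
      rw [div_mul_eq_mul_div, div_mul_eq_mul_div, one_mul]
      gcongr
    have h3 : ρ / (ρ - 1) * y (b + 1) = y (b + 1) + 1 / (ρ - 1) * y (b + 1) := by
      field_simp
      ring
    linarith

theorem sum_Ioc_le_of_decay (hρ : 1 < ρ) (hy0 : ∀ j, 0 ≤ y j) (hy : ∀ j, ρ * y (j + 1) ≤ y j)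
    (a b : ℤ) : ∑ j ∈ Finset.Ioc a b, y j ≤ 1 / (ρ - 1) * y a := by
  have hρ' : 0 < ρ - 1 := by linarith
  have key : ∀ b, a ≤ b → ∑ j ∈ Finset.Ioc a b, y j ≤ 1 / (ρ - 1) * y a - 1 / (ρ - 1) * y b := by
    intro b hab
    induction b, hab using Int.leInduction with
    | base => simp
    | succ b hab ih =>
      rw [← Finset.insert_Ioc_right_eq_Ioc_add_one (by lia), Finset.sum_insert (by simp)]
      have h1 := hy b
      have h2 : 1 / (ρ - 1) * (ρ * y (b + 1)) ≤ 1 / (ρ - 1) * y b := by gcongr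
      have h3 : 1 / (ρ - 1) * (ρ * y (b + 1)) = y (b + 1) + 1 / (ρ - 1) * y (b + 1) := by
        field_simp
        ring
      linarith
  rcases lt_or_ge b a with h | h
  · rw [Finset.Ioc_eq_empty (by lia), Finset.sum_empty]
    have := hy0 a
    positivity
  · refine (key b h).trans (sub_le_self _ ?_)
    have := hy0 b
    positivity

end Sums

/-! ### Littlewood-Paley decomposition of spacetime functions and Bernstein's inequality -/

section LittlewoodPaley

variable {n : ℕ} {T : ℝ} {V : Type*} [NormedAddCommGroup V] [NormedSpace ℝ V] {χ : E n → ℝ}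
  {f : Spacetime n → V}

theorem lpLe_enorm_le (χ : E n → ℝ) (k : ℤ) (f : Spacetime n → V) (t : ℝ) (x : E n) :
    ‖lpLe χ k f (t, x)‖ₑ ≤ ∫⁻ y, ‖lpKernel χ k y‖ₑ * ‖f (t, x - y)‖ₑ := by
  refine (enorm_integral_le_lintegral_enorm _).trans_eq ?_
  simp_rw [enorm_smul]

theorem lpLe_norm_le (hχ : IsLPBump χ) (k : ℤ) {t B : ℝ}
    (hB : ∀ x : E n, ‖f (t, x)‖ ≤ B) (x : E n) :
    ‖lpLe χ k f (t, x)‖ ≤ (∫ y, |lpKernel χ 0 y|) * B := by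
  rw [← IsLPBump.integral_abs_lpKernel χ k, ← integral_mul_const]
  refine norm_integral_le_of_norm_le ((hχ.lpKernel_integrable k).norm.mul_const B)
    (Eventually.of_forall fun y => ?_)
  rw [norm_smul]
  exact mul_le_mul_of_nonneg_left (hB _) (norm_nonneg _)

theorem sum_lp (χ : E n → ℝ) (f : Spacetime n → V) {a b : ℤ} (hab : a ≤ b) (p : Spacetime n) :
    ∑ j ∈ Finset.Ioc a b, lp χ j f p = lpLe χ b f p - lpLe χ a f p :=
  sum_Ioc_telescope (fun j => lpLe χ j f p) hab

theorem Tame.exists_lp_bound (hf : Tame T f) (hχ : IsLPBump χ) (k : ℤ) {t : ℝ} (ht : t ∈ Ioo 0 T) :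
    ∃ B, ∀ x : E n, ‖lp χ k f (t, x)‖ ≤ B := by
  obtain ⟨B, hB⟩ := hf.slice_bound ht
  refine ⟨_, fun x => (norm_sub_le _ _).trans
    (add_le_add (lpLe_norm_le hχ k hB x) (lpLe_norm_le hχ (k - 1) hB x))⟩

variable [CompleteSpace V]

namespace Tame

theorem contDiffOn_lp (hf : Tame T f) (hχ : IsLPBump χ) (k : ℤ) :
    ContDiffOn ℝ ∞ (lp χ k f) (openSlab n T) :=
  (hf.contDiffOn_lpLe hχ k).sub (hf.contDiffOn_lpLe hχ (k - 1))

theorem pd_lp (hf : Tame T f) (hχ : IsLPBump χ) (k : ℤ) (α : Fin (n + 1)) {p : Spacetime n}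
    (hp : p ∈ openSlab n T) : WaveMap.pd α (lp χ k f) p = lp χ k (WaveMap.pd α f) p := by
  have h : lp χ k f = fun p => lpLe χ k f p - lpLt χ k f p := rfl
  rw [h]
  refine (pd_sub (hf.contDiffOn_lpLe hχ k) (hf.contDiffOn_lpLe hχ (k - 1)) hp α).trans ?_
  exact congrArg₂ (· - ·) (hf.pd_lpLe hχ k α hp) (hf.pd_lpLe hχ (k - 1) α hp)

/-- The kernel identity applied to `P_{≤ k}` and `P_{≤ k-1}`; the index `k + 1` is needed because
reproduction requires a strictly larger frequency. -/
theorem lpLe_lp (hf : Tame T f) (hχ : IsLPBump χ) (k : ℤ) {p : Spacetime n}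
    (hp : p ∈ openSlab n T) : lpLe χ (k + 1) (lp χ k f) p = lp χ k f p := by
  obtain ⟨B, hB⟩ := hf.slice_bound hp.1
  have hc := hf.continuous_slice hp.1
  have hc1 := WaveMap.continuous_slice (hf.contDiffOn_lpLe hχ k).continuousOn hp.1
  have hc2 := WaveMap.continuous_slice (hf.contDiffOn_lpLe hχ (k - 1)).continuousOn hp.1
  have e1 := lp_reproducing hχ (show k < k + 1 by lia) hc hB p.2
  have e2 := lp_reproducing hχ (show k - 1 < k + 1 by lia) hc hB p.2
  have i1 := integrable_smul_translate (hχ.lpKernel_integrable (k + 1)) hc1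
    (fun x => lpLe_norm_le hχ k hB x) p.2
  have i2 := integrable_smul_translate (hχ.lpKernel_integrable (k + 1)) hc2
    (fun x => lpLe_norm_le hχ (k - 1) hB x) p.2
  have h : lpLe χ (k + 1) (lp χ k f) p = (∫ y, lpKernel χ (k + 1) y • lpLe χ k f (p.1, p.2 - y)) -
      ∫ y, lpKernel χ (k + 1) y • lpLe χ (k - 1) f (p.1, p.2 - y) := by
    rw [← integral_sub i1 i2]
    simp only [lpLe, lp, lpLt, smul_sub]
  rw [h]
  exact congrArg₂ (· - ·) e1 e2

/-- `∂_i P_k f = (∂_i K_{k+1}) * P_k f`, where `K_j` is the kernel of `P_{≤ j}`. -/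
theorem pd_lp_eq_integral (hf : Tame T f) (hχ : IsLPBump χ) (k : ℤ) (i : Fin n)
    {p : Spacetime n} (hp : p ∈ openSlab n T) :
    WaveMap.pd i.succ (lp χ k f) p = ∫ y, fderiv ℝ (lpKernel χ (k + 1)) y
      (EuclideanSpace.single i 1) • lp χ k f (p.1, p.2 - y) := by
  have hsm := hf.contDiffOn_lp hχ k
  have hd : ∀ x : E n, fderiv ℝ (fun x => lp χ k f (p.1, x)) x (EuclideanSpace.single i 1) =
      WaveMap.pd i.succ (lp χ k f) (p.1, x) := by
    intro x
    have h1 := (differentiableAt_of_mem hsm (p := (p.1, x)) ⟨hp.1, mem_univ x⟩).hasFDerivAt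
    have h2 : HasFDerivAt (fun x : E n => (p.1, x)) (ContinuousLinearMap.inr ℝ ℝ (E n)) x :=
      hasFDerivAt_prodMk_right p.1 x
    have h3 := h1.comp x h2
    change HasFDerivAt (fun x => lp χ k f (p.1, x)) _ x at h3
    rw [h3.fderiv]
    simp [WaveMap.pd, coordVec]
  have hg : ContDiff ℝ 1 fun x : E n => lp χ k f (p.1, x) := by
    have h1 : ContDiffOn ℝ ∞ (fun x : E n => lp χ k f (p.1, x)) univ :=
      hsm.comp (by fun_prop) fun x _ => ⟨hp.1, mem_univ x⟩
    exact (contDiffOn_univ.1 h1).of_le (by simp)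
  obtain ⟨B, hB⟩ := hf.exists_lp_bound hχ k hp.1
  obtain ⟨B', hB'⟩ := (hf.pd i.succ).exists_lp_bound hχ k hp.1
  rw [← integral_smul_fderiv_translate (g := fun x : E n => lp χ k f (p.1, x))
    ((hχ.lpKernel_contDiff (k + 1)).of_le (by simp))
    (hχ.lpKernel_integrable (k + 1)) (hχ.fderiv_lpKernel_integrable (k + 1) _) hg hB
    (B' := B') (fun x => by
      rw [hd, hf.pd_lp hχ k _ (p := (p.1, x)) ⟨hp.1, mem_univ x⟩]
      exact hB' x)]
  simp_rw [hd]
  rw [hf.pd_lp hχ k _ hp, ← (hf.pd i.succ).lpLe_lp hχ k hp, lpLe]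
  congr 1
  ext y
  rw [hf.pd_lp hχ k _ (p := (p.1, p.2 - y)) ⟨hp.1, mem_univ _⟩]

end Tame

/-- The constant in the Bernstein inequality `‖∂_i P_k f‖ ≤ C 2^k ‖P_k f‖`. -/
def bernsteinConst (χ : E n → ℝ) : ℝ :=
  1 + 2 * ∑ i : Fin n, ∫ y, |fderiv ℝ (lpKernel χ 0) y (EuclideanSpace.single i 1)|

theorem one_le_bernsteinConst (χ : E n → ℝ) : 1 ≤ bernsteinConst χ := by
  unfold bernsteinConst
  have : 0 ≤ ∑ i : Fin n, ∫ y, |fderiv ℝ (lpKernel χ 0) y (EuclideanSpace.single i 1)| :=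
    Finset.sum_nonneg fun i _ => integral_nonneg fun y => abs_nonneg _
  linarith

/-- The derivative is moved onto the kernel of `P_{≤ k+1}`, and Young's inequality applies on each
slice. By scaling the `L¹` norm of the differentiated kernel is proportional to `2^{k+1}`, whence
the 2 in `bernsteinConst`. -/
theorem NormBound.bernstein (hf : Tame T f) (hχ : IsLPBump χ) {k : ℤ} (i : Fin n) {q r : ℝ≥0∞}
    (hr : 1 ≤ r) {B : ℝ} (h : NormBound T q r (lp χ k f) B) :
    NormBound T q r (pd i.succ (lp χ k f)) (bernsteinConst χ * 2 ^ k * B) := by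
  have hKc : Continuous fun y => fderiv ℝ (lpKernel χ (k + 1)) y (EuclideanSpace.single i 1) :=
    ((hχ.lpKernel_contDiff (k + 1)).continuous_fderiv (by simp)).clm_apply continuous_const
  have hK1 := hχ.fderiv_lpKernel_integrable (k + 1) (EuclideanSpace.single i 1)
  set C := ∫ y, |fderiv ℝ (lpKernel χ (k + 1)) y (EuclideanSpace.single i 1)| with hC
  have hC' : C ≤ bernsteinConst χ * 2 ^ k := by
    rw [hC, hχ.integral_abs_fderiv_lpKernel, zpow_add₀ two_ne_zero, zpow_one]
    have h1 := Finset.single_le_sum (f := fun i : Fin n => ∫ y, |fderiv ℝ (lpKernel χ 0) y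
      (EuclideanSpace.single i 1)|) (fun i _ => integral_nonneg fun y => abs_nonneg _)
      (Finset.mem_univ i)
    have h2 : (0 : ℝ) < 2 ^ k := by positivity
    unfold bernsteinConst
    nlinarith
  refine NormBound.mono ⟨(contDiffOn_pd (hf.contDiffOn_lp hχ k) _).continuousOn,
    mul_nonneg (integral_nonneg fun y => abs_nonneg _) h.nonneg, ?_⟩
    (mul_le_mul_of_nonneg_right hC' h.nonneg)
  rw [ENNReal.ofReal_mul (integral_nonneg fun y => abs_nonneg _)]
  refine le_trans ?_ (mul_le_mul_right h.le _)
  rw [mixedNorm, mixedNorm]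
  have key : ∀ᵐ t ∂(volume.restrict (Icc 0 T) : Measure ℝ),
      eLpNorm (fun x : E n => pd i.succ (lp χ k f) (t, x)) r volume ≤
        ENNReal.ofReal C * eLpNorm (fun x : E n => lp χ k f (t, x)) r volume := by
    filter_upwards [ae_mem_Ioo T] with t ht
    refine eLpNorm_le_of_le_convolution hKc hK1 (continuous_slice h.cont ht) (fun x => ?_) hr
    rw [hf.pd_lp_eq_integral hχ k i (p := (t, x)) ⟨ht, mem_univ x⟩]
    refine (enorm_integral_le_lintegral_enorm _).trans_eq ?_
    simp_rw [enorm_smul]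
  exact (eLpNorm_le_nnreal_smul_eLpNorm_of_ae_le_mul' (c := C.toNNReal) key q)

/-- `P_{≤ k} f` is the limit of the sums of `P_j f` over `-N < j ≤ k`, since compact support forces
`P_{≤ -N} f → 0`. Growth of the bounds makes the sum comparable to its top term. -/
theorem NormBound.lpLe_of_lp (hf : Tame T f) {R : ℝ}
    (hR : ∀ p ∈ openSlab n T, R < ‖p.2‖ → f p = 0) (hn : 0 < n) (hχ : IsLPBump χ)
    {q r : ℝ≥0∞} (hq : 1 ≤ q) (hr : 1 ≤ r) {G ρ : ℝ} {y : ℤ → ℝ} (hG : 0 ≤ G) (hρ : 1 < ρ)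
    (hy0 : ∀ j, 0 ≤ y j) (hy : ∀ j, ρ * y j ≤ y (j + 1))
    (h : ∀ j, NormBound T q r (lp χ j f) (G * y j)) (k : ℤ) :
    NormBound T q r (lpLe χ k f) (G * (ρ / (ρ - 1)) * y k) := by
  refine NormBound.of_tendsto (G := fun N p => ∑ j ∈ Finset.Ioc (-(N : ℤ)) k, lp χ j f p)
    (hf.contDiffOn_lpLe hχ k).continuousOn (fun p hp => ?_) fun N => ?_
  · obtain ⟨B, hB⟩ := hf.slice_bound hp.1
    have h1 := tendsto_lp_atBot hχ hn (hf.continuous_slice hp.1) hB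
      (fun x => hR (p.1, x) ⟨hp.1, mem_univ x⟩) p.2
    have h2 := h1.const_sub (lpLe χ k f p)
    rw [sub_zero] at h2
    refine h2.congr' ?_
    filter_upwards [eventually_ge_atTop (-k).toNat] with N hN
    rw [sum_lp χ f (by lia)]
    rfl
  · refine (NormBound.sum hq hr _ fun j _ => h j).mono ?_
    rw [← Finset.mul_sum, mul_assoc]
    exact mul_le_mul_of_nonneg_left (sum_Ioc_le_of_growth hρ hy0 hy _ _) hG

/-- The counterpart for frequencies above `2^k`: here `P_{≤ N} f → f`, and decay of the bounds makes
the sum comparable to `y k`. -/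
theorem NormBound.sub_lpLe_of_lp (hf : Tame T f) (hχ : IsLPBump χ)
    {q r : ℝ≥0∞} (hq : 1 ≤ q) (hr : 1 ≤ r) {G ρ : ℝ} {y : ℤ → ℝ} (hG : 0 ≤ G) (hρ : 1 < ρ)
    (hy0 : ∀ j, 0 ≤ y j) (hy : ∀ j, ρ * y (j + 1) ≤ y j)
    (h : ∀ j, NormBound T q r (lp χ j f) (G * y j)) (k : ℤ) :
    NormBound T q r (fun p => f p - lpLe χ k f p) (G * (1 / (ρ - 1)) * y k) := by
  refine NormBound.of_tendsto (G := fun N p => ∑ j ∈ Finset.Ioc k (N : ℤ), lp χ j f p)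
    (hf.smooth.continuousOn.sub (hf.contDiffOn_lpLe hχ k).continuousOn) (fun p hp => ?_)
    fun N => ?_
  · obtain ⟨B, hB⟩ := hf.slice_bound hp.1
    have h1 := tendsto_lp_atTop hχ (hf.continuous_slice hp.1) hB p.2
    refine (h1.sub_const (lpLe χ k f p)).congr' ?_
    filter_upwards [eventually_ge_atTop k.toNat] with N hN
    rw [sum_lp χ f (by lia)]
    rfl
  · refine (NormBound.sum hq hr _ fun j _ => h j).mono ?_
    rw [← Finset.mul_sum, mul_assoc]
    exact mul_le_mul_of_nonneg_left (sum_Ioc_le_of_decay hρ hy0 hy _ _) hG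

end LittlewoodPaley

/-! ### Consequences of the Strichartz norm -/

section Strichartz

variable {n m : ℕ} {T : ℝ} {V : Type*} [NormedAddCommGroup V] [NormedSpace ℝ V]

/-- The scaling exponent of `L^q_t L^r_x`. -/
def scaling (n : ℕ) (q r : ℝ≥0∞) : ℝ := (q⁻¹).toReal + n * (r⁻¹).toReal

theorem NormBound.of_strichartzNorm {f : Spacetime n → V} (hf : ContDiffOn ℝ ∞ f (openSlab n T))
    {k : ℤ} {a : ℝ} (ha : 0 ≤ a) (h : strichartzNorm T k f ≤ ENNReal.ofReal a) {q r : ℝ≥0∞}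
    (hqr : Admissible n q r) :
    NormBound T q r f ((2 : ℝ) ^ (-scaling n q r * k) * a) ∧
      NormBound T q r (pd 0 f) ((2 : ℝ) ^ ((1 - scaling n q r) * k) * a) := by
  have h1 : ENNReal.ofReal ((2 : ℝ) ^ (scaling n q r * k)) * (mixedNorm T q r f +
      ENNReal.ofReal ((2 : ℝ) ^ (-k)) * mixedNorm T q r (pd 0 f)) ≤ ENNReal.ofReal a := by
    refine le_trans ?_ h
    unfold strichartzNorm
    refine le_trans (le_of_eq ?_) (le_iSup₂_of_le q r (le_iSup_of_le hqr le_rfl))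
    congr 3
    unfold scaling
    ring
  set s := scaling n q r
  have key : ∀ (z : ℝ) (X : ℝ≥0∞), ENNReal.ofReal ((2 : ℝ) ^ z) * X ≤ ENNReal.ofReal a →
      X ≤ ENNReal.ofReal ((2 : ℝ) ^ (-z) * a) := by
    intro z X hX
    have hz : (2 : ℝ) ^ (-z) * 2 ^ z = 1 := by
      rw [← Real.rpow_add two_pos]; simp
    calc X = ENNReal.ofReal ((2 : ℝ) ^ (-z)) * (ENNReal.ofReal ((2 : ℝ) ^ z) * X) := by
          rw [← mul_assoc, ← ENNReal.ofReal_mul (by positivity), hz, ENNReal.ofReal_one, one_mul]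
      _ ≤ ENNReal.ofReal ((2 : ℝ) ^ (-z)) * ENNReal.ofReal a := by gcongr
      _ = _ := by rw [← ENNReal.ofReal_mul (by positivity)]
  refine ⟨⟨hf.continuousOn, by positivity, ?_⟩,
    ⟨(contDiffOn_pd hf 0).continuousOn, by positivity, ?_⟩⟩
  · rw [neg_mul]
    refine key _ _ (le_trans ?_ h1)
    gcongr
    exact le_self_add
  · have e : (1 - s) * (k : ℝ) = -((s - 1) * k) := by ring
    rw [e]
    refine key _ _ (le_trans ?_ h1)
    have e2 : ENNReal.ofReal ((2 : ℝ) ^ ((s - 1) * k)) =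
        ENNReal.ofReal ((2 : ℝ) ^ (s * k)) * ENNReal.ofReal ((2 : ℝ) ^ (-k)) := by
      rw [← ENNReal.ofReal_mul (by positivity), ← Real.rpow_intCast, ← Real.rpow_add two_pos]
      congr 2
      push_cast
      ring
    rw [e2, mul_assoc]
    gcongr
    exact le_add_self

/-- The time derivative is part of the Strichartz norm; the spatial ones cost `2^k` by Bernstein.
One constant serves both because `bernsteinConst` is at least 1. -/
theorem NormBound.pd_lp_of_strichartzNorm [CompleteSpace V] {χ : E n → ℝ} (hχ : IsLPBump χ)
    {f : Spacetime n → V} (hf : Tame T f) {k : ℤ} {a : ℝ} (ha : 0 ≤ a)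
    (h : strichartzNorm T k (lp χ k f) ≤ ENNReal.ofReal a) {q r : ℝ≥0∞}
    (hqr : Admissible n q r) (α : Fin (n + 1)) :
    NormBound T q r (pd α (lp χ k f))
      (bernsteinConst χ * ((2 : ℝ) ^ ((1 - scaling n q r) * k) * a)) := by
  obtain ⟨h1, h2⟩ := NormBound.of_strichartzNorm (hf.contDiffOn_lp hχ k) ha h hqr
  refine Fin.cases ?_ (fun i => ?_) α
  · refine h2.mono (le_mul_of_one_le_left h2.nonneg (one_le_bernsteinConst χ))
  · have h3 := h1.bernstein hf hχ i (one_le_two.trans hqr.2.1)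
    refine h3.mono (le_of_eq ?_)
    have e : (2 : ℝ) ^ ((1 - scaling n q r) * k) = 2 ^ k * (2 : ℝ) ^ (-scaling n q r * k) := by
      rw [← Real.rpow_intCast, ← Real.rpow_add two_pos]
      congr 1
      ring
    rw [e]
    ring

end Strichartz

theorem holderTriple_two_mul (r : ℝ≥0∞) : ENNReal.HolderTriple (2 * r) (2 * r) r where
  inv_add_inv_eq_inv := by
    rw [← two_mul, ENNReal.mul_inv (by simp) (by simp), ← mul_assoc,
      ENNReal.mul_inv_cancel (by simp) (by simp), one_mul]

/-! ### Frequency-truncated sources on a time slice -/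

section Slice

variable {n : ℕ} {V : Type*} [NormedAddCommGroup V] {χ : E n → ℝ}

/-- The constant in the Bernstein inequality `‖P_{≤ k} f‖_s ≤ C 2^{kn(1/2-1/s)} ‖f‖_2`. -/
def bernsteinTwoConst (χ : E n → ℝ) (s : ℝ) : ℝ :=
  (∫ y, lpKernel χ 0 y ^ 2) ^ ((1 - 2 / s) / 2) * (∫ y, |lpKernel χ 0 y|) ^ (2 / s)

theorem bernsteinTwoConst_nonneg (χ : E n → ℝ) (s : ℝ) : 0 ≤ bernsteinTwoConst χ s := by
  unfold bernsteinTwoConst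
  have h1 : 0 ≤ ∫ y, lpKernel χ 0 y ^ 2 := integral_nonneg fun y => sq_nonneg _
  have h2 : 0 ≤ ∫ y, |lpKernel χ 0 y| := integral_nonneg fun y => abs_nonneg _
  positivity

theorem eLpNorm_lpKernel_two (hχ : IsLPBump χ) (k : ℤ) :
    eLpNorm (lpKernel χ k) 2 volume =
      ENNReal.ofReal ((((2 : ℝ) ^ k) ^ n * ∫ y, lpKernel χ 0 y ^ 2) ^ (1 / 2 : ℝ)) := by
  rw [← IsLPBump.integral_sq_lpKernel, (hχ.lpKernel_memLp_two k).eLpNorm_eq_integral_rpow_norm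
    two_ne_zero (by simp)]
  simp

/-- Young's inequality keeps the exponent `s` for `g₁`, while the kernel lifts `g₂` from `L²` to
`L^s` at the price of a positive power of `2^k` when `s > 2`. The hypothesis is a majorant of `P_{≤
k}` applied to a source bounded by `g₁ + g₂`. -/
theorem eLpNorm_le_low_add_high (hχ : IsLPBump χ) (k : ℤ) {f : E n → V} {g₁ g₂ : E n → ℝ}
    (hg₁ : Continuous g₁) (hg₂ : Continuous g₂)
    (h : ∀ x, ‖f x‖ₑ ≤ ∫⁻ y, ‖lpKernel χ k y‖ₑ * (‖g₁ (x - y)‖ₑ + ‖g₂ (x - y)‖ₑ))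
    {s : ℝ} (hs : 2 ≤ s) :
    eLpNorm f (ENNReal.ofReal s) volume ≤
      ENNReal.ofReal (∫ y, |lpKernel χ 0 y|) * eLpNorm g₁ (ENNReal.ofReal s) volume +
      ENNReal.ofReal (bernsteinTwoConst χ s * (2 : ℝ) ^ (n * ((1 - 2 / s) / 2) * k)) *
        eLpNorm g₂ 2 volume := by
  have hKc := hχ.lpKernel_continuous k
  have hK1 := hχ.lpKernel_integrable k
  have hs0 : 0 < s := by linarith
  have hs1 : 1 ≤ ENNReal.ofReal s := by
    rw [← ENNReal.ofReal_one]; exact ENNReal.ofReal_le_ofReal (by linarith)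
  have hm : ∀ g : E n → ℝ, Continuous g →
      Measurable fun x => ∫⁻ y, ‖lpKernel χ k y‖ₑ * ‖g (x - y)‖ₑ := by
    intro g hg
    have h1 : Continuous fun p : E n × E n => lpKernel χ k p.2 := by fun_prop
    have h2 : Continuous fun p : E n × E n => g (p.1 - p.2) := by fun_prop
    exact (h1.enorm.measurable.mul h2.enorm.measurable).lintegral_prod_right'
  set F₁ : E n → ℝ≥0∞ := fun x => ∫⁻ y, ‖lpKernel χ k y‖ₑ * ‖g₁ (x - y)‖ₑ with hF₁
  set F₂ : E n → ℝ≥0∞ := fun x => ∫⁻ y, ‖lpKernel χ k y‖ₑ * ‖g₂ (x - y)‖ₑ with hF₂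
  have e1 : eLpNorm f (ENNReal.ofReal s) volume ≤ eLpNorm (F₁ + F₂) (ENNReal.ofReal s) volume := by
    refine eLpNorm_mono_enorm fun x => (h x).trans_eq ?_
    rw [enorm_eq_self, Pi.add_apply, hF₁, hF₂, ← lintegral_add_left]
    · simp_rw [mul_add]
    · have h2 : Continuous fun y => g₁ (x - y) := by fun_prop
      exact hKc.enorm.measurable.mul h2.enorm.measurable
  refine e1.trans ((eLpNorm_add_le (hm g₁ hg₁).aestronglyMeasurable
    (hm g₂ hg₂).aestronglyMeasurable hs1).trans (add_le_add ?_ ?_))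
  · rw [← IsLPBump.integral_abs_lpKernel χ k]
    exact eLpNorm_le_of_le_convolution hKc hK1 hg₁ (fun x => le_rfl) hs1
  · refine (eLpNorm_le_of_le_convolution_two hKc hK1 (f := F₂) (hm g₂ hg₂) hg₂ (fun x => le_rfl)
      hs).trans_eq ?_
    congr 1
    have h1 : 0 ≤ ∫ y, lpKernel χ 0 y ^ 2 := integral_nonneg fun y => sq_nonneg _
    have h2 : 0 ≤ ∫ y, |lpKernel χ 0 y| := integral_nonneg fun y => abs_nonneg _
    have hp1 : 0 ≤ 1 - 2 / s := by
      rw [sub_nonneg, div_le_one hs0]; exact hs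
    have hp2 : 0 ≤ 2 / s := by positivity
    rw [eLpNorm_lpKernel_two hχ, IsLPBump.integral_abs_lpKernel,
      ENNReal.ofReal_rpow_of_nonneg (by positivity) hp1,
      ENNReal.ofReal_rpow_of_nonneg h2 hp2, ← ENNReal.ofReal_mul (by positivity)]
    congr 1
    rw [← Real.rpow_mul (by positivity), Real.mul_rpow (by positivity) h1]
    have e : (((2 : ℝ) ^ k) ^ n) ^ (1 / 2 * (1 - 2 / s)) =
        (2 : ℝ) ^ (n * ((1 - 2 / s) / 2) * k) := by
      rw [← Real.rpow_intCast, ← Real.rpow_natCast, ← Real.rpow_mul two_pos.le,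
        ← Real.rpow_mul two_pos.le]
      congr 1
      ring
    rw [e, bernsteinTwoConst]
    ring_nf

end Slice

/-! ### The D'Alembertian of `P_{≤ k}φ` -/

section Box

variable {n m : ℕ} {T : ℝ} {χ : E n → ℝ} {φ : Spacetime n → E m}

/-- Only the size of the nonlinearity matters here: `|φ| = 1` and the signs of the metric are
discarded. -/
theorem IsClassicalWaveMap.norm_box_le (h : IsClassicalWaveMap T φ) {p : Spacetime n}
    (hp : p ∈ openSlab n T) : ‖box φ p‖ ≤ ∑ α, ‖pd α φ p‖ ^ 2 := by
  rw [h.equation p hp, norm_neg, norm_smul, h.sphere p (openSlab_subset_slab hp), mul_one]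
  refine (norm_sum_le _ _).trans (Finset.sum_le_sum fun α _ => ?_)
  rw [norm_mul, Real.norm_eq_abs, abs_eta, one_mul, real_inner_self_eq_norm_sq]
  simp

theorem Tame.box_lpLe {V : Type*} [NormedAddCommGroup V] [NormedSpace ℝ V] [CompleteSpace V]
    {f : Spacetime n → V} (hf : Tame T f) (hχ : IsLPBump χ) (k : ℤ)
    {p : Spacetime n} (hp : p ∈ openSlab n T) : box (lpLe χ k f) p = lpLe χ k (box f) p := by
  have h1 : ∀ α, WaveMap.pd α (WaveMap.pd α (lpLe χ k f)) p =
      lpLe χ k (WaveMap.pd α (WaveMap.pd α f)) p := by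
    intro α
    rw [pd_congr (fun q hq => hf.pd_lpLe hχ k α hq) hp, (hf.pd α).pd_lpLe hχ k α hp]
  have h2 : lpLe χ k (box f) p = ∫ y, ∑ α, lpKernel χ k y •
      (eta α • WaveMap.pd α (WaveMap.pd α f) (p.1, p.2 - y)) := by
    simp only [lpLe, box, Finset.smul_sum]
  simp only [box, h1] at h2 ⊢
  rw [h2, integral_finsetSum]
  · refine Finset.sum_congr rfl fun α _ => ?_
    simp_rw [lpLe, ← integral_smul, smul_comm (eta α)]
  · intro α _
    obtain ⟨B, hB⟩ := ((hf.pd α).pd α).slice_bound hp.1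
    have := (integrable_smul_translate (hχ.lpKernel_integrable k)
      (((hf.pd α).pd α).continuous_slice hp.1) hB p.2).smul (eta α)
    refine this.congr (Eventually.of_forall fun y => ?_)
    exact smul_comm _ _ _

/-- The scaling exponent of `∂P_kφ` in `L^4_t L^{2(n-1)}_x`. -/
def lowExp (n : ℕ) : ℝ := ((n : ℝ) - 3) / (4 * ((n : ℝ) - 1))

/-- Minus the scaling exponent of `∂P_kφ` in `L^4_t L^4_x`. -/
def highExp (n : ℕ) : ℝ := ((n : ℝ) - 3) / 4

theorem lowExp_pos (hn : 5 ≤ n) : 0 < lowExp n := by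
  have : (5 : ℝ) ≤ n := by exact_mod_cast hn
  exact div_pos (by linarith) (by linarith)

theorem highExp_pos (hn : 5 ≤ n) : 0 < highExp n := by
  have : (5 : ℝ) ≤ n := by exact_mod_cast hn
  exact div_pos (by linarith) (by linarith)

theorem cast_sub_one (hn : 5 ≤ n) : ((n - 1 : ℕ) : ℝ) = (n : ℝ) - 1 := by
  push_cast [Nat.cast_sub (show 1 ≤ n by lia)]; rfl

theorem toReal_inv_low (hn : 5 ≤ n) :
    ((2 * ((n - 1 : ℕ) : ℝ≥0∞))⁻¹).toReal = (2 * ((n : ℝ) - 1))⁻¹ := by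
  rw [ENNReal.toReal_inv, ENNReal.toReal_mul, ENNReal.toReal_natCast, cast_sub_one hn]
  simp

theorem admissible_low (hn : 5 ≤ n) : Admissible n (2 * 2) (2 * ((n - 1 : ℕ) : ℝ≥0∞)) := by
  have h5 : (5 : ℝ) ≤ n := by exact_mod_cast hn
  have h4 : ((2 * 2 : ℝ≥0∞)⁻¹).toReal = 1 / 4 := by
    rw [ENNReal.toReal_inv, ENNReal.toReal_mul]; norm_num
  refine ⟨?_, ?_, ?_⟩
  · norm_num
  · have : (1 : ℝ≥0∞) ≤ ((n - 1 : ℕ) : ℝ≥0∞) := by exact_mod_cast (by lia : 1 ≤ n - 1)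
    calc (2 : ℝ≥0∞) = 2 * 1 := by simp
      _ ≤ _ := by gcongr
  · rw [toReal_inv_low hn, h4]
    have : ((n : ℝ) - 1) / 2 * (2 * ((n : ℝ) - 1))⁻¹ = 1 / 4 := by
      have : (n : ℝ) - 1 ≠ 0 := by linarith
      field_simp
      norm_num
    rw [this]
    linarith

theorem scaling_low (hn : 5 ≤ n) :
    1 - scaling n (2 * 2) (2 * ((n - 1 : ℕ) : ℝ≥0∞)) = lowExp n := by
  have h5 : (5 : ℝ) ≤ n := by exact_mod_cast hn
  have h4 : ((2 * 2 : ℝ≥0∞)⁻¹).toReal = 1 / 4 := by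
    rw [ENNReal.toReal_inv, ENNReal.toReal_mul]; norm_num
  rw [scaling, toReal_inv_low hn, h4, lowExp]
  have : (n : ℝ) - 1 ≠ 0 := by linarith
  field_simp
  ring

theorem admissible_high (hn : 5 ≤ n) : Admissible n (2 * 2) (2 * 2) := by
  have h5 : (5 : ℝ) ≤ n := by exact_mod_cast hn
  have h4 : ((2 * 2 : ℝ≥0∞)⁻¹).toReal = 1 / 4 := by
    rw [ENNReal.toReal_inv, ENNReal.toReal_mul]; norm_num
  refine ⟨by norm_num, by norm_num, ?_⟩
  rw [h4]
  linarith

theorem scaling_high (n : ℕ) : 1 - scaling n (2 * 2) (2 * 2) = -highExp n := by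
  have h4 : ((2 * 2 : ℝ≥0∞)⁻¹).toReal = 1 / 4 := by
    rw [ENNReal.toReal_inv, ENNReal.toReal_mul]; norm_num
  rw [scaling, h4, highExp]
  ring

/-- The frequency-localized bounds on `φ`, in terms of a sequence `a`. -/
structure StrichartzBound (χ : E n → ℝ) (T : ℝ) (φ : Spacetime n → E m) (a : ℤ → ℝ) : Prop where
  nonneg : ∀ k, 0 ≤ a k
  le : ∀ k, strichartzNorm T k (lp χ k φ) ≤ ENNReal.ofReal (a k)

namespace StrichartzBound

variable {a : ℤ → ℝ}

theorem pd_lp (ha : StrichartzBound χ T φ a) (hχ : IsLPBump χ) (hφ : Tame T φ) {q r : ℝ≥0∞}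
    (hqr : Admissible n q r) (α : Fin (n + 1)) (k : ℤ) :
    NormBound T q r (pd α (lp χ k φ))
      (bernsteinConst χ * ((2 : ℝ) ^ ((1 - scaling n q r) * k) * a k)) :=
  NormBound.pd_lp_of_strichartzNorm hχ hφ (ha.nonneg k) (ha.le k) hqr α

/-- The majorant `y` separates the scaling from the growth hypothesis: it is taken both as `2^{ek}
b_k` with the regular envelope and as `2^{ek} θ` with a mere upper bound. -/
theorem pd_lpLe (ha : StrichartzBound χ T φ a) (hn : 0 < n) (hχ : IsLPBump χ) (hφ : Tame T φ)
    {q r : ℝ≥0∞} (hqr : Admissible n q r) {ρ : ℝ} {y : ℤ → ℝ} (hρ : 1 < ρ)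
    (hay : ∀ j : ℤ, (2 : ℝ) ^ ((1 - scaling n q r) * j) * a j ≤ y j)
    (hy : ∀ j, ρ * y j ≤ y (j + 1)) (α : Fin (n + 1)) (k : ℤ) :
    NormBound T q r (pd α (lpLe χ k φ)) (bernsteinConst χ * (ρ / (ρ - 1)) * y k) := by
  obtain ⟨R, hR⟩ := hφ.exists_pd_eq_zero α
  have hC : 0 ≤ bernsteinConst χ := zero_le_one.trans (one_le_bernsteinConst χ)
  refine (NormBound.lpLe_of_lp (hφ.pd α) hR hn hχ (one_le_two.trans hqr.1)
    (one_le_two.trans hqr.2.1) hC hρ (fun j => ?_) hy (fun j => ?_) k).congr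
    fun p hp => hφ.pd_lpLe hχ k α hp
  · exact (mul_nonneg (by positivity) (ha.nonneg j)).trans (hay j)
  · exact ((ha.pd_lp hχ hφ hqr α j).mono (mul_le_mul_of_nonneg_left (hay j) hC)).congr
      fun p hp => (hφ.pd_lp hχ j α hp).symm

theorem pd_sub_lpLe (ha : StrichartzBound χ T φ a) (hχ : IsLPBump χ) (hφ : Tame T φ)
    {q r : ℝ≥0∞} (hqr : Admissible n q r) {ρ : ℝ} {y : ℤ → ℝ} (hρ : 1 < ρ)
    (hay : ∀ j : ℤ, (2 : ℝ) ^ ((1 - scaling n q r) * j) * a j ≤ y j)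
    (hy : ∀ j, ρ * y (j + 1) ≤ y j) (α : Fin (n + 1)) (k : ℤ) :
    NormBound T q r (fun p => pd α φ p - pd α (lpLe χ k φ) p)
      (bernsteinConst χ * (1 / (ρ - 1)) * y k) := by
  have hC : 0 ≤ bernsteinConst χ := zero_le_one.trans (one_le_bernsteinConst χ)
  refine (NormBound.sub_lpLe_of_lp (hφ.pd α) hχ (one_le_two.trans hqr.1)
    (one_le_two.trans hqr.2.1) hC hρ (fun j => ?_) hy (fun j => ?_) k).congr
    fun p hp => by rw [hφ.pd_lpLe hχ k α hp]
  · exact (mul_nonneg (by positivity) (ha.nonneg j)).trans (hay j)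
  · exact ((ha.pd_lp hχ hφ hqr α j).mono (mul_le_mul_of_nonneg_left (hay j) hC)).congr
      fun p hp => (hφ.pd_lp hχ j α hp).symm

end StrichartzBound

/-- The factor 2 is the one from `(x + y)² ≤ 2x² + 2y²`, used when `∂φ` is split into low and high
frequencies. -/
theorem NormBound.sum_sq {V : Type*} [NormedAddCommGroup V] {q r : ℝ≥0∞}
    (h1 : 1 ≤ q) (htop : q ≠ ⊤) (hr : 1 ≤ r) {g : Fin (n + 1) → Spacetime n → V} {B : ℝ}
    (h : ∀ α, NormBound T (2 * q) (2 * r) (g α) B) :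
    NormBound T q r (fun p => 2 * ∑ α, ‖g α p‖ ^ 2) (2 * (n + 1) * B ^ 2) := by
  have hH := holderTriple_two_mul r
  have h2 := NormBound.sum h1 hr Finset.univ (F := fun α p => ‖g α p‖ ^ 2) (A := fun _ => B ^ 2)
    fun α _ => by
      have := NormBound.mul (r := r) (zero_lt_one.trans_le h1).ne' htop (h α) (h α)
        (F := fun p => ‖g α p‖ ^ 2) ((h α).cont.norm.pow 2) zero_le_one
        (fun p _ => by simp [sq])
      simpa [sq] using this
  refine (h2.dominated (K := 2) (F := fun p => 2 * ∑ α, ‖g α p‖ ^ 2) (continuousOn_const.mul h2.cont) zero_le_two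
    fun p _ => by rw [norm_mul, Real.norm_two]).mono (le_of_eq ?_)
  simp
  ring

theorem rpow_growth {s : ℝ} (θ : ℝ) (j : ℤ) :
    (2 : ℝ) ^ s * ((2 : ℝ) ^ (s * j) * θ) = (2 : ℝ) ^ (s * ((j + 1 : ℤ) : ℝ)) * θ := by
  rw [← mul_assoc, ← Real.rpow_add two_pos]
  congr 2
  push_cast
  ring

theorem one_lt_two_rpow {s : ℝ} (hs : 0 < s) : 1 < (2 : ℝ) ^ s :=
  Real.one_lt_rpow one_lt_two hs

/-- The constant in the `L^4_t L^{2(n-1)}_x` bound on `∂P_{≤ k}φ`. -/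
def lowConst (χ : E n → ℝ) : ℝ :=
  bernsteinConst χ * ((2 : ℝ) ^ lowExp n / ((2 : ℝ) ^ lowExp n - 1))

/-- The constant in the `L^4_t L^4_x` bound on `∂(φ - P_{≤ k}φ)`. -/
def highConst (χ : E n → ℝ) : ℝ :=
  bernsteinConst χ * (1 / ((2 : ℝ) ^ highExp n - 1))

/-- The constant in the bound on `□P_{≤ k}φ`. -/
def boxConst (χ : E n → ℝ) : ℝ :=
  (∫ y, |lpKernel χ 0 y|) * (2 * (n + 1) * lowConst χ ^ 2) +
    bernsteinTwoConst χ ((n : ℝ) - 1) * (2 * (n + 1) * highConst χ ^ 2)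

theorem boxConst_nonneg (χ : E n → ℝ) : 0 ≤ boxConst χ := by
  have h1 := bernsteinTwoConst_nonneg χ ((n : ℝ) - 1)
  have h2 : 0 ≤ ∫ y, |lpKernel χ 0 y| := integral_nonneg fun y => abs_nonneg _
  unfold boxConst
  positivity

theorem StrichartzBound.pd_lpLe_low {a : ℤ → ℝ} (ha : StrichartzBound χ T φ a) (hn : 5 ≤ n)
    (hχ : IsLPBump χ) (hφ : Tame T φ) {θ : ℝ} (hθ : ∀ k, a k ≤ θ) (α : Fin (n + 1)) (k : ℤ) :
    NormBound T (2 * 2) (2 * ((n - 1 : ℕ) : ℝ≥0∞)) (pd α (lpLe χ k φ))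
      (lowConst χ * ((2 : ℝ) ^ (lowExp n * k) * θ)) := by
  refine ha.pd_lpLe (by lia) hχ hφ (admissible_low hn) (one_lt_two_rpow (lowExp_pos hn))
    (y := fun j : ℤ => (2 : ℝ) ^ (lowExp n * j) * θ) (fun j => ?_) (fun j => ?_) α k
  · rw [scaling_low hn]
    exact mul_le_mul_of_nonneg_left (hθ j) (by positivity)
  · exact (rpow_growth θ j).le

/-- `P_{≤ k}` commutes with `□`, and `|□φ|` is quadratic in `∂φ`. For low frequencies the
`L⁴L^{2(n-1)}` pieces have the positive exponent `lowExp`, so they sum up to `k`. For high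
frequencies the `L⁴L⁴` pieces have the negative exponent `-highExp`, so they sum from `k` upwards,
and Bernstein brings their square from `L²_x` to `L^{n-1}_x`. -/
theorem StrichartzBound.box_lpLe {a : ℤ → ℝ} (ha : StrichartzBound χ T φ a) (hn : 5 ≤ n)
    (hχ : IsLPBump χ) (hφ : IsClassicalWaveMap T φ) {θ : ℝ} (hθ : ∀ k, a k ≤ θ) (k : ℤ) :
    NormBound T 2 ((n - 1 : ℕ) : ℝ≥0∞) (box (lpLe χ k φ))
      (boxConst χ * ((2 : ℝ) ^ (2 * lowExp n * k) * θ ^ 2)) := by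
  have h5 : (5 : ℝ) ≤ n := by exact_mod_cast hn
  have ht := hφ.tame
  have hlow := fun α => ha.pd_lpLe_low hn hχ ht hθ α k
  have hhigh := fun α => ha.pd_sub_lpLe hχ ht (admissible_high hn)
    (one_lt_two_rpow (highExp_pos hn)) (y := fun j : ℤ => (2 : ℝ) ^ (-highExp n * j) * θ)
    (fun j => by
      rw [scaling_high n]
      exact mul_le_mul_of_nonneg_left (hθ j) (by positivity))
    (fun j => by
      rw [← mul_assoc, ← Real.rpow_add two_pos]
      push_cast
      ring_nf
      exact le_rfl) α k
  have hN1 : (1 : ℝ≥0∞) ≤ ((n - 1 : ℕ) : ℝ≥0∞) := by exact_mod_cast (by lia : 1 ≤ n - 1)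
  have gl := NormBound.sum_sq (q := 2) one_le_two (by simp) hN1 hlow
  have gh := NormBound.sum_sq (q := 2) one_le_two (by simp) one_le_two hhigh
  have hNs : ((n - 1 : ℕ) : ℝ≥0∞) = ENNReal.ofReal ((n : ℝ) - 1) := by
    rw [← cast_sub_one hn, ENNReal.ofReal_natCast]
  set g₁ : Spacetime n → ℝ := fun p => 2 * ∑ α, ‖pd α (lpLe χ k φ) p‖ ^ 2 with hg₁
  set g₂ : Spacetime n → ℝ := fun p => 2 * ∑ α, ‖pd α φ p - pd α (lpLe χ k φ) p‖ ^ 2 with hg₂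
  set L := ∫ y, |lpKernel χ 0 y| with hL
  have hL0 : 0 ≤ L := integral_nonneg fun y => abs_nonneg _
  set b := bernsteinTwoConst χ ((n : ℝ) - 1) *
    (2 : ℝ) ^ (n * ((1 - 2 / ((n : ℝ) - 1)) / 2) * k) with hb
  have hb0 : 0 ≤ b := mul_nonneg (bernsteinTwoConst_nonneg _ _) (by positivity)
  have hbox : ∀ p ∈ openSlab n T, ‖box φ p‖ ≤ g₁ p + g₂ p := by
    intro p hp
    refine (hφ.norm_box_le hp).trans ?_
    rw [hg₁, hg₂, ← mul_add, ← Finset.sum_add_distrib, Finset.mul_sum]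
    refine Finset.sum_le_sum fun α _ => ?_
    have h1 : ‖pd α φ p‖ ≤ ‖pd α (lpLe χ k φ) p‖ + ‖pd α φ p - pd α (lpLe χ k φ) p‖ := by
      simpa using norm_add_le (pd α (lpLe χ k φ) p) (pd α φ p - pd α (lpLe χ k φ) p)
    nlinarith [norm_nonneg (pd α φ p), sq_nonneg (‖pd α (lpLe χ k φ) p‖ -
      ‖pd α φ p - pd α (lpLe χ k φ) p‖)]
  have hslice : ∀ᵐ t ∂(volume.restrict (Icc 0 T) : Measure ℝ),
      eLpNorm (fun x : E n => box (lpLe χ k φ) (t, x)) ((n - 1 : ℕ) : ℝ≥0∞) volume ≤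
        ENNReal.ofReal L * eLpNorm (fun x : E n => g₁ (t, x)) ((n - 1 : ℕ) : ℝ≥0∞) volume +
        ENNReal.ofReal b * eLpNorm (fun x : E n => g₂ (t, x)) 2 volume := by
    filter_upwards [ae_mem_Ioo T] with t htt
    rw [hNs]
    refine eLpNorm_le_low_add_high hχ k (continuous_slice gl.cont htt)
      (continuous_slice gh.cont htt) (fun x => ?_) (by linarith)
    rw [ht.box_lpLe hχ k (p := (t, x)) ⟨htt, mem_univ x⟩]
    refine (lpLe_enorm_le χ k _ t x).trans (lintegral_mono fun y => ?_)
    gcongr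
    have h1 := hbox (t, x - y) ⟨htt, mem_univ _⟩
    have h2 : ‖box φ (t, x - y)‖ₑ ≤ ‖g₁ (t, x - y) + g₂ (t, x - y)‖ₑ := by
      rw [enorm_le_iff_norm_le]
      exact h1.trans (le_abs_self _)
    exact h2.trans (enorm_add_le _ _)
  have hm : mixedNorm T 2 ((n - 1 : ℕ) : ℝ≥0∞) (box (lpLe χ k φ)) ≤
      ENNReal.ofReal L * mixedNorm T 2 ((n - 1 : ℕ) : ℝ≥0∞) g₁ +
        ENNReal.ofReal b * mixedNorm T 2 2 g₂ := by
    have h1 := eLpNorm_mono_enorm_ae (p := 2) (f := fun t : ℝ => eLpNorm (fun x : E n =>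
      box (lpLe χ k φ) (t, x)) ((n - 1 : ℕ) : ℝ≥0∞) volume) (g := (fun t : ℝ => ENNReal.ofReal L *
        eLpNorm (fun x : E n => g₁ (t, x)) ((n - 1 : ℕ) : ℝ≥0∞) volume) + fun t : ℝ =>
        ENNReal.ofReal b * eLpNorm (fun x : E n => g₂ (t, x)) 2 volume) hslice
    refine h1.trans ((eLpNorm_add_le ((aemeasurable_slice gl.cont _).const_mul
      _).aestronglyMeasurable ((aemeasurable_slice gh.cont _).const_mul
      _).aestronglyMeasurable one_le_two).trans (add_le_add ?_ ?_))
    · exact eLpNorm_le_nnreal_smul_eLpNorm_of_ae_le_mul' (c := L.toNNReal)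
        (Eventually.of_forall fun t => le_rfl) 2
    · exact eLpNorm_le_nnreal_smul_eLpNorm_of_ae_le_mul' (c := b.toNNReal)
        (Eventually.of_forall fun t => le_rfl) 2
  have hfin : NormBound T 2 ((n - 1 : ℕ) : ℝ≥0∞) (box (lpLe χ k φ)) (L *
      (2 * (n + 1) * (lowConst χ * ((2 : ℝ) ^ (lowExp n * k) * θ)) ^ 2) + b *
      (2 * (n + 1) * (highConst χ * ((2 : ℝ) ^ (-highExp n * k) * θ)) ^ 2)) := by
    refine ⟨(contDiffOn_box (ht.contDiffOn_lpLe hχ k)).continuousOn, by positivity, hm.trans ?_⟩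
    rw [ENNReal.ofReal_add (by positivity) (by positivity), ENNReal.ofReal_mul hL0,
      ENNReal.ofReal_mul hb0]
    gcongr
    · exact gl.le
    · exact gh.le
  refine hfin.mono (le_of_eq ?_)
  have e1 : ((2 : ℝ) ^ (lowExp n * k)) ^ 2 = (2 : ℝ) ^ (2 * lowExp n * k) := by
    rw [← Real.rpow_natCast, ← Real.rpow_mul two_pos.le]
    congr 1
    push_cast
    ring
  -- Both contributions scale alike: `n(n-3)/(2(n-1)) - (n-3)/2 = (n-3)/(2(n-1))`, which is `2 *
  -- lowExp n`.
  have e2 : (2 : ℝ) ^ (n * ((1 - 2 / ((n : ℝ) - 1)) / 2) * k) * ((2 : ℝ) ^ (-highExp n * k)) ^ 2 =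
      (2 : ℝ) ^ (2 * lowExp n * k) := by
    rw [← Real.rpow_natCast, ← Real.rpow_mul two_pos.le, ← Real.rpow_add two_pos]
    congr 1
    unfold highExp lowExp
    have : (n : ℝ) - 1 ≠ 0 := by linarith
    push_cast
    field_simp
    ring
  simp only [mul_pow, hb, boxConst]
  rw [e1, add_mul, ← e2]
  ring

end Box

/-! ### Almost orthogonal matrices -/

section Algebra

variable {m : ℕ}

theorem norm_transpose (A : Mat m) : ‖Aᵀ‖ = ‖A‖ := by
  rw [← Matrix.conjTranspose_eq_transpose_of_trivial, Matrix.l2_opNorm_conjTranspose]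

theorem norm_transpose_mul_self (A : Mat m) : ‖Aᵀ * A‖ = ‖A‖ ^ 2 := by
  rw [← Matrix.conjTranspose_eq_transpose_of_trivial, Matrix.l2_opNorm_conjTranspose_mul_self, sq]

/-- An inequality, since for `m = 0` the identity matrix is zero. -/
theorem norm_one_mat_le (m : ℕ) : ‖(1 : Mat m)‖ ≤ 1 := by
  rcases Nat.eq_zero_or_pos m with rfl | h
  · rw [Subsingleton.elim (1 : Mat 0) 0, norm_zero]
    exact zero_le_one
  · have : Nonempty (Fin m) := ⟨⟨0, h⟩⟩
    exact (CStarRing.norm_one (E := Mat m)).le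

/-- Antisymmetry cancels the two linear terms `uᵀ w u` and `uᵀ wᵀ u`, so the orthogonality defect
grows only quadratically in `w`. -/
theorem transpose_mul_step {w u : Mat m} (hw : wᵀ = -w) :
    (u + w * u)ᵀ * (u + w * u) - 1 = (uᵀ * u - 1) + uᵀ * (wᵀ * w) * u := by
  rw [Matrix.transpose_add, Matrix.transpose_mul, hw]
  noncomm_ring

theorem isUnit_of_norm_transpose_mul_sub_one {U : Mat m} (h : ‖Uᵀ * U - 1‖ ≤ 1 / 2) : IsUnit U := by
  have h1 : IsUnit (Uᵀ * U) := by
    have h2 : ‖1 - Uᵀ * U‖ < 1 := by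
      rw [norm_sub_rev]; linarith
    simpa using isUnit_one_sub_of_norm_lt_one h2
  rw [Matrix.isUnit_iff_isUnit_det] at h1 ⊢
  rw [Matrix.det_mul] at h1
  exact isUnit_of_mul_isUnit_right h1

/-- `U⁻¹` differs from `Uᵀ` by `(Uᵀ U - 1) U⁻¹`, which is absorbed into the left-hand side. -/
theorem norm_inv_le {U : Mat m} (h : ‖Uᵀ * U - 1‖ ≤ 1 / 2) : ‖U⁻¹‖ ≤ 2 * ‖U‖ := by
  have hU := (Matrix.isUnit_iff_isUnit_det U).1 (isUnit_of_norm_transpose_mul_sub_one h)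
  have h1 : U⁻¹ = Uᵀ - (Uᵀ * U - 1) * U⁻¹ := by
    rw [sub_mul, mul_assoc, Matrix.mul_nonsing_inv _ hU]
    simp
  have h2 : ‖U⁻¹‖ ≤ ‖U‖ + 1 / 2 * ‖U⁻¹‖ := by
    calc ‖U⁻¹‖ = ‖Uᵀ - (Uᵀ * U - 1) * U⁻¹‖ := by rw [← h1]
      _ ≤ ‖Uᵀ‖ + ‖(Uᵀ * U - 1) * U⁻¹‖ := norm_sub_le _ _
      _ ≤ ‖U‖ + 1 / 2 * ‖U⁻¹‖ := by
        rw [norm_transpose]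
        gcongr
        exact (norm_mul_le _ _).trans (by gcongr)
  linarith

end Algebra

/-! ### Estimates for the recursion `u_{k+1} = (1 + w_k) u_k` -/

section Recursion

variable {n m : ℕ} {T : ℝ}

/-- The multiplication of matrices. -/
abbrev mulL (m : ℕ) : Mat m →L[ℝ] Mat m →L[ℝ] Mat m := ContinuousLinearMap.mul ℝ (Mat m)

/-- A sequence of matrix fields obeying the recursion `u_{k+1} = u_k + w_k u_k`, with `u_{k₀} = 1`
and antisymmetric `w_k`. -/
structure IsFrameSeq (T : ℝ) (k₀ : ℤ) (w u : ℤ → Spacetime n → Mat m) : Prop where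
  smooth : ∀ k, ContDiffOn ℝ ∞ (w k) (openSlab n T)
  antisymm : ∀ k p, (w k p)ᵀ = -w k p
  init : u k₀ = fun _ => 1
  step : ∀ k, k₀ ≤ k → u (k + 1) = fun p => u k p + w k p * u k p

namespace IsFrameSeq

variable {k₀ : ℤ} {w u : ℤ → Spacetime n → Mat m}

theorem contDiffOn (h : IsFrameSeq T k₀ w u) {k : ℤ} (hk : k₀ ≤ k) :
    ContDiffOn ℝ ∞ (u k) (openSlab n T) := by
  induction k, hk using Int.leInduction with
  | base => rw [h.init]; exact contDiffOn_const
  | succ k hk ih =>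
    rw [h.step k hk]
    exact ih.add (contDiffOn_bilin (mulL m) (h.smooth k) ih)

theorem norm_transpose_mul_sub_one_le (h : IsFrameSeq T k₀ w u) {p : Spacetime n} {β : ℤ → ℝ}
    (hβ : ∀ k, ‖w k p‖ ≤ β k) (hs : ∀ k, ∑ j ∈ Finset.Ico k₀ k, β j ^ 2 ≤ 1 / 2) {k : ℤ}
    (hk : k₀ ≤ k) : ‖(u k p)ᵀ * u k p - 1‖ ≤ 2 * ∑ j ∈ Finset.Ico k₀ k, β j ^ 2 := by
  induction k, hk using Int.leInduction with
  | base => simp [h.init]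
  | succ k hk ih =>
    -- Bootstrap: the defect bound at stage `k` is at most 1, hence `‖u k‖² = ‖uᵀ u‖ ≤ 2`, which is
    -- what the next increment needs.
    have hu : ‖u k p‖ ^ 2 ≤ 2 := by
      rw [← norm_transpose_mul_self]
      have h1 : ‖(u k p)ᵀ * u k p‖ ≤ ‖(u k p)ᵀ * u k p - 1‖ + ‖(1 : Mat m)‖ := by
        simpa using norm_add_le ((u k p)ᵀ * u k p - 1) 1
      linarith [hs k, norm_one_mat_le m]
    rw [h.step k hk, ← Finset.insert_Ico_right_eq_Ico_add_one (by lia),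
      Finset.sum_insert (by simp)]
    simp only
    rw [transpose_mul_step (h.antisymm k p)]
    have h2 : ‖(u k p)ᵀ * ((w k p)ᵀ * w k p) * u k p‖ ≤ 2 * β k ^ 2 := by
      have h3 : ‖(u k p)ᵀ * ((w k p)ᵀ * w k p) * u k p‖ ≤ ‖u k p‖ * ‖w k p‖ ^ 2 * ‖u k p‖ := by
        refine (norm_mul_le _ _).trans ?_
        gcongr
        refine (norm_mul_le _ _).trans ?_
        rw [norm_transpose, norm_transpose_mul_self]
      have h4 : ‖w k p‖ ^ 2 ≤ β k ^ 2 := by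
        have := hβ k
        gcongr
      calc _ ≤ _ := h3
        _ = ‖u k p‖ ^ 2 * ‖w k p‖ ^ 2 := by ring
        _ ≤ _ := by gcongr
    refine (norm_add_le _ _).trans ?_
    linarith

theorem norm_le_two (h : IsFrameSeq T k₀ w u) {p : Spacetime n} {β : ℤ → ℝ}
    (hβ : ∀ k, ‖w k p‖ ≤ β k) (hs : ∀ k, ∑ j ∈ Finset.Ico k₀ k, β j ^ 2 ≤ 1 / 2) {k : ℤ}
    (hk : k₀ ≤ k) : ‖u k p‖ ≤ 2 := by
  have h0 := h.norm_transpose_mul_sub_one_le hβ hs hk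
  have h1 : ‖(u k p)ᵀ * u k p‖ ≤ ‖(u k p)ᵀ * u k p - 1‖ + ‖(1 : Mat m)‖ := by
    simpa using norm_add_le ((u k p)ᵀ * u k p - 1) 1
  rw [norm_transpose_mul_self] at h1
  nlinarith [hs k, norm_one_mat_le m, norm_nonneg (u k p)]

variable {τ ρ : ℝ} {q r : ℝ≥0∞}

theorem pd_step (h : IsFrameSeq T k₀ w u) {k : ℤ} (hk : k₀ ≤ k) {p : Spacetime n}
    (hp : p ∈ openSlab n T) (α : Fin (n + 1)) :
    pd α (u (k + 1)) p = pd α (u k) p + (pd α (w k) p * u k p + w k p * pd α (u k) p) := by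
  have hu := h.contDiffOn hk
  rw [h.step k hk]
  refine (pd_add hu (contDiffOn_bilin (mulL m) (h.smooth k) hu) hp α).trans ?_
  congr 1
  exact pd_bilin (mulL m) (h.smooth k) hu hp α

theorem box_step (h : IsFrameSeq T k₀ w u) {k : ℤ} (hk : k₀ ≤ k) {p : Spacetime n}
    (hp : p ∈ openSlab n T) :
    box (u (k + 1)) p = box (u k) p + (box (w k) p * u k p +
      ∑ α, (2 * eta α) • (pd α (w k) p * pd α (u k) p) + w k p * box (u k) p) := by
  have hu := h.contDiffOn hk
  rw [h.step k hk]
  refine (box_add hu (contDiffOn_bilin (mulL m) (h.smooth k) hu) hp).trans ?_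
  congr 1
  exact box_bilin (mulL m) (h.smooth k) hu hp

/-- The growth of a quantity which at each step grows by a factor at most `1 + τ`, up to a source
bounded by a geometrically growing sequence `G y_k`. -/
theorem recursion_le {G : ℝ} {y : ℤ → ℝ} (hρ : 1 < ρ) (hτ : τ ≤ (ρ - 1) / 2) (hG : 0 ≤ G)
    (hy0 : ∀ k, 0 ≤ y k) (hy : ∀ k, ρ * y k ≤ y (k + 1)) (k : ℤ) :
    2 * G / (ρ - 1) * y k + (G * y k + τ * (2 * G / (ρ - 1) * y k)) ≤
      2 * G / (ρ - 1) * y (k + 1) := by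
  have hρ' : 0 < ρ - 1 := by linarith
  have hD : 0 ≤ 2 * G / (ρ - 1) := by positivity
  have h1 : 2 * G / (ρ - 1) * (ρ * y k) ≤ 2 * G / (ρ - 1) * y (k + 1) := by gcongr; exact hy k
  have h2 : τ * (2 * G / (ρ - 1) * y k) ≤ (ρ - 1) / 2 * (2 * G / (ρ - 1) * y k) :=
    mul_le_mul_of_nonneg_right hτ (mul_nonneg hD (hy0 k))
  have h3 : (ρ - 1) / 2 * (2 * G / (ρ - 1) * y k) = G * y k := by field_simp
  have h4 : 2 * G / (ρ - 1) * (ρ * y k) = 2 * G / (ρ - 1) * y k + 2 * (G * y k) := by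
    field_simp
    ring
  linarith

/-- By the Leibniz rule the increment of `∂u_k` is the source `(∂w_k) u_k`, of size `2 G y_k`, plus
a term of relative size `τ`. Geometric growth of `y` leaves room for both, by `recursion_le` with `2
* G` as the source constant. -/
theorem normBound_pd (h : IsFrameSeq T k₀ w u)
    (hu2 : ∀ k, k₀ ≤ k → ∀ p ∈ openSlab n T, ‖u k p‖ ≤ 2)
    (hwτ : ∀ k, ∀ p ∈ openSlab n T, ‖w k p‖ ≤ τ) (hq : 1 ≤ q) (hr : 1 ≤ r) (hρ : 1 < ρ)
    (hτ0 : 0 ≤ τ) (hτ : τ ≤ (ρ - 1) / 2) {G : ℝ} (hG : 0 ≤ G) {y : ℤ → ℝ} (hy0 : ∀ k, 0 ≤ y k)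
    (hy : ∀ k, ρ * y k ≤ y (k + 1)) (α : Fin (n + 1))
    (hw : ∀ k, NormBound T q r (pd α (w k)) (G * y k)) {k : ℤ} (hk : k₀ ≤ k) :
    NormBound T q r (pd α (u k)) (2 * (2 * G) / (ρ - 1) * y k) := by
  have hρ' : 0 < ρ - 1 := by linarith
  induction k, hk using Int.leInduction with
  | base =>
    refine ((NormBound.zero T q r).congr (F := pd α (u k₀)) fun p _ => ?_).mono
      (mul_nonneg (by positivity) (hy0 _))
    rw [h.init, pd_const]
  | succ k hk ih =>
    have hu := h.contDiffOn hk
    have h1 : NormBound T q r (fun p => pd α (w k) p * u k p) (2 * (G * y k)) :=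
      (hw k).dominated ((hw k).cont.mul hu.continuousOn) zero_le_two fun p hp => by
        refine (norm_mul_le _ _).trans ?_
        rw [mul_comm]
        gcongr
        exact hu2 k hk p hp
    have h2 : NormBound T q r (fun p => w k p * pd α (u k) p)
        (τ * (2 * (2 * G) / (ρ - 1) * y k)) :=
      ih.dominated ((h.smooth k).continuousOn.mul ih.cont) hτ0 fun p hp => by
        refine (norm_mul_le _ _).trans ?_
        gcongr
        exact hwτ k p hp
    refine ((ih.add hq hr (h1.add hq hr h2)).congr fun p hp => h.pd_step hk hp α).mono ?_
    have := recursion_le (G := 2 * G) hρ hτ (by positivity) hy0 hy k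
    linarith

/-- As for first derivatives, with the extra cross terms `∂w_k ∂u_k` counted as source: Hölder puts
each factor in `L^{2q}L^{2r}` with size a multiple of `z_k`, and `z_k² = y_k`. -/
theorem normBound_box (h : IsFrameSeq T k₀ w u)
    (hu2 : ∀ k, k₀ ≤ k → ∀ p ∈ openSlab n T, ‖u k p‖ ≤ 2)
    (hwτ : ∀ k, ∀ p ∈ openSlab n T, ‖w k p‖ ≤ τ) (hq : 1 ≤ q) (hqt : q ≠ ⊤) (hr : 1 ≤ r)
    (hρ : 1 < ρ) (hτ0 : 0 ≤ τ) (hτ : τ ≤ (ρ - 1) / 2) {G G₁ G₂ : ℝ} (hG : 0 ≤ G) (hG₁ : 0 ≤ G₁)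
    (hG₂ : 0 ≤ G₂) {y z : ℤ → ℝ} (hy0 : ∀ k, 0 ≤ y k)
    (hy : ∀ k, ρ * y k ≤ y (k + 1)) (hz : ∀ k, z k * z k = y k)
    (hw : ∀ k, NormBound T q r (box (w k)) (G * y k))
    (hpw : ∀ α k, NormBound T (2 * q) (2 * r) (pd α (w k)) (G₁ * z k))
    (hpu : ∀ α k, k₀ ≤ k → NormBound T (2 * q) (2 * r) (pd α (u k)) (G₂ * z k))
    {k : ℤ} (hk : k₀ ≤ k) :
    NormBound T q r (box (u k))
      (2 * (2 * G + 2 * (n + 1) * (G₁ * G₂)) / (ρ - 1) * y k) := by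
  have hρ' : 0 < ρ - 1 := by linarith
  have hH := holderTriple_two_mul r
  set H := 2 * G + 2 * (n + 1) * (G₁ * G₂) with hHdef
  have hH0 : 0 ≤ H := by positivity
  induction k, hk using Int.leInduction with
  | base =>
    refine ((NormBound.zero T q r).congr (F := box (u k₀)) fun p _ => ?_).mono
      (mul_nonneg (by positivity) (hy0 _))
    rw [h.init]
    have : ∀ α : Fin (n + 1), pd α (fun _ : Spacetime n => (1 : Mat m)) = fun _ => 0 := by
      intro α; funext p; exact pd_const _ _ _
    simp [box, this, pd_const]
  | succ k hk ih =>
    have hu := h.contDiffOn hk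
    have h1 : NormBound T q r (fun p => box (w k) p * u k p) (2 * (G * y k)) :=
      (hw k).dominated ((hw k).cont.mul hu.continuousOn) zero_le_two fun p hp => by
        refine (norm_mul_le _ _).trans ?_
        rw [mul_comm]
        gcongr
        exact hu2 k hk p hp
    have h2 : NormBound T q r (fun p => w k p * box (u k) p)
        (τ * (2 * H / (ρ - 1) * y k)) :=
      ih.dominated ((h.smooth k).continuousOn.mul ih.cont) hτ0 fun p hp => by
        refine (norm_mul_le _ _).trans ?_
        gcongr
        exact hwτ k p hp
    have h3 : NormBound T q r (fun p => ∑ α, (2 * eta α) • (pd α (w k) p * pd α (u k) p))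
        (2 * (n + 1) * (G₁ * G₂) * y k) := by
      refine (NormBound.sum hq hr Finset.univ (F := fun α p =>
        (2 * eta α) • (pd α (w k) p * pd α (u k) p)) fun α _ =>
        NormBound.mul (r := r) (zero_lt_one.trans_le hq).ne' hqt (hpw α k) (hpu α k hk)
        (K := 2) (((hpw α k).cont.mul (hpu α k hk).cont).const_smul (2 * eta α)) zero_le_two
        fun p _ => ?_).mono ?_
      · rw [norm_smul, norm_mul, Real.norm_two, Real.norm_eq_abs, abs_eta, mul_one]
        gcongr
        exact norm_mul_le _ _
      · rw [Finset.sum_const, Finset.card_univ, Fintype.card_fin, nsmul_eq_mul, ← hz k]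
        push_cast
        exact le_of_eq (by ring)
    refine ((ih.add hq hr ((h1.add hq hr h3).add hq hr h2)).congr
      fun p hp => h.box_step hk hp).mono ?_
    have := recursion_le (G := H) hρ hτ hH0 hy0 hy k
    have e : H * y k = 2 * (G * y k) + 2 * (n + 1) * (G₁ * G₂) * y k := by rw [hHdef]; ring
    linarith

/-- For `D_k = ∂u_k - A_k u_k` the recursion reads `D_{k+1} = D_k + (∂w_k - (A_{k+1} - A_k)) u_k +
w_k ∂u_k - A_{k+1} w_k u_k`. Each increment is of size `b_k²` in `L¹L^∞`, so the errors simply add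
up, and no geometric growth is needed in this sum. -/
theorem normBound_pd_sub_mul (h : IsFrameSeq T k₀ w u)
    (hu2 : ∀ k, k₀ ≤ k → ∀ p ∈ openSlab n T, ‖u k p‖ ≤ 2) (α : Fin (n + 1))
    {A : ℤ → Spacetime n → Mat m} {G₁ G₂ G₃ G₄ B₀ : ℝ} {b y z : ℤ → ℝ} (hyz : ∀ k, z k * y k = b k ^ 2)
    (hdiff : ∀ k, NormBound T 1 ∞ (fun p => pd α (w k) p - (A (k + 1) p - A k p)) (G₁ * b k ^ 2))
    (hw : ∀ k, NormBound T 2 ∞ (w k) (G₂ * z k))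
    (hu : ∀ k, k₀ ≤ k → NormBound T 2 ∞ (pd α (u k)) (G₃ * y k))
    (hA : ∀ k, NormBound T 2 ∞ (A (k + 1)) (G₄ * y k))
    (hinit : NormBound T 1 ∞ (A k₀) B₀) {k : ℤ} (hk : k₀ ≤ k) :
    NormBound T 1 ∞ (fun p => pd α (u k) p - A k p * u k p)
      (B₀ + (2 * G₁ + G₂ * G₃ + 2 * (G₄ * G₂)) * ∑ j ∈ Finset.Ico k₀ k, b j ^ 2) := by
  have hH : ENNReal.HolderTriple ∞ ∞ ∞ := ⟨by simp⟩
  induction k, hk using Int.leInduction with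
  | base =>
    refine (hinit.neg.congr (F := fun p => pd α (u k₀) p - A k₀ p * u k₀ p) fun p _ => ?_).mono
      (by simp)
    rw [h.init, pd_const]
    simp
  | succ k hk ih =>
    have hus := h.contDiffOn hk
    have t1 : NormBound T 1 ∞ (fun p => (pd α (w k) p - (A (k + 1) p - A k p)) * u k p)
        (2 * (G₁ * b k ^ 2)) :=
      (hdiff k).dominated ((hdiff k).cont.mul hus.continuousOn) zero_le_two fun p hp => by
        refine (norm_mul_le _ _).trans ?_
        rw [mul_comm]
        gcongr
        exact hu2 k hk p hp
    have t2 : NormBound T 1 ∞ (fun p => w k p * pd α (u k) p) (1 * (G₂ * z k * (G₃ * y k))) :=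
      NormBound.mul (r₁ := ∞) (r₂ := ∞) one_ne_zero ENNReal.one_ne_top
        (by simpa using hw k) (by simpa using hu k hk)
        ((hw k).cont.mul (hu k hk).cont) zero_le_one fun p _ => by
          rw [one_mul]; exact norm_mul_le _ _
    have t3 : NormBound T 1 ∞ (fun p => A (k + 1) p * (w k p * u k p))
        (2 * (G₄ * y k * (G₂ * z k))) :=
      NormBound.mul (r₁ := ∞) (r₂ := ∞) one_ne_zero ENNReal.one_ne_top
        (by simpa using hA k) (by simpa using hw k)
        ((hA k).cont.mul ((hw k).cont.mul hus.continuousOn)) zero_le_two fun p hp => by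
          calc ‖A (k + 1) p * (w k p * u k p)‖ ≤ ‖A (k + 1) p‖ * (‖w k p‖ * ‖u k p‖) :=
                (norm_mul_le _ _).trans (by gcongr; exact norm_mul_le _ _)
            _ ≤ ‖A (k + 1) p‖ * (‖w k p‖ * 2) := by gcongr; exact hu2 k hk p hp
            _ = _ := by ring
    refine ((ih.add le_rfl le_top ((t1.add le_rfl le_top t2).sub le_rfl le_top t3)).congr
      fun p hp => ?_).mono (le_of_eq ?_)
    · rw [h.pd_step hk hp α, h.step k hk]
      noncomm_ring
    · rw [← Finset.insert_Ico_right_eq_Ico_add_one (by lia), Finset.sum_insert (by simp)]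
      have e1 : G₂ * z k * (G₃ * y k) = G₂ * G₃ * b k ^ 2 := by rw [← hyz k]; ring
      have e2 : G₄ * y k * (G₂ * z k) = G₄ * G₂ * b k ^ 2 := by rw [← hyz k]; ring
      rw [e1, e2]
      ring

end IsFrameSeq

end Recursion

/-! ### The antisymmetric product of two vectors -/

section Wedge

variable {m : ℕ}

theorem norm_vecMulVec_le (a b : E m) : ‖(Matrix.vecMulVec a.ofLp b.ofLp : Mat m)‖ ≤ ‖a‖ * ‖b‖ := by
  rw [Matrix.l2_opNorm_def]
  refine ContinuousLinearMap.opNorm_le_bound _ (by positivity) fun x => ?_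
  have h : (Matrix.toEuclideanLin (𝕜 := ℝ) (Matrix.vecMulVec a.ofLp b.ofLp)) x =
      inner ℝ b x • a := by
    ext i
    simp [Matrix.toLpLin_apply, Matrix.vecMulVec_mulVec, PiLp.inner_apply, dotProduct, mul_comm]
  change ‖(Matrix.toEuclideanLin (𝕜 := ℝ) (Matrix.vecMulVec a.ofLp b.ofLp)) x‖ ≤ _
  rw [h, norm_smul, mul_comm ‖a‖, mul_right_comm]
  gcongr
  exact norm_inner_le_norm b x

theorem norm_wedge_le (a b : E m) : ‖wedge a b‖ ≤ 2 * (‖a‖ * ‖b‖) := by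
  refine (norm_sub_le _ _).trans ?_
  have h1 := norm_vecMulVec_le a b
  have h2 := norm_vecMulVec_le b a
  rw [mul_comm ‖b‖] at h2
  linarith

/-- `wedge` as a continuous bilinear map. -/
def wedgeL (m : ℕ) : E m →L[ℝ] E m →L[ℝ] Mat m :=
  LinearMap.mkContinuous₂ (LinearMap.mk₂ ℝ wedge
    (fun a b c => by
      ext i j; simp [wedge, Matrix.vecMulVec_apply]; ring)
    (fun r a b => by
      ext i j; simp [wedge, Matrix.vecMulVec_apply]; ring)
    (fun a b c => by
      ext i j; simp [wedge, Matrix.vecMulVec_apply]; ring)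
    (fun r a b => by
      ext i j; simp [wedge, Matrix.vecMulVec_apply]; ring)) 2
    fun a b => by rw [mul_assoc]; exact norm_wedge_le a b
theorem wedgeL_apply (a b : E m) : wedgeL m a b = wedge a b := rfl

theorem transpose_wedge (a b : E m) : (wedge a b)ᵀ = -wedge a b := by
  ext i j
  simp [wedge, Matrix.vecMulVec_apply]
  ring

end Wedge

/-! ### The coefficients `w_k` of the frame and the truncated connections -/

section Frame

variable {n m : ℕ} {T : ℝ} {χ : E n → ℝ} {φ : Spacetime n → E m}

/-- The matrix `P_kφ (P_{<k}φ)† - P_{<k}φ (P_kφ)†`. -/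
def frameCoeff (χ : E n → ℝ) (φ : Spacetime n → E m) (k : ℤ) (p : Spacetime n) : Mat m :=
  wedge (lp χ k φ p) (lpLt χ k φ p)

/-- The matrix `∂_α P_{<k}φ (P_{<k}φ)† - P_{<k}φ (∂_α P_{<k}φ)†`. -/
def connectionLt (χ : E n → ℝ) (φ : Spacetime n → E m) (α : Fin (n + 1)) (k : ℤ)
    (p : Spacetime n) : Mat m :=
  wedge (pd α (lpLt χ k φ) p) (lpLt χ k φ p)

theorem lpLt_add_one (χ : E n → ℝ) (φ : Spacetime n → E m) (k : ℤ) :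
    lpLt χ (k + 1) φ = lpLe χ k φ := by
  rw [lpLt, add_sub_cancel_right]

theorem lpLt_add_one_eq_add (χ : E n → ℝ) (φ : Spacetime n → E m) (k : ℤ) :
    lpLt χ (k + 1) φ = fun p => lpLt χ k φ p + lp χ k φ p := by
  rw [lpLt_add_one]
  funext p
  simp [lp]

theorem contDiffOn_frameCoeff (hχ : IsLPBump χ) (hφ : Tame T φ) (k : ℤ) :
    ContDiffOn ℝ ∞ (frameCoeff χ φ k) (openSlab n T) :=
  contDiffOn_bilin (wedgeL m) (hφ.contDiffOn_lp hχ k) (hφ.contDiffOn_lpLe hχ (k - 1))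

theorem isFrameSeq_frameLt (hχ : IsLPBump χ) (hφ : Tame T φ) (M : ℤ) :
    IsFrameSeq T (-M + 1) (frameCoeff χ φ) (frameLt χ φ M) where
  smooth := contDiffOn_frameCoeff hχ hφ
  antisymm k p := transpose_wedge _ _
  init := by
    funext p
    have h : Finset.Ioo (-M) (-M + 1) = ∅ := by ext; simp
    rw [frameLt_eq, h]
    simp
  step k hk := by
    funext p
    have h : Finset.Ioo (-M) (k + 1) = insert k (Finset.Ioo (-M) k) := by ext; simp; lia
    rw [frameLt_eq χ φ M (k + 1), h, Finset.sum_insert (by simp), add_left_comm, ← frameLt_eq,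
      add_comm]
    rfl

theorem frame_eq_frameLt (χ : E n → ℝ) (φ : Spacetime n → E m) (M : ℤ) :
    frame χ φ M = frameLt χ φ M (-9) := by
  funext p
  have h : Finset.Ioc (-M) (-10) = Finset.Ioo (-M) (-9) := by ext; simp; try lia
  rw [frameLt_eq, frame, h]

/-- The `L¹` norm of the kernel of `P_{≤ k}`. -/
def kernelConst (χ : E n → ℝ) : ℝ := ∫ y, |lpKernel χ 0 y|

theorem kernelConst_nonneg (χ : E n → ℝ) : 0 ≤ kernelConst χ :=
  integral_nonneg fun _ => abs_nonneg _

theorem admissible_top (hn : 5 ≤ n) : Admissible n ∞ ∞ := by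
  have h5 : (5 : ℝ) ≤ n := by exact_mod_cast hn
  refine ⟨le_top, le_top, ?_⟩
  simp
  linarith

theorem scaling_top (n : ℕ) : scaling n ∞ ∞ = 0 := by simp [scaling]

theorem admissible_two (hn : 5 ≤ n) : Admissible n 2 ∞ := by
  have h5 : (5 : ℝ) ≤ n := by exact_mod_cast hn
  refine ⟨le_rfl, le_top, ?_⟩
  simp
  linarith

theorem scaling_two (n : ℕ) : scaling n 2 ∞ = 1 / 2 := by simp [scaling]

theorem norm_lpLe_le (hχ : IsLPBump χ) (hφ : IsClassicalWaveMap T φ) (k : ℤ) {p : Spacetime n}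
    (hp : p ∈ slab n T) : ‖lpLe χ k φ p‖ ≤ kernelConst χ := by
  have := lpLe_norm_le hχ k (t := p.1) (f := φ) (B := 1)
    (fun x => (hφ.sphere (p.1, x) ⟨hp.1, mem_univ x⟩).le) p.2
  simpa [kernelConst] using this

/-- The constant in the bounds on `∂(P_kφ (P_{<k}φ)† - P_{<k}φ (P_kφ)†)`. -/
def coeffConst (χ : E n → ℝ) (ρ : ℝ) : ℝ :=
  2 * bernsteinConst χ * (kernelConst χ + ρ / (ρ - 1))

theorem coeffConst_nonneg (χ : E n → ℝ) {ρ : ℝ} (hρ : 1 < ρ) : 0 ≤ coeffConst χ ρ := by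
  have hρ' : 0 < ρ - 1 := by linarith
  have h1 := one_le_bernsteinConst χ
  have h2 := kernelConst_nonneg χ
  unfold coeffConst
  positivity

/-- The constant in the bound on `□(P_kφ (P_{<k}φ)† - P_{<k}φ (P_kφ)†)`. -/
def boxCoeffConst (χ : E n → ℝ) : ℝ :=
  2 * kernelConst χ * (boxConst χ + boxConst χ) +
    (n + 1) * (2 * 2 * (bernsteinConst χ * lowConst χ)) + 2 * boxConst χ

theorem lowConst_nonneg (hn : 5 ≤ n) (χ : E n → ℝ) : 0 ≤ lowConst χ := by
  have h1 := one_lt_two_rpow (lowExp_pos hn)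
  have h2 := one_le_bernsteinConst χ
  have h3 : 0 < (2 : ℝ) ^ lowExp n - 1 := by linarith
  unfold lowConst
  positivity

theorem boxCoeffConst_nonneg (hn : 5 ≤ n) (χ : E n → ℝ) : 0 ≤ boxCoeffConst χ := by
  have h1 := one_le_bernsteinConst χ
  have h2 := kernelConst_nonneg χ
  have h3 := boxConst_nonneg χ
  have h4 := lowConst_nonneg hn χ
  unfold boxCoeffConst
  positivity

theorem rpow_mono_int {s : ℝ} (hs : 0 ≤ s) {j k : ℤ} (h : j ≤ k) :
    (2 : ℝ) ^ (s * j) ≤ (2 : ℝ) ^ (s * k) := by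
  have : (j : ℝ) ≤ k := by exact_mod_cast h
  exact Real.rpow_le_rpow_of_exponent_le one_le_two (by gcongr)

theorem rpow_low_mul_self (θ : ℝ) (k : ℤ) :
    (2 : ℝ) ^ (lowExp n * k) * θ * ((2 : ℝ) ^ (lowExp n * k) * θ) =
      (2 : ℝ) ^ (2 * lowExp n * k) * θ ^ 2 := by
  have : (2 : ℝ) ^ (2 * lowExp n * k) = (2 : ℝ) ^ (lowExp n * k) * (2 : ℝ) ^ (lowExp n * k) := by
    rw [← Real.rpow_add two_pos]
    congr 1
    ring
  rw [this]
  ring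

theorem norm_connectionLt_le (hχ : IsLPBump χ)
    (hφ : IsClassicalWaveMap T φ) (α : Fin (n + 1)) (k : ℤ) {p : Spacetime n}
    (hp : p ∈ openSlab n T) :
    ‖connectionLt χ φ α k p‖ ≤ 2 * kernelConst χ * ‖pd α (lpLt χ k φ) p‖ := by
  refine (norm_wedge_le _ _).trans ?_
  rw [mul_assoc, mul_comm (kernelConst χ)]
  gcongr
  exact norm_lpLe_le hχ hφ (k - 1) (openSlab_subset_slab hp)

theorem continuousOn_connectionLt (hχ : IsLPBump χ) (hφ : Tame T φ) (α : Fin (n + 1)) (k : ℤ) :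
    ContinuousOn (connectionLt χ φ α k) (openSlab n T) :=
  (contDiffOn_bilin (wedgeL m) (contDiffOn_pd (hφ.contDiffOn_lpLe hχ (k - 1)) α)
    (hφ.contDiffOn_lpLe hχ (k - 1))).continuousOn

namespace StrichartzBound

variable {b : ℤ → ℝ} {θ : ℝ}

theorem normBound_lp (ha : StrichartzBound χ T φ b) (hχ : IsLPBump χ) (hφ : Tame T φ)
    {q r : ℝ≥0∞} (hqr : Admissible n q r) (k : ℤ) :
    NormBound T q r (lp χ k φ) ((2 : ℝ) ^ (-scaling n q r * k) * b k) :=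
  (NormBound.of_strichartzNorm (hφ.contDiffOn_lp hχ k) (ha.nonneg k) (ha.le k) hqr).1

/-- The `L^∞L^∞` part of the Strichartz norm, extended by continuity to the boundary times, since
invertibility of `U` is asserted on the closed slab. -/
theorem norm_lp_le (ha : StrichartzBound χ T φ b) (hn : 5 ≤ n) (hχ : IsLPBump χ)
    (hφ : IsClassicalWaveMap T φ) (hT : 0 < T) (k : ℤ) {p : Spacetime n} (hp : p ∈ slab n T) :
    ‖lp χ k φ p‖ ≤ b k := by
  have h1 : ∀ p ∈ openSlab n T, ‖lp χ k φ p‖ ≤ b k := by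
    intro p hp
    have h2 := ha.normBound_lp hχ hφ.tame (admissible_top hn) k
    rw [scaling_top] at h2
    simpa using h2.pointwise hp
  have hcl : closure (openSlab n T) = slab n T := by
    rw [openSlab, closure_prod_eq, closure_Ioo hT.ne, closure_univ]
    rfl
  obtain ⟨e, R, he⟩ := hφ.exists_const
  have hc : ContinuousOn (lp χ k φ) (slab n T) :=
    (continuousOn_lpLe hχ k hφ.smooth.continuousOn he).sub
      (continuousOn_lpLe hχ (k - 1) hφ.smooth.continuousOn he)
  exact le_on_closure h1 (hcl ▸ hc.norm) continuousOn_const (hcl ▸ hp)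

theorem norm_frameCoeff_le (ha : StrichartzBound χ T φ b) (hn : 5 ≤ n) (hχ : IsLPBump χ)
    (hφ : IsClassicalWaveMap T φ) (hT : 0 < T) (k : ℤ) {p : Spacetime n} (hp : p ∈ slab n T) :
    ‖frameCoeff χ φ k p‖ ≤ 2 * kernelConst χ * b k := by
  refine (norm_wedge_le _ _).trans ?_
  rw [mul_assoc, mul_comm (kernelConst χ)]
  have h0 := ha.nonneg k
  gcongr
  · exact ha.norm_lp_le hn hχ hφ hT k hp
  · exact norm_lpLe_le hχ hφ (k - 1) hp

theorem pd_lpLt (ha : StrichartzBound χ T φ b) (hn : 5 ≤ n) (hχ : IsLPBump χ)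
    (hφ : IsClassicalWaveMap T φ) {q r : ℝ≥0∞}
    (hqr : Admissible n q r) {ρ : ℝ} {y : ℤ → ℝ} (hρ : 1 < ρ)
    (hby : ∀ j : ℤ, (2 : ℝ) ^ ((1 - scaling n q r) * j) * b j ≤ y j)
    (hy : ∀ j, ρ * y j ≤ y (j + 1)) (α : Fin (n + 1)) (k : ℤ) :
    NormBound T q r (pd α (lpLt χ k φ)) (bernsteinConst χ * (ρ / (ρ - 1)) * y k) := by
  have hρ' : 0 < ρ - 1 := by linarith
  -- `P_{<k}` is `P_{≤ k-1}`, and `y (k - 1) ≤ y k` by growth.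
  refine (ha.pd_lpLe (by lia) hχ hφ.tame hqr hρ hby hy α (k - 1)).mono ?_
  have h1 := hy (k - 1)
  rw [sub_add_cancel] at h1
  have h2 : 0 ≤ y (k - 1) := (mul_nonneg (by positivity) (ha.nonneg _)).trans (hby (k - 1))
  have h3 : y (k - 1) ≤ y k := by nlinarith
  have h4 := one_le_bernsteinConst χ
  gcongr

/-- The derivative falls either on `P_kφ`, with `P_{<k}φ` bounded because `|φ| = 1`, or on
`P_{<k}φ`, with `|P_kφ| ≤ b_k ≤ 1`. In the second case the small factor is given up: the derivative
already carries `y k`. -/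
theorem pd_frameCoeff (ha : StrichartzBound χ T φ b) (hn : 5 ≤ n) (hχ : IsLPBump χ)
    (hφ : IsClassicalWaveMap T φ) (hT : 0 < T) (hb1 : ∀ k, b k ≤ 1) {q r : ℝ≥0∞}
    (hqr : Admissible n q r) {ρ : ℝ} {y : ℤ → ℝ} (hρ : 1 < ρ)
    (hby : ∀ j : ℤ, (2 : ℝ) ^ ((1 - scaling n q r) * j) * b j ≤ y j)
    (hy : ∀ j, ρ * y j ≤ y (j + 1)) (α : Fin (n + 1)) (k : ℤ) :
    NormBound T q r (pd α (frameCoeff χ φ k)) (coeffConst χ ρ * y k) := by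
  have hq := one_le_two.trans hqr.1
  have hr := one_le_two.trans hqr.2.1
  have hρ' : 0 < ρ - 1 := by linarith
  have hB := one_le_bernsteinConst χ
  have hK := kernelConst_nonneg χ
  have ht := hφ.tame
  have s1 := ht.contDiffOn_lp hχ k
  have s2 : ContDiffOn ℝ ∞ (lpLt χ k φ) (openSlab n T) := ht.contDiffOn_lpLe hχ (k - 1)
  have h1 := ha.pd_lp hχ ht hqr α k
  have h2 := ha.pd_lpLt hn hχ hφ hqr hρ hby hy α k
  have e1 : NormBound T q r (fun p => wedgeL m (pd α (lp χ k φ) p) (lpLt χ k φ p))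
      (2 * kernelConst χ * (bernsteinConst χ * ((2 : ℝ) ^ ((1 - scaling n q r) * k) *
        b k))) :=
    h1.dominated (contDiffOn_bilin (wedgeL m) (contDiffOn_pd s1 α) s2).continuousOn
      (by positivity) fun p hp => by
        refine (norm_wedge_le _ _).trans ?_
        rw [mul_assoc, mul_comm (kernelConst χ)]
        gcongr
        exact norm_lpLe_le hχ hφ (k - 1) (openSlab_subset_slab hp)
  have e2 : NormBound T q r (fun p => wedgeL m (lp χ k φ p) (pd α (lpLt χ k φ) p))
      (2 * (bernsteinConst χ * (ρ / (ρ - 1)) * y k)) :=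
    h2.dominated (contDiffOn_bilin (wedgeL m) s1 (contDiffOn_pd s2 α)).continuousOn
      (by positivity) fun p hp => by
        refine (norm_wedge_le _ _).trans ?_
        gcongr
        refine mul_le_of_le_one_left (norm_nonneg _) ?_
        exact (ha.norm_lp_le hn hχ hφ hT k (openSlab_subset_slab hp)).trans (hb1 k)
  refine ((e1.add hq hr e2).congr fun p hp => pd_bilin (wedgeL m) s1 s2 hp α).mono ?_
  have h3 : 2 * kernelConst χ * (bernsteinConst χ * ((2 : ℝ) ^ ((1 - scaling n q r) * k) *
      b k)) ≤ 2 * kernelConst χ * (bernsteinConst χ * y k) := by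
    gcongr
    exact hby k
  refine (add_le_add_left h3 _).trans (le_of_eq ?_)
  unfold coeffConst
  ring

/-- The product rule for `□`, with `□P_kφ` taken as the difference of `□P_{≤ k}φ` and `□P_{≤ k-1}φ`.
The cross terms are products of two `L⁴L^{2(n-1)}` factors of size `2^{lowExp k} θ`. -/
theorem box_frameCoeff (ha : StrichartzBound χ T φ b) (hn : 5 ≤ n) (hχ : IsLPBump χ)
    (hφ : IsClassicalWaveMap T φ) (hT : 0 < T) (hθ : ∀ k, b k ≤ θ) (hθ1 : θ ≤ 1) (k : ℤ) :
    NormBound T 2 ((n - 1 : ℕ) : ℝ≥0∞) (box (frameCoeff χ φ k))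
      (boxCoeffConst χ * ((2 : ℝ) ^ (2 * lowExp n * k) * θ ^ 2)) := by
  have hr : (1 : ℝ≥0∞) ≤ ((n - 1 : ℕ) : ℝ≥0∞) := by exact_mod_cast (by lia : 1 ≤ n - 1)
  have hB := one_le_bernsteinConst χ
  have hK := kernelConst_nonneg χ
  have hbc := boxConst_nonneg χ
  have hlc := lowConst_nonneg hn χ
  have hle := (lowExp_pos hn).le
  have hθ0 : 0 ≤ θ := (ha.nonneg 0).trans (hθ 0)
  have ht := hφ.tame
  have hH := holderTriple_two_mul ((n - 1 : ℕ) : ℝ≥0∞)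
  have s1 := ht.contDiffOn_lp hχ k
  have s2 : ContDiffOn ℝ ∞ (lpLt χ k φ) (openSlab n T) := ht.contDiffOn_lpLe hχ (k - 1)
  set Y := (2 : ℝ) ^ (2 * lowExp n * k) * θ ^ 2 with hY
  have hmono : boxConst χ * ((2 : ℝ) ^ (2 * lowExp n * (k - 1 : ℤ)) * θ ^ 2) ≤ boxConst χ * Y := by
    have := rpow_mono_int (s := 2 * lowExp n) (j := k - 1) (k := k) (by positivity) (by lia)
    rw [hY]
    gcongr
  have bx1 := ha.box_lpLe hn hχ hφ hθ k
  have bx2 := (ha.box_lpLe hn hχ hφ hθ (k - 1)).mono hmono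
  have bxp : NormBound T 2 ((n - 1 : ℕ) : ℝ≥0∞) (box (lp χ k φ)) (boxConst χ * Y + boxConst χ * Y) :=
    (bx1.sub one_le_two hr bx2).congr fun p hp =>
      box_sub (ht.contDiffOn_lpLe hχ k) (ht.contDiffOn_lpLe hχ (k - 1)) hp
  have t1 : NormBound T 2 ((n - 1 : ℕ) : ℝ≥0∞)
      (fun p => wedgeL m (box (lp χ k φ) p) (lpLt χ k φ p))
      (2 * kernelConst χ * (boxConst χ * Y + boxConst χ * Y)) :=
    bxp.dominated (contDiffOn_bilin (wedgeL m) (contDiffOn_box s1) s2).continuousOn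
      (by positivity) fun p hp => by
        refine (norm_wedge_le _ _).trans ?_
        rw [mul_assoc, mul_comm (kernelConst χ)]
        gcongr
        exact norm_lpLe_le hχ hφ (k - 1) (openSlab_subset_slab hp)
  have t3 : NormBound T 2 ((n - 1 : ℕ) : ℝ≥0∞)
      (fun p => wedgeL m (lp χ k φ p) (box (lpLt χ k φ) p)) (2 * (boxConst χ * Y)) :=
    NormBound.dominated (G := box (lpLt χ k φ)) bx2
      (contDiffOn_bilin (wedgeL m) s1 (contDiffOn_box s2)).continuousOn
      (by positivity) fun p hp => by
        refine (norm_wedge_le _ _).trans ?_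
        gcongr
        refine mul_le_of_le_one_left (norm_nonneg _) ?_
        exact (ha.norm_lp_le hn hχ hφ hT k (openSlab_subset_slab hp)).trans ((hθ k).trans hθ1)
  have hlow := fun α => ha.pd_lp hχ ht (admissible_low hn) α k
  have hlow2 := fun α => ha.pd_lpLe_low hn hχ ht hθ α (k - 1)
  have t2 : NormBound T 2 ((n - 1 : ℕ) : ℝ≥0∞)
      (fun p => ∑ α, (2 * eta α) • wedgeL m (pd α (lp χ k φ) p) (pd α (lpLt χ k φ) p))
      ((n + 1) * (2 * 2 * (bernsteinConst χ * lowConst χ)) * Y) := by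
    refine (NormBound.sum one_le_two hr Finset.univ (F := fun α p =>
        (2 * eta α) • wedgeL m (pd α (lp χ k φ) p) (pd α (lpLt χ k φ) p)) fun α _ =>
        NormBound.mul (r := ((n - 1 : ℕ) : ℝ≥0∞)) (G := pd α (lp χ k φ))
        (H := pd α (lpLt χ k φ)) two_ne_zero (by simp) (hlow α) (hlow2 α)
        (K := 2 * 2) ((contDiffOn_bilin (wedgeL m) (contDiffOn_pd s1 α)
          (contDiffOn_pd s2 α)).continuousOn.const_smul (2 * eta α)) (by positivity)
        fun p _ => ?_).mono ?_
    · rw [norm_smul, norm_mul, Real.norm_two, Real.norm_eq_abs, abs_eta, mul_one, mul_assoc]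
      gcongr
      exact norm_wedge_le _ _
    · rw [Finset.sum_const, Finset.card_univ, Fintype.card_fin, nsmul_eq_mul, hY,
        ← rpow_low_mul_self, scaling_low hn]
      have h1 : bernsteinConst χ * ((2 : ℝ) ^ (lowExp n * k) * b k) *
          (lowConst χ * ((2 : ℝ) ^ (lowExp n * (k - 1 : ℤ)) * θ)) ≤
          bernsteinConst χ * ((2 : ℝ) ^ (lowExp n * k) * θ) *
          (lowConst χ * ((2 : ℝ) ^ (lowExp n * k) * θ)) := by
        have h2 := rpow_mono_int (j := k - 1) (k := k) hle (by lia)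
        have h3 := hθ k
        gcongr
      push_cast
      calc _ ≤ ((n : ℝ) + 1) * (2 * 2 * (bernsteinConst χ * ((2 : ℝ) ^ (lowExp n * k) * θ) *
          (lowConst χ * ((2 : ℝ) ^ (lowExp n * k) * θ)))) := by
            push_cast at h1
            gcongr
        _ = _ := by ring
  refine (((t1.add one_le_two hr t2).add one_le_two hr t3).congr
    fun p hp => box_bilin (wedgeL m) s1 s2 hp).mono (le_of_eq ?_)
  unfold boxCoeffConst
  ring

/-- With `ψ = P_{<k}φ`, `f = P_kφ` and `∧` for `wedge`, the expression equals `f ∧ ∂ψ - ∂ψ ∧ f - ∂f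
∧ f`; the dangerous `∂f ∧ ψ` cancels. Each term pairs `f` in `L²L^∞`, of size `2^{-k/2} b_k`, with a
derivative of size about `2^{k/2} b_k`. -/
theorem pd_frameCoeff_sub (ha : StrichartzBound χ T φ b) (hn : 5 ≤ n) (hχ : IsLPBump χ)
    (hφ : IsClassicalWaveMap T φ) {ρ : ℝ} (hρ : 1 < ρ)
    (hy : ∀ j : ℤ, ρ * ((2 : ℝ) ^ (1 / 2 * (j : ℝ)) * b j) ≤
      (2 : ℝ) ^ (1 / 2 * ((j + 1 : ℤ) : ℝ)) * b (j + 1))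
    (α : Fin (n + 1)) (k : ℤ) :
    NormBound T 1 ∞ (fun p => pd α (frameCoeff χ φ k) p -
        (connectionLt χ φ α (k + 1) p - connectionLt χ φ α k p))
      (2 * bernsteinConst χ * (2 * (ρ / (ρ - 1)) + 1) * b k ^ 2) := by
  have hH : ENNReal.HolderTriple ∞ ∞ ∞ := ⟨by simp⟩
  have ht := hφ.tame
  have s1 := ht.contDiffOn_lp hχ k
  have s2 : ContDiffOn ℝ ∞ (lpLt χ k φ) (openSlab n T) := ht.contDiffOn_lpLe hχ (k - 1)
  have h1 := ha.normBound_lp hχ ht (admissible_two hn) k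
  have h2 := ha.pd_lp hχ ht (admissible_two hn) α k
  have h3 := ha.pd_lpLt hn hχ hφ (admissible_two hn) hρ
    (y := fun j : ℤ => (2 : ℝ) ^ (1 / 2 * (j : ℝ)) * b j)
    (fun j => by rw [scaling_two]; norm_num) hy α k
  rw [scaling_two] at h1 h2
  have ez : (2 : ℝ) ^ (-(2⁻¹ * (k : ℝ))) * (2 : ℝ) ^ (2⁻¹ * (k : ℝ)) = 1 := by
    rw [← Real.rpow_add two_pos]; simp
  have e12 : (1 : ℝ) - 1 / 2 = 1 / 2 := by norm_num
  rw [e12] at h2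
  have c1 := (contDiffOn_bilin (wedgeL m) s1 (contDiffOn_pd s2 α)).continuousOn
  have c2 := (contDiffOn_bilin (wedgeL m) (contDiffOn_pd s2 α) s1).continuousOn
  have c3 := (contDiffOn_bilin (wedgeL m) (contDiffOn_pd s1 α) s1).continuousOn
  have t1 := NormBound.mul (q := 1) (r := ∞) (r₁ := ∞) (r₂ := ∞) one_ne_zero ENNReal.one_ne_top
    (by simpa using h1) (by simpa using h3) c1 zero_le_two
    (fun p _ => norm_wedge_le _ _)
  have t2 := NormBound.mul (q := 1) (r := ∞) (r₁ := ∞) (r₂ := ∞) one_ne_zero ENNReal.one_ne_top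
    (by simpa using h3) (by simpa using h1) c2 zero_le_two
    (fun p _ => norm_wedge_le _ _)
  have t3 := NormBound.mul (q := 1) (r := ∞) (r₁ := ∞) (r₂ := ∞) one_ne_zero ENNReal.one_ne_top
    (by simpa using h2) (by simpa using h1) c3 zero_le_two
    (fun p _ => norm_wedge_le _ _)
  refine (((t1.sub le_rfl le_top t2).sub le_rfl le_top t3).congr fun p hp => ?_).mono
    (le_of_eq ?_)
  · have hpdw : pd α (frameCoeff χ φ k) p = wedgeL m (pd α (lp χ k φ) p) (lpLt χ k φ p) +
        wedgeL m (lp χ k φ p) (pd α (lpLt χ k φ) p) := pd_bilin (wedgeL m) s1 s2 hp α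
    have hpsi : pd α (lpLt χ (k + 1) φ) p = pd α (lpLt χ k φ) p + pd α (lp χ k φ) p := by
      rw [lpLt_add_one_eq_add]
      exact pd_add s2 s1 hp α
    rw [hpdw, connectionLt, connectionLt, hpsi, lpLt_add_one_eq_add]
    simp only [← wedgeL_apply, map_add, add_apply]
    abel
  · generalize (2 : ℝ) ^ (-(2⁻¹ * (k : ℝ))) = X at ez ⊢
    generalize (2 : ℝ) ^ (2⁻¹ * (k : ℝ)) = Z at ez ⊢
    linear_combination (2 * bernsteinConst χ * (2 * (ρ / (ρ - 1)) + 1) * b k ^ 2) * ez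

end StrichartzBound

end Frame

/-- A frequency envelope is comparable to one which grows by at most the factor `2^σ` at each
step. -/
theorem IsFrequencyEnvelope.exists_regular {κ σ ε : ℝ} {c : ℤ → ℝ}
    (h : IsFrequencyEnvelope κ σ ε c) (hσ : 0 ≤ σ) (hκ : 0 < κ) :
    ∃ b : ℤ → ℝ, (∀ k, c k ≤ b k) ∧ (∀ k, b k ≤ (2 : ℝ) ^ σ * b (k + 1)) ∧
      ∀ S : Finset ℤ, ∑ k ∈ S, b k ^ 2 ≤ (κ ^ 2 * ε) ^ 2 := by
  -- The regularized envelope is the supremum of `g k k'` over `k'`. It lies between `c k` and `κ *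
  -- c k`, and varies by at most `2^σ` per step with no factor `κ`, as step-by-step geometric growth
  -- requires.
  set g : ℤ → ℤ → ℝ := fun k k' => (2 : ℝ) ^ (-σ * |(k : ℝ) - k'|) * c k' with hg
  have hbdd : ∀ k, BddAbove (range (g k)) := fun k => ⟨κ * c k, by
    rintro _ ⟨k', rfl⟩
    exact h.lower k k'⟩
  have hcb : ∀ k, c k ≤ ⨆ k', g k k' := fun k => by
    refine le_trans (le_of_eq ?_) (le_ciSup (hbdd k) k)
    simp [hg]
  have hbc : ∀ k, (⨆ k', g k k') ≤ κ * c k := fun k => ciSup_le fun k' => h.lower k k'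
  refine ⟨fun k => ⨆ k', g k k', hcb, fun k => ciSup_le fun k' => ?_, fun S => ?_⟩
  · have h1 : g k k' ≤ (2 : ℝ) ^ σ * g (k + 1) k' := by
      simp only [hg]
      rw [← mul_assoc, ← Real.rpow_add two_pos]
      have h2 : |((k + 1 : ℤ) : ℝ) - k'| ≤ |(k : ℝ) - k'| + 1 := by
        have := abs_add_le ((k : ℝ) - k') 1
        rw [abs_one] at this
        push_cast
        rwa [add_sub_right_comm]
      refine mul_le_mul_of_nonneg_right (Real.rpow_le_rpow_of_exponent_le one_le_two ?_)
        (h.pos k').le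
      nlinarith
    exact h1.trans (mul_le_mul_of_nonneg_left (le_ciSup (hbdd (k + 1)) k') (by positivity))
  · have h1 := (Real.sqrt_le_iff.1 h.l2_bound).2
    have h2 := h.summable_sq.sum_le_tsum S fun k _ => sq_nonneg (c k)
    calc ∑ k ∈ S, (⨆ k', g k k') ^ 2 ≤ ∑ k ∈ S, κ ^ 2 * c k ^ 2 :=
          Finset.sum_le_sum fun k _ => by
            rw [← mul_pow]
            exact pow_le_pow_left₀ ((h.pos k).le.trans (hcb k)) (hbc k) 2
      _ = κ ^ 2 * ∑ k ∈ S, c k ^ 2 := by rw [Finset.mul_sum]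
      _ ≤ κ ^ 2 * (κ * ε) ^ 2 := by gcongr; exact h2.trans h1
      _ = _ := by ring

/-! ### Estimates for the frame under a small Strichartz bound -/

section Frame

variable {n m : ℕ} {T : ℝ} {χ : E n → ℝ} {φ : Spacetime n → E m}

/-- The bilinear map `(A, B) ↦ A† B`. -/
def transposeMulL (m : ℕ) : Mat m →L[ℝ] Mat m →L[ℝ] Mat m :=
  LinearMap.mkContinuous₂ (LinearMap.mk₂ ℝ (fun A B : Mat m => Aᵀ * B)
    (fun a b c => by simp [add_mul])
    (fun r a b => by simp)
    (fun a b c => by simp [mul_add])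
    (fun r a b => by simp)) 1
    fun a b => by
      rw [one_mul, ← norm_transpose a]
      exact norm_mul_le _ _

theorem norm_pd_transpose_mul_sub_one_le {U : Spacetime n → Mat m}
    (hU : ContDiffOn ℝ ∞ U (openSlab n T)) {p : Spacetime n} (hp : p ∈ openSlab n T)
    (α : Fin (n + 1)) : ‖pd α (fun p => (U p)ᵀ * U p - 1) p‖ ≤ 2 * (‖U p‖ * ‖pd α U p‖) := by
  have h1 : ContDiffOn ℝ ∞ (fun p => (U p)ᵀ * U p) (openSlab n T) :=
    contDiffOn_bilin (transposeMulL m) hU hU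
  have h2 : pd α (fun p => (U p)ᵀ * U p) p = (pd α U p)ᵀ * U p + (U p)ᵀ * pd α U p :=
    pd_bilin (transposeMulL m) hU hU hp α
  rw [pd_sub h1 contDiffOn_const hp, pd_const, sub_zero, h2]
  have h3 := norm_mul_le (pd α U p)ᵀ (U p)
  have h4 := norm_mul_le (U p)ᵀ (pd α U p)
  rw [norm_transpose] at h3 h4
  linarith [norm_add_le ((pd α U p)ᵀ * U p) ((U p)ᵀ * pd α U p)]

/-- Frequency-localized bounds on `φ` in terms of a sequence `b`, which is small in `ℓ²` and for
which `2^{k/2} b_k` grows geometrically. -/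
structure SmallStrichartzBound (χ : E n → ℝ) (T : ℝ) (φ : Spacetime n → E m) (s θ : ℝ)
    (b : ℤ → ℝ) : Prop extends StrichartzBound χ T φ b where
  growth : ∀ k : ℤ, (2 : ℝ) ^ s * ((2 : ℝ) ^ (1 / 2 * (k : ℝ)) * b k) ≤
    (2 : ℝ) ^ (1 / 2 * ((k + 1 : ℤ) : ℝ)) * b (k + 1)
  sum_sq_le : ∀ S : Finset ℤ, ∑ k ∈ S, b k ^ 2 ≤ θ ^ 2
  s_pos : 0 < s
  s_le : s ≤ lowExp n
  theta_nonneg : 0 ≤ θ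
  theta_le_one : θ ≤ 1
  coeff_le_half : 2 * kernelConst χ * θ ≤ 1 / 2
  coeff_le : 2 * kernelConst χ * θ ≤ ((2 : ℝ) ^ s - 1) / 2

/-- The constant in the bounds on `∂U`. -/
def pdFrameConst (χ : E n → ℝ) (ρ : ℝ) : ℝ := 2 * (2 * coeffConst χ ρ) / (ρ - 1)

theorem pdFrameConst_nonneg (χ : E n → ℝ) {ρ : ℝ} (hρ : 1 < ρ) : 0 ≤ pdFrameConst χ ρ := by
  have h1 := coeffConst_nonneg χ hρ
  have h2 : 0 < ρ - 1 := by linarith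
  unfold pdFrameConst
  positivity

/-- The constant in the bound on `□U`. -/
def boxFrameConst (χ : E n → ℝ) (ρ : ℝ) : ℝ :=
  2 * (2 * boxCoeffConst χ + 2 * (n + 1) * (coeffConst χ ρ * pdFrameConst χ ρ)) / (ρ - 1)

theorem boxFrameConst_nonneg (hn : 5 ≤ n) (χ : E n → ℝ) {ρ : ℝ} (hρ : 1 < ρ) :
    0 ≤ boxFrameConst χ ρ := by
  have h1 := coeffConst_nonneg χ hρ
  have h2 := pdFrameConst_nonneg χ hρ
  have h3 := boxCoeffConst_nonneg hn χ
  have h4 : 0 < ρ - 1 := by linarith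
  unfold boxFrameConst
  positivity

/-- The constant in the bounds on `∂P_{<k}φ (P_{<k}φ)† - P_{<k}φ (∂P_{<k}φ)†`. -/
def connectionConst (χ : E n → ℝ) (ρ : ℝ) : ℝ :=
  2 * kernelConst χ * (bernsteinConst χ * (ρ / (ρ - 1)))

theorem connectionConst_nonneg (χ : E n → ℝ) {ρ : ℝ} (hρ : 1 < ρ) : 0 ≤ connectionConst χ ρ := by
  have h1 := kernelConst_nonneg χ
  have h2 := one_le_bernsteinConst χ
  have h4 : 0 < ρ - 1 := by linarith
  unfold connectionConst
  positivity

/-- The constant in the quadratic part of the bound on `∂U - AU`. -/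
def defectConst (χ : E n → ℝ) (ρ : ℝ) : ℝ :=
  2 * (2 * bernsteinConst χ * (2 * (ρ / (ρ - 1)) + 1)) +
    2 * kernelConst χ * pdFrameConst χ ρ + 2 * (connectionConst χ ρ * (2 * kernelConst χ))

theorem defectConst_nonneg (χ : E n → ℝ) {ρ : ℝ} (hρ : 1 < ρ) : 0 ≤ defectConst χ ρ := by
  have h1 := kernelConst_nonneg χ
  have h2 := one_le_bernsteinConst χ
  have h3 := pdFrameConst_nonneg χ hρ
  have h4 := connectionConst_nonneg χ hρ
  have h5 : 0 < ρ - 1 := by linarith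
  unfold defectConst
  positivity

namespace SmallStrichartzBound

variable {s θ : ℝ} {b : ℤ → ℝ}

theorem le_theta (h : SmallStrichartzBound χ T φ s θ b) (k : ℤ) : b k ≤ θ := by
  have := h.sum_sq_le {k}
  rw [Finset.sum_singleton] at this
  exact (sq_le_sq₀ (h.nonneg k) h.theta_nonneg).1 this

theorem one_lt (h : SmallStrichartzBound χ T φ s θ b) : 1 < (2 : ℝ) ^ s := one_lt_two_rpow h.s_pos

/-- `2^k b_k` is `2^{k/2} b_k` times the increasing factor `2^{k/2}`, so it inherits the growth
rate. -/
theorem growth_one (h : SmallStrichartzBound χ T φ s θ b) (k : ℤ) :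
    (2 : ℝ) ^ s * ((2 : ℝ) ^ (1 * (k : ℝ)) * b k) ≤
      (2 : ℝ) ^ (1 * ((k + 1 : ℤ) : ℝ)) * b (k + 1) := by
  have e : ∀ j : ℤ, (2 : ℝ) ^ (1 * (j : ℝ)) =
      (2 : ℝ) ^ (1 / 2 * (j : ℝ)) * (2 : ℝ) ^ (1 / 2 * (j : ℝ)) := fun j => by
    rw [← Real.rpow_add two_pos]
    ring_nf
  have h1 := rpow_mono_int (s := 1 / 2) (j := k) (k := k + 1) (by norm_num) (by lia)
  have h2 := h.nonneg (k + 1)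
  rw [e, e]
  calc _ = (2 : ℝ) ^ (1 / 2 * (k : ℝ)) * ((2 : ℝ) ^ s * ((2 : ℝ) ^ (1 / 2 * (k : ℝ)) * b k)) := by
        ring
    _ ≤ (2 : ℝ) ^ (1 / 2 * ((k + 1 : ℤ) : ℝ)) *
        ((2 : ℝ) ^ (1 / 2 * ((k + 1 : ℤ) : ℝ)) * b (k + 1)) :=
      mul_le_mul h1 (h.growth k) (mul_nonneg (by positivity)
        (mul_nonneg (by positivity) (h.nonneg k))) (by positivity)
    _ = _ := by ring

theorem growth_rpow {e : ℝ} (hse : s ≤ e) {B : ℝ} (hB : 0 ≤ B) (k : ℤ) :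
    (2 : ℝ) ^ s * ((2 : ℝ) ^ (e * (k : ℝ)) * B) ≤ (2 : ℝ) ^ (e * ((k + 1 : ℤ) : ℝ)) * B := by
  rw [← rpow_growth]
  gcongr
  exact one_le_two

theorem rpow_mul_le {e : ℝ} (he : 0 ≤ e) {B : ℝ} (hB : 0 ≤ B) :
    (2 : ℝ) ^ (e * ((-9 : ℤ) : ℝ)) * B ≤ B := by
  refine mul_le_of_le_one_left hB (Real.rpow_le_one_of_one_le_of_nonpos one_le_two ?_)
  push_cast
  linarith

theorem norm_frameCoeff_le_theta (h : SmallStrichartzBound χ T φ s θ b) (hn : 5 ≤ n)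
    (hχ : IsLPBump χ) (hφ : IsClassicalWaveMap T φ) (hT : 0 < T) (k : ℤ) {p : Spacetime n}
    (hp : p ∈ slab n T) : ‖frameCoeff χ φ k p‖ ≤ 2 * kernelConst χ * θ := by
  refine (h.norm_frameCoeff_le hn hχ hφ hT k hp).trans ?_
  have := kernelConst_nonneg χ
  gcongr
  exact h.le_theta k

theorem sum_coeff_sq_le (h : SmallStrichartzBound χ T φ s θ b) (S : Finset ℤ) :
    ∑ k ∈ S, (2 * kernelConst χ * b k) ^ 2 ≤ 1 / 2 * (2 * kernelConst χ * θ) := by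
  have h1 := kernelConst_nonneg χ
  have h2 := h.theta_nonneg
  simp_rw [mul_pow _ (b _)]
  rw [← Finset.mul_sum]
  calc _ ≤ (2 * kernelConst χ) ^ 2 * θ ^ 2 := by gcongr; exact h.sum_sq_le S
    _ = 2 * kernelConst χ * θ * (2 * kernelConst χ * θ) := by ring
    -- One of the two factors `2 * kernelConst χ * θ` is traded for `1 / 2`, leaving a bound linear
    -- in `θ`.
    _ ≤ _ := by gcongr; exact h.coeff_le_half

theorem norm_transpose_mul_sub_one_le (h : SmallStrichartzBound χ T φ s θ b) (hn : 5 ≤ n)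
    (hχ : IsLPBump χ) (hφ : IsClassicalWaveMap T φ) (hT : 0 < T) {M k : ℤ} (hk : -M + 1 ≤ k)
    {p : Spacetime n} (hp : p ∈ slab n T) :
    ‖(frameLt χ φ M k p)ᵀ * frameLt χ φ M k p - 1‖ ≤ 2 * kernelConst χ * θ := by
  have h1 := (isFrameSeq_frameLt hχ hφ.tame M).norm_transpose_mul_sub_one_le
    (fun k => h.norm_frameCoeff_le hn hχ hφ hT k hp)
    (fun k => (h.sum_coeff_sq_le _).trans (by linarith [h.coeff_le_half])) hk
  linarith [h.sum_coeff_sq_le (Finset.Ico (-M + 1) k)]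

theorem norm_frameLt_le (h : SmallStrichartzBound χ T φ s θ b) (hn : 5 ≤ n)
    (hχ : IsLPBump χ) (hφ : IsClassicalWaveMap T φ) (hT : 0 < T) {M k : ℤ} (hk : -M + 1 ≤ k)
    {p : Spacetime n} (hp : p ∈ slab n T) : ‖frameLt χ φ M k p‖ ≤ 2 :=
  (isFrameSeq_frameLt hχ hφ.tame M).norm_le_two
    (fun k => h.norm_frameCoeff_le hn hχ hφ hT k hp)
    (fun k => (h.sum_coeff_sq_le _).trans (by linarith [h.coeff_le_half])) hk

theorem pd_frameLt (h : SmallStrichartzBound χ T φ s θ b) (hn : 5 ≤ n)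
    (hχ : IsLPBump χ) (hφ : IsClassicalWaveMap T φ) (hT : 0 < T) {q r : ℝ≥0∞}
    (hqr : Admissible n q r) {y : ℤ → ℝ}
    (hby : ∀ j : ℤ, (2 : ℝ) ^ ((1 - scaling n q r) * j) * b j ≤ y j)
    (hy : ∀ j, (2 : ℝ) ^ s * y j ≤ y (j + 1)) (α : Fin (n + 1)) {M k : ℤ} (hk : -M + 1 ≤ k) :
    NormBound T q r (pd α (frameLt χ φ M k)) (pdFrameConst χ ((2 : ℝ) ^ s) * y k) :=
  (isFrameSeq_frameLt hχ hφ.tame M).normBound_pd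
    (fun _ hk p hp => h.norm_frameLt_le hn hχ hφ hT hk (openSlab_subset_slab hp))
    (fun k p hp => h.norm_frameCoeff_le_theta hn hχ hφ hT k (openSlab_subset_slab hp))
    (one_le_two.trans hqr.1) (one_le_two.trans hqr.2.1) h.one_lt
    (mul_nonneg (mul_nonneg zero_le_two (kernelConst_nonneg χ)) h.theta_nonneg) h.coeff_le
    (coeffConst_nonneg χ h.one_lt)
    (fun j => (mul_nonneg (by positivity) (h.nonneg j)).trans (hby j)) hy α
    (fun k => h.pd_frameCoeff hn hχ hφ hT (fun j => (h.le_theta j).trans h.theta_le_one) hqr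
      h.one_lt hby hy α k) hk

theorem pd_frameLt_two (h : SmallStrichartzBound χ T φ s θ b) (hn : 5 ≤ n)
    (hχ : IsLPBump χ) (hφ : IsClassicalWaveMap T φ) (hT : 0 < T) (α : Fin (n + 1)) {M k : ℤ}
    (hk : -M + 1 ≤ k) :
    NormBound T 2 ∞ (pd α (frameLt χ φ M k))
      (pdFrameConst χ ((2 : ℝ) ^ s) * ((2 : ℝ) ^ (1 / 2 * (k : ℝ)) * b k)) :=
  h.pd_frameLt hn hχ hφ hT (admissible_two hn)
    (y := fun j : ℤ => (2 : ℝ) ^ (1 / 2 * (j : ℝ)) * b j)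
    (fun j => by rw [scaling_two]; norm_num) h.growth α hk

theorem pd_frameLt_top (h : SmallStrichartzBound χ T φ s θ b) (hn : 5 ≤ n)
    (hχ : IsLPBump χ) (hφ : IsClassicalWaveMap T φ) (hT : 0 < T) (α : Fin (n + 1)) {M k : ℤ}
    (hk : -M + 1 ≤ k) :
    NormBound T ∞ ∞ (pd α (frameLt χ φ M k))
      (pdFrameConst χ ((2 : ℝ) ^ s) * ((2 : ℝ) ^ (1 * (k : ℝ)) * b k)) :=
  h.pd_frameLt hn hχ hφ hT (admissible_top hn) (y := fun j : ℤ => (2 : ℝ) ^ (1 * (j : ℝ)) * b j)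
    (fun j => by rw [scaling_top, sub_zero]) h.growth_one α hk

theorem box_frameLt (h : SmallStrichartzBound χ T φ s θ b) (hn : 5 ≤ n)
    (hχ : IsLPBump χ) (hφ : IsClassicalWaveMap T φ) (hT : 0 < T) {M k : ℤ} (hk : -M + 1 ≤ k) :
    NormBound T 2 ((n - 1 : ℕ) : ℝ≥0∞) (box (frameLt χ φ M k))
      (boxFrameConst χ ((2 : ℝ) ^ s) * ((2 : ℝ) ^ (2 * lowExp n * k) * θ ^ 2)) := by
  have hr : (1 : ℝ≥0∞) ≤ ((n - 1 : ℕ) : ℝ≥0∞) := by exact_mod_cast (by lia : 1 ≤ n - 1)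
  have hle := lowExp_pos hn
  have hlow : ∀ j : ℤ, (2 : ℝ) ^ ((1 - scaling n (2 * 2) (2 * ((n - 1 : ℕ) : ℝ≥0∞))) * j) * b j ≤
      (2 : ℝ) ^ (lowExp n * j) * θ := fun j => by
    rw [scaling_low hn]
    exact mul_le_mul_of_nonneg_left (h.le_theta j) (by positivity)
  have hlow' := growth_rpow h.s_le h.theta_nonneg
  exact (isFrameSeq_frameLt hχ hφ.tame M).normBound_box
    (y := fun k : ℤ => (2 : ℝ) ^ (2 * lowExp n * k) * θ ^ 2)
    (z := fun k : ℤ => (2 : ℝ) ^ (lowExp n * k) * θ)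
    (fun _ hk p hp => h.norm_frameLt_le hn hχ hφ hT hk (openSlab_subset_slab hp))
    (fun k p hp => h.norm_frameCoeff_le_theta hn hχ hφ hT k (openSlab_subset_slab hp))
    one_le_two (by simp) hr h.one_lt
    (mul_nonneg (mul_nonneg zero_le_two (kernelConst_nonneg χ)) h.theta_nonneg) h.coeff_le
    (boxCoeffConst_nonneg hn χ) (coeffConst_nonneg χ h.one_lt) (pdFrameConst_nonneg χ h.one_lt)
    (fun j => by positivity)
    (growth_rpow (by linarith [h.s_le]) (sq_nonneg θ))
    (rpow_low_mul_self θ)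
    (h.box_frameCoeff hn hχ hφ hT h.le_theta h.theta_le_one)
    (fun α k => h.pd_frameCoeff hn hχ hφ hT (fun j => (h.le_theta j).trans h.theta_le_one)
      (admissible_low hn) h.one_lt hlow hlow' α k)
    (fun α k hk => h.pd_frameLt hn hχ hφ hT (admissible_low hn) hlow hlow' α hk)
    hk

theorem connectionLt_add_one (h : SmallStrichartzBound χ T φ s θ b) (hn : 5 ≤ n)
    (hχ : IsLPBump χ) (hφ : IsClassicalWaveMap T φ) {q r : ℝ≥0∞}
    (hqr : Admissible n q r) {y : ℤ → ℝ}
    (hby : ∀ j : ℤ, (2 : ℝ) ^ ((1 - scaling n q r) * j) * b j ≤ y j)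
    (hy : ∀ j, (2 : ℝ) ^ s * y j ≤ y (j + 1)) (α : Fin (n + 1)) (k : ℤ) :
    NormBound T q r (connectionLt χ φ α (k + 1)) (connectionConst χ ((2 : ℝ) ^ s) * y k) := by
  have hK := kernelConst_nonneg χ
  have h1 := h.pd_lpLe (by lia) hχ hφ.tame hqr h.one_lt hby hy α k
  rw [← lpLt_add_one] at h1
  refine (h1.dominated (continuousOn_connectionLt hχ hφ.tame α (k + 1)) (by positivity)
    fun p hp => norm_connectionLt_le hχ hφ α (k + 1) hp).mono (le_of_eq ?_)
  rw [connectionConst, mul_assoc (2 * kernelConst χ)]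

/-- The part linear in `θ` comes from the initial connection alone; all later increments are
quadratic and sum by the `ℓ²` bound. -/
theorem pd_frameLt_sub (h : SmallStrichartzBound χ T φ s θ b) (hn : 5 ≤ n)
    (hχ : IsLPBump χ) (hφ : IsClassicalWaveMap T φ) (hT : 0 < T) (α : Fin (n + 1)) {M k : ℤ}
    (hM : T ≤ (2 : ℝ) ^ M) (hk : -M + 1 ≤ k) :
    NormBound T 1 ∞ (fun p => pd α (frameLt χ φ M k) p - connectionLt χ φ α k p * frameLt χ φ M k p)
      (connectionConst χ ((2 : ℝ) ^ s) * θ + defectConst χ ((2 : ℝ) ^ s) * θ ^ 2) := by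
  have hK := kernelConst_nonneg χ
  have hB := one_le_bernsteinConst χ
  have hC := connectionConst_nonneg χ h.one_lt
  have ht := hφ.tame
  have hinit : NormBound T 1 ∞ (connectionLt χ φ α (-M + 1))
      (connectionConst χ ((2 : ℝ) ^ s) * θ) := by
    refine ⟨continuousOn_connectionLt hχ ht α _, mul_nonneg hC h.theta_nonneg,
      (mixedNorm_one_top_le hT.le fun p hp => (h.connectionLt_add_one hn hχ hφ (admissible_top hn)
        (y := fun j : ℤ => (2 : ℝ) ^ (1 * (j : ℝ)) * b j)
        (fun j => by rw [scaling_top, sub_zero]) h.growth_one α (-M)).pointwise hp).trans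
        (ENNReal.ofReal_le_ofReal ?_)⟩
    -- The connection at index `-M + 1` is built from `P_{≤ -M}φ`, so its sup norm carries `2^{-M}`,
    -- which pays for the factor `T` from integrating in time.
    have h1 : T * (2 : ℝ) ^ (1 * ((-M : ℤ) : ℝ)) ≤ 1 := by
      rw [one_mul, Real.rpow_intCast, zpow_neg, ← div_eq_mul_inv]
      exact div_le_one_of_le₀ hM (by positivity)
    calc _ = connectionConst χ ((2 : ℝ) ^ s) * (T * (2 : ℝ) ^ (1 * ((-M : ℤ) : ℝ)) * b (-M)) := by
          ring
      _ ≤ connectionConst χ ((2 : ℝ) ^ s) * (1 * θ) := by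
          have h2 := h.le_theta (-M)
          have h3 := h.nonneg (-M)
          gcongr
      _ = _ := by rw [one_mul]
  have hw : ∀ k, NormBound T 2 ∞ (frameCoeff χ φ k)
      (2 * kernelConst χ * ((2 : ℝ) ^ (-(1 / 2) * (k : ℝ)) * b k)) := fun k => by
    have h1 := h.normBound_lp hχ ht (admissible_two hn) k
    rw [scaling_two] at h1
    refine h1.dominated (contDiffOn_frameCoeff hχ ht k).continuousOn (by positivity) fun p hp => ?_
    refine (norm_wedge_le _ _).trans ?_
    rw [mul_assoc, mul_comm (kernelConst χ)]
    gcongr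
    exact norm_lpLe_le hχ hφ (k - 1) (openSlab_subset_slab hp)
  refine ((isFrameSeq_frameLt hχ ht M).normBound_pd_sub_mul (b := b) (A := connectionLt χ φ α)
    (y := fun j : ℤ => (2 : ℝ) ^ (1 / 2 * (j : ℝ)) * b j)
    (z := fun j : ℤ => (2 : ℝ) ^ (-(1 / 2) * (j : ℝ)) * b j)
    (fun _ hk p hp => h.norm_frameLt_le hn hχ hφ hT hk (openSlab_subset_slab hp)) α
    (fun k => ?_) (h.pd_frameCoeff_sub hn hχ hφ h.one_lt h.growth α) hw
    (fun k hk => h.pd_frameLt_two hn hχ hφ hT α hk)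
    (h.connectionLt_add_one hn hχ hφ (admissible_two hn)
      (fun j => by rw [scaling_two]; norm_num) h.growth α) hinit hk).mono ?_
  · have : (2 : ℝ) ^ (-(1 / 2) * (k : ℝ)) * (2 : ℝ) ^ (1 / 2 * (k : ℝ)) = 1 := by
      rw [← Real.rpow_add two_pos, ← add_mul]; simp
    linear_combination b k ^ 2 * this
  · have := mul_le_mul_of_nonneg_left (h.sum_sq_le (Finset.Ico (-M + 1) k))
      (defectConst_nonneg χ h.one_lt)
    rw [defectConst] at this ⊢
    linarith

end SmallStrichartzBound

end Frame

/-! ### Choice of the small parameter -/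

theorem exists_small_theta {K ρ : ℝ} (hK : 0 ≤ K) (hρ : 1 < ρ) :
    ∃ θ₀ : ℝ, 0 < θ₀ ∧ ∀ θ ≤ θ₀, θ ≤ 1 ∧ 2 * K * θ ≤ 1 / 2 ∧ 2 * K * θ ≤ (ρ - 1) / 2 := by
  have hρ' : 0 < ρ - 1 := by linarith
  have hm : 0 < min (1 / 2) ((ρ - 1) / 2) := lt_min (by norm_num) (by positivity)
  -- The `+ 1` keeps the denominator positive when `K = 0`.
  refine ⟨min 1 (min (1 / 2) ((ρ - 1) / 2) / (2 * K + 1)), by positivity, fun θ hθ => ?_⟩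
  have h1 : 2 * K * θ ≤ min (1 / 2) ((ρ - 1) / 2) := by
    calc 2 * K * θ ≤ 2 * K * (min (1 / 2) ((ρ - 1) / 2) / (2 * K + 1)) := by
          gcongr
          exact hθ.trans (min_le_right _ _)
      _ = min (1 / 2) ((ρ - 1) / 2) * (2 * K / (2 * K + 1)) := by ring
      _ ≤ _ := mul_le_of_le_one_right hm.le (div_le_one_of_le₀ (by linarith) (by positivity))
  exact ⟨hθ.trans (min_le_left _ _), h1.trans (min_le_left _ _), h1.trans (min_le_right _ _)⟩

theorem exists_smallStrichartzBound {n m : ℕ} {T : ℝ} {χ : E n → ℝ} {φ : Spacetime n → E m}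
    {κ σ ε C₀ s : ℝ} {c : ℤ → ℝ} (hc : IsFrequencyEnvelope κ σ ε c) (hσ : 0 ≤ σ) (hκ : 0 < κ)
    (hC₀ : 0 ≤ C₀) (hφ : ∀ k, strichartzNorm T k (lp χ k φ) ≤ ENNReal.ofReal (2 * C₀ * c k))
    (hs : 0 < s) (hsσ : s ≤ 1 / 2 - σ) (hsn : s ≤ lowExp n) (hθ0 : 0 ≤ 2 * C₀ * κ ^ 2 * ε)
    (hθ1 : 2 * C₀ * κ ^ 2 * ε ≤ 1) (hθ2 : 2 * kernelConst χ * (2 * C₀ * κ ^ 2 * ε) ≤ 1 / 2)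
    (hθ3 : 2 * kernelConst χ * (2 * C₀ * κ ^ 2 * ε) ≤ ((2 : ℝ) ^ s - 1) / 2) :
    ∃ b, SmallStrichartzBound χ T φ s (2 * C₀ * κ ^ 2 * ε) b := by
  obtain ⟨b, hcb, hgrow, hsum⟩ := hc.exists_regular hσ hκ
  have hb : ∀ k, 0 ≤ b k := fun k => (hc.pos k).le.trans (hcb k)
  refine ⟨fun k => 2 * C₀ * b k, ?_⟩
  exact
  { nonneg := fun k => mul_nonneg (by positivity) (hb k)
    le := fun k => (hφ k).trans (ENNReal.ofReal_le_ofReal (by have := hcb k; gcongr))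
    growth := fun k => by
      -- One step gains `2^{1/2}` from the weight and loses at most `2^σ` from the envelope; `s ≤
      -- 1/2 - σ` is what is left.
      have h1 : (2 : ℝ) ^ s * ((2 : ℝ) ^ (1 / 2 * (k : ℝ)) * (2 : ℝ) ^ σ) ≤
          (2 : ℝ) ^ (1 / 2 * ((k + 1 : ℤ) : ℝ)) := by
        rw [← Real.rpow_add two_pos, ← Real.rpow_add two_pos]
        refine Real.rpow_le_rpow_of_exponent_le one_le_two ?_
        push_cast
        linarith
      calc (2 : ℝ) ^ s * ((2 : ℝ) ^ (1 / 2 * (k : ℝ)) * (2 * C₀ * b k))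
          ≤ (2 : ℝ) ^ s * ((2 : ℝ) ^ (1 / 2 * (k : ℝ)) * (2 * C₀ * ((2 : ℝ) ^ σ * b (k + 1)))) := by
            have := hgrow k
            gcongr
        _ = (2 : ℝ) ^ s * ((2 : ℝ) ^ (1 / 2 * (k : ℝ)) * (2 : ℝ) ^ σ) *
            (2 * C₀ * b (k + 1)) := by ring
        _ ≤ _ := mul_le_mul_of_nonneg_right h1 (mul_nonneg (by positivity) (hb _))
    sum_sq_le := fun S => by
      simp_rw [mul_pow _ (b _)]
      rw [← Finset.mul_sum]
      calc _ ≤ (2 * C₀) ^ 2 * (κ ^ 2 * ε) ^ 2 := by gcongr; exact hsum S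
        _ = _ := by ring
    s_pos := hs
    s_le := hsn
    theta_nonneg := hθ0
    theta_le_one := hθ1
    coeff_le_half := hθ2
    coeff_le := hθ3 }

end WaveMap

end

/-! ### Assembly of the estimates -/

theorem proposition6p1 (n m : ℕ) (hn : 5 ≤ n) (hm : 2 ≤ m)
    (σ : ℝ) (hσ0 : 0 < σ) (hσ1 : σ < 1 / 2) (κ : ℝ) (hκ : 0 < κ)
    (χ : WaveMap.E n → ℝ) (hχ : WaveMap.IsLPBump χ) :
    ∃ C : ℝ, 0 < C ∧
    ∀ C₀ : ℝ, 1 ≤ C₀ →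
    ∃ ε₀ : ℝ, 0 < ε₀ ∧
    ∀ ε : ℝ, 0 < ε → ε ≤ ε₀ →
    ∀ T : ℝ, 0 < T →
    ∃ M₀ : ℤ, ∀ M : ℤ, M₀ ≤ M →
    ∀ (c : ℤ → ℝ) (φ : WaveMap.Spacetime n → WaveMap.E m),
      WaveMap.IsFrequencyEnvelope κ σ ε c →
      WaveMap.IsClassicalWaveMap T φ →
      (∀ k : ℤ, WaveMap.strichartzNorm T k (WaveMap.lp χ k φ) ≤ ENNReal.ofReal (2 * C₀ * c k)) →
      let U : WaveMap.Spacetime n → WaveMap.Mat m := WaveMap.frame χ φ M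
      let A : Fin (n + 1) → WaveMap.Spacetime n → WaveMap.Mat m := WaveMap.connection χ φ
      ContDiffOn ℝ ∞ U (WaveMap.openSlab n T) ∧
      WaveMap.mixedNorm T ∞ ∞ (fun p => (U p)ᵀ * U p - 1) ≤ ENNReal.ofReal (C * C₀ ^ 2 * ε) ∧
      WaveMap.mixedNorm T ∞ ∞ (WaveMap.pd 0 (fun p => (U p)ᵀ * U p - 1)) ≤
        ENNReal.ofReal (C * C₀ ^ 2 * ε) ∧
      (∀ p ∈ WaveMap.slab n T, IsUnit (U p)) ∧
      WaveMap.mixedNorm T ∞ ∞ U ≤ ENNReal.ofReal C ∧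
      WaveMap.mixedNorm T ∞ ∞ (fun p => (U p)⁻¹) ≤ ENNReal.ofReal C ∧
      (∀ α : Fin (n + 1),
        WaveMap.mixedNorm T 1 ∞ (fun p => WaveMap.pd α U p - A α p * U p) ≤
          ENNReal.ofReal (C * C₀ ^ 2 * ε) ∧
        WaveMap.mixedNorm T ∞ ∞ (WaveMap.pd α U) ≤ ENNReal.ofReal (C * C₀ ^ 2 * ε) ∧
        WaveMap.mixedNorm T 2 ∞ (WaveMap.pd α U) ≤ ENNReal.ofReal (C * C₀ ^ 2 * ε)) ∧
      WaveMap.mixedNorm T 2 ((n - 1 : ℕ) : ℝ≥0∞) (WaveMap.box U) ≤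
        ENNReal.ofReal (C * C₀ ^ 2 * ε) := by
  -- A single growth rate for every recursion: `1/2 - σ` for the envelope-weighted bounds, `lowExp
  -- n` for those using only `b_k ≤ θ`.
  set s := min (1 / 2 - σ) (WaveMap.lowExp n) with hs
  have hs0 : 0 < s := lt_min (by linarith) (WaveMap.lowExp_pos hn)
  have hρ := WaveMap.one_lt_two_rpow hs0
  have hK0 := WaveMap.kernelConst_nonneg χ
  have hP0 := WaveMap.pdFrameConst_nonneg χ hρ
  have hA0 := WaveMap.connectionConst_nonneg χ hρ
  have hD0 := WaveMap.defectConst_nonneg χ hρ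
  have hB0 := WaveMap.boxFrameConst_nonneg hn χ hρ
  obtain ⟨θ₀, hθ₀, hsmall⟩ := WaveMap.exists_small_theta hK0 hρ
  set K := 2 * WaveMap.kernelConst χ + 4 * WaveMap.pdFrameConst χ (2 ^ s) +
    (WaveMap.connectionConst χ (2 ^ s) + WaveMap.defectConst χ (2 ^ s)) +
    WaveMap.boxFrameConst χ (2 ^ s) with hK
  have hK' : 0 ≤ K := by positivity
  -- The 4 covers `‖U‖ ≤ 2` and `‖U⁻¹‖ ≤ 4`; the rest turns bounds by `K * θ`, with `θ = 2 * C₀ * κ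
  -- ^ 2 * ε`, into the required form. The choice of `ε₀` says that `θ ≤ θ₀`.
  refine ⟨4 + 2 * κ ^ 2 * K, by positivity, fun C₀ hC₀ => ⟨θ₀ / (2 * C₀ * κ ^ 2), by positivity,
    fun ε hε hεle T hT => ?_⟩⟩
  obtain ⟨N, hN⟩ := pow_unbounded_of_one_lt T one_lt_two
  -- `M ≥ 10` ensures that the starting index `-M + 1` does not exceed `-9`, and `M ≥ N` gives `T ≤
  -- 2^M`.
  refine ⟨max 10 N, fun M hM c φ hc hφ hbound => ?_⟩
  have hM10 : (10 : ℤ) ≤ M := (le_max_left _ _).trans hM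
  have hTM : T ≤ (2 : ℝ) ^ M := by
    refine hN.le.trans ?_
    rw [← zpow_natCast]
    exact zpow_le_zpow_right₀ one_le_two ((le_max_right _ _).trans hM)
  have hk : -M + 1 ≤ -9 := by lia
  set θ := 2 * C₀ * κ ^ 2 * ε with hθ
  have hθ0 : 0 ≤ θ := by positivity
  have hθle : θ ≤ θ₀ := by
    rw [le_div_iff₀ (by positivity)] at hεle
    rw [hθ, mul_comm]
    exact hεle
  obtain ⟨hθ1, hθ2, hθ3⟩ := hsmall θ hθle
  have hfin : ∀ X : ℝ, X ≤ K * θ → X ≤ (4 + 2 * κ ^ 2 * K) * C₀ ^ 2 * ε := fun X hX => by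
    have h1 : K * θ ≤ 2 * κ ^ 2 * K * C₀ ^ 2 * ε := by
      -- The estimates are linear in `C₀`; the square in the statement is reached through `C₀ ≥ 1`.
      have h2 : C₀ ≤ C₀ ^ 2 := by nlinarith
      calc K * θ = 2 * κ ^ 2 * K * C₀ * ε := by rw [hθ]; ring
        _ ≤ _ := by gcongr
    have h3 : 0 ≤ 4 * C₀ ^ 2 * ε := by positivity
    linarith
  obtain ⟨b, hb⟩ := WaveMap.exists_smallStrichartzBound hc hσ0.le hκ (by linarith) hbound hs0
    (min_le_left _ _) (min_le_right _ _) (hθ ▸ hθ0) (hθ ▸ hθ1) (hθ ▸ hθ2) (hθ ▸ hθ3)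
  rw [← hθ] at hb
  have hθsq : θ ^ 2 ≤ θ := by nlinarith
  have hb9 := hb.le_theta (-9)
  have hb90 := hb.nonneg (-9)
  intro U A
  have hU : U = WaveMap.frameLt χ φ M (-9) := WaveMap.frame_eq_frameLt χ φ M
  -- `P_{<-9}` is `P_{≤ -9-1}`, and `-9 - 1` reduces to `-10`.
  have hA : A = fun α => WaveMap.connectionLt χ φ α (-9) := rfl
  have hUsmooth : ContDiffOn ℝ ∞ U (WaveMap.openSlab n T) := by
    rw [hU]
    exact (WaveMap.isFrameSeq_frameLt hχ hφ.tame M).contDiffOn hk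
  have hU2 : ∀ p ∈ WaveMap.slab n T, ‖U p‖ ≤ 2 := fun p hp => by
    rw [hU]
    exact hb.norm_frameLt_le hn hχ hφ hT hk hp
  have hUU : ∀ p ∈ WaveMap.slab n T, ‖(U p)ᵀ * U p - 1‖ ≤ 2 * WaveMap.kernelConst χ * θ :=
    fun p hp => by
      rw [hU]
      exact hb.norm_transpose_mul_sub_one_le hn hχ hφ hT hk hp
  have hpdtop : ∀ α, WaveMap.NormBound T ∞ ∞ (WaveMap.pd α U)
      (WaveMap.pdFrameConst χ (2 ^ s) * θ) := fun α => by
    rw [hU]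
    refine (hb.pd_frameLt_top hn hχ hφ hT α hk).mono (mul_le_mul_of_nonneg_left ?_ hP0)
    exact (WaveMap.SmallStrichartzBound.rpow_mul_le zero_le_one hb90).trans hb9
  have hpdtwo : ∀ α, WaveMap.NormBound T 2 ∞ (WaveMap.pd α U)
      (WaveMap.pdFrameConst χ (2 ^ s) * θ) := fun α => by
    rw [hU]
    refine (hb.pd_frameLt_two hn hχ hφ hT α hk).mono (mul_le_mul_of_nonneg_left ?_ hP0)
    exact (WaveMap.SmallStrichartzBound.rpow_mul_le (by norm_num) hb90).trans hb9
  refine ⟨hUsmooth, ?_, ?_, ?_, ?_, ?_, fun α => ⟨?_, ?_, ?_⟩, ?_⟩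
  · exact WaveMap.mixedNorm_top_le fun p hp =>
      (hUU p (WaveMap.openSlab_subset_slab hp)).trans (hfin _ (by gcongr; rw [hK]; linarith))
  · refine WaveMap.mixedNorm_top_le fun p hp =>
      (WaveMap.norm_pd_transpose_mul_sub_one_le hUsmooth hp 0).trans (hfin _ ?_)
    have h1 := hU2 p (WaveMap.openSlab_subset_slab hp)
    calc 2 * (‖U p‖ * ‖WaveMap.pd 0 U p‖)
        ≤ 2 * (2 * (WaveMap.pdFrameConst χ (2 ^ s) * θ)) := by
          gcongr
          exact (hpdtop 0).pointwise hp
      _ = 4 * WaveMap.pdFrameConst χ (2 ^ s) * θ := by ring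
      _ ≤ K * θ := by gcongr; rw [hK]; linarith
  · exact fun p hp => WaveMap.isUnit_of_norm_transpose_mul_sub_one ((hUU p hp).trans hθ2)
  · refine WaveMap.mixedNorm_top_le fun p hp =>
      (hU2 p (WaveMap.openSlab_subset_slab hp)).trans ?_
    have : 0 ≤ 2 * κ ^ 2 * K := by positivity
    linarith
  · refine WaveMap.mixedNorm_top_le fun p hp => ?_
    have hp' := WaveMap.openSlab_subset_slab hp
    have h1 := WaveMap.norm_inv_le ((hUU p hp').trans hθ2)
    have h2 := hU2 p hp'
    have : 0 ≤ 2 * κ ^ 2 * K := by positivity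
    linarith
  · have h1 := (hb.pd_frameLt_sub hn hχ hφ hT α hTM hk).le
    rw [← hU] at h1
    refine h1.trans (ENNReal.ofReal_le_ofReal (hfin _ ?_))
    calc _ ≤ WaveMap.connectionConst χ (2 ^ s) * θ + WaveMap.defectConst χ (2 ^ s) * θ := by gcongr
      _ = (WaveMap.connectionConst χ (2 ^ s) + WaveMap.defectConst χ (2 ^ s)) * θ := by ring
      _ ≤ K * θ := by gcongr; rw [hK]; linarith
  · exact (hpdtop α).le.trans (ENNReal.ofReal_le_ofReal
      (hfin _ (by gcongr; rw [hK]; linarith)))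
  · exact (hpdtwo α).le.trans (ENNReal.ofReal_le_ofReal
      (hfin _ (by gcongr; rw [hK]; linarith)))
  · have h1 := (hb.box_frameLt hn hχ hφ hT hk).le
    rw [← hU] at h1
    refine h1.trans (ENNReal.ofReal_le_ofReal (hfin _ ?_))
    have hle := WaveMap.lowExp_pos hn
    calc _ ≤ WaveMap.boxFrameConst χ (2 ^ s) * θ :=
          mul_le_mul_of_nonneg_left ((WaveMap.SmallStrichartzBound.rpow_mul_le (by positivity)
            (sq_nonneg θ)).trans hθsq) hB0
      _ ≤ K * θ := by gcongr; rw [hK]; linarith
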